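/- Let $I$ be an instance of the stable marriage problem with incomplete lists, with $n\ge 1$ men $U$ and $n$ women $W$, each person ranking a subset of the other side in strict order. Let $m$ be the total length of all preference lists, and let $\mathrm{rank}(x,y)$ be the position of $y$ on the list of $x$. Assume, as may be done without loss of generality, that all men and women are assigned in every stable matching of $I$. For a stable matching $M$ let $d_U(M)=\max_{u\in U}\mathrm{rank}(u,M(u))$, $d_W(M)=\max_{w\in W}\mathrm{rank}(w,M(w))$ and $r(M)=|d_U(M)-d_W(M)|$. Let $M_0$ and $M_z$ be the man-optimal and the woman-optimal stable matching, and $d_0=r(M_0)$. Rotations. For a stable matching $M$ let $s(u,M)$ be the first woman after $M(u)$ on the list of $u$ who prefers $u$ to her partner in $M$. A rotation exposed on $M$ is a cyclic sequence of distinct pairs $(u_1,w_1),\dots,(u_q,w_q)$ of $M$ with $s(u_i,M)=w_{i+1}$ (indices modulo $q$); eliminating it replaces the pairs $(u_i,w_i)$ by $(u_i,w_{i+1})$. Let $R$ be the set of all rotations exposed on some stable matching. A rotation $\rho$ precedes $\tau$ if, starting from $M_0$, $\tau$ is not exposed until $\rho$ has been eliminated; $c(S)$ denotes $S\subseteq R$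 together with all predecessors of its elements. For a set $Q'$ of rotations, $M/Q'$ is the result of eliminating them from $M$ in an order that respects precedence. Let $\phi(u,w)$ be the rotation that contains the pair $(u,w)$, and let $R_b(M)$ be the set of rotations that contain a pair $(M(w),w)$ with $\mathrm{rank}(w,M(w))=b$. Algorithm REDI. Compute $M_0$, $M_z$ and $R$. If $d_U(M_0)\ge d_W(M_0)$, return $M_0$. Set $M_{opt}\gets M_0$, then $M_{opt}\gets \mathrm{COL}(M_0,\emptyset,M_{opt})$; if $r(M_{opt})=0$, return $M_{opt}$. For each man $u$: set $M\gets M_0$, $Q\gets\emptyset$, and while $(u,M(u))\notin M_z$ and $d_U(M)<d_W(M)$: let $a\gets d_U(M)$, $Q'\gets c(\phi(u,M(u)))\setminus Q$, $M\gets M/Q'$, $Q\gets Q\cup Q'$; if now $d_U(M)>a$ and $\mathrm{rank}(u,M(u))=d_U(M)$, set $M_{opt}\gets\mathrm{COL}(M,Q,M_{opt})$ and, if $r(M_{opt})=0$, return $M_{opt}$. After the last man return $M_{opt}$. Subroutine $\mathrm{COL}(M,Q,M_{opt})$ (all variables local). Let $a\gets d_U(M)$ and repeat: if $r(M)<r(M_{opt})$,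 set $M_{opt}\gets M$; if $d_U(M)\ge d_W(M)$, return $M_{opt}$; let $b\gets d_W(M)$ and $Q'\gets c(R_b(M))\setminus Q$; if $d_U(M/Q')>a$ or $d_W(M/Q')=b$, return $M_{opt}$; otherwise $M\gets M/Q'$, $Q\gets Q\cup Q'$. Theorem. Algorithm REDI always terminates within $O(\max\{1,d_0\}\cdot n\cdot m)$ time, hence within $O(d_0nm)$ time whenever $d_0\ge 1$. Precisely: there are one program for a unit-cost random access machine (registers and arrays of natural numbers, with addition, truncated subtraction and comparison) and one constant $C$ such that, for every such $I$, given by the preference lists stored in arrays, the program halts after at most $C\cdot\max\{1,d_0\}\cdot n\cdot m$ steps, never storing a number larger than $(n+m+2)^C$ and never writing beyond that address, and on its way carries out a complete execution of REDI on $I$: its memory holds first $M_0$, $M_z$ and the list of all rotations, then in the right order the values of $M$ and $M_{opt}$ at the start of the treatment of each man, after each elimination in the while loop, and in each iteration of COL after the update of $M_{opt}$, and at the end the returned matching. -/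

import Mathlib

/-! # Instances, stable matchings, degrees -/

/-- An instance of the stable marriage problem with incomplete lists, with men `Fin n` and women
`Fin n`: everybody ranks a subset of the other side strictly. The lists need not be mutual. -/
structure SMI (n : ℕ) where
  manList : Fin n → List (Fin n)
  womanList : Fin n → List (Fin n)
  manList_nodup : ∀ i, (manList i).Nodup
  womanList_nodup : ∀ j, (womanList j).Nodup

/-- A set of man-woman pairs `(i, j)` (man first). -/
abbrev PairSet (n : ℕ) := Finset (Fin n × Fin n)

namespace SMI

variable {n : ℕ}

/-- The total length of all preference lists (men's and women's). -/
def totalLength (I : SMI n) : ℕ :=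
  ∑ i, (I.manList i).length + ∑ j, (I.womanList j).length

/-- Location (starting from 1) of woman `j` on the list of man `i`. -/
def manRank (I : SMI n) (i j : Fin n) : ℕ := (I.manList i).idxOf j + 1

/-- Location (starting from 1) of man `i` on the list of woman `j`. -/
def womanRank (I : SMI n) (j i : Fin n) : ℕ := (I.womanList j).idxOf i + 1

def Acceptable (I : SMI n) (i j : Fin n) : Prop := j ∈ I.manList i ∧ i ∈ I.womanList j

/-- Man `i` prefers woman `j` to woman `j'`. -/
def ManPrefers (I : SMI n) (i j j' : Fin n) : Prop :=
  j ∈ I.manList i ∧ j' ∈ I.manList i ∧ I.manRank i j < I.manRank i j'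

/-- Woman `j` prefers man `i` to man `i'`. -/
def WomanPrefers (I : SMI n) (j i i' : Fin n) : Prop :=
  i ∈ I.womanList j ∧ i' ∈ I.womanList j ∧ I.womanRank j i < I.womanRank j i'

def IsMatching (I : SMI n) (M : PairSet n) : Prop :=
  (∀ i j, (i, j) ∈ M → I.Acceptable i j) ∧
  (∀ i j j', (i, j) ∈ M → (i, j') ∈ M → j = j') ∧
  (∀ i i' j, (i, j) ∈ M → (i', j) ∈ M → i = i')

/-- `(i, j)` is acceptable, `i` is unmatched or prefers `j` to his partner, and `j` is unmatched or
prefers `i` to her partner. -/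
def Blocking (I : SMI n) (M : PairSet n) (i j : Fin n) : Prop :=
  I.Acceptable i j ∧
  ((∀ j', (i, j') ∉ M) ∨ ∃ j', (i, j') ∈ M ∧ I.ManPrefers i j j') ∧
  ((∀ i', (i', j) ∉ M) ∨ ∃ i', (i', j) ∈ M ∧ I.WomanPrefers j i i')

def IsStable (I : SMI n) (M : PairSet n) : Prop :=
  I.IsMatching M ∧ ∀ i j, ¬ I.Blocking M i j

/-- All men and women are assigned in any stable matching. -/
def AllAssigned (I : SMI n) : Prop :=
  ∀ M, I.IsStable M → (∀ i, ∃ j, (i, j) ∈ M) ∧ (∀ j, ∃ i, (i, j) ∈ M)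

/-- The stable matching in which each man has his most-preferred woman in any stable matching. -/
def IsManOptimal (I : SMI n) (M : PairSet n) : Prop :=
  I.IsStable M ∧ ∀ M', I.IsStable M' → ∀ i j', (i, j') ∈ M' →
    ∃ j, (i, j) ∈ M ∧ I.manRank i j ≤ I.manRank i j'

/-- The stable matching in which each woman has her most-preferred man in any stable matching. -/
def IsWomanOptimal (I : SMI n) (M : PairSet n) : Prop :=
  I.IsStable M ∧ ∀ M', I.IsStable M' → ∀ i' j, (i', j) ∈ M' →
    ∃ i, (i, j) ∈ M ∧ I.womanRank j i ≤ I.womanRank j i'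

/-- The man-degree `d_U(M)`. -/
def manDegree (I : SMI n) (M : PairSet n) : ℕ := M.sup fun p => I.manRank p.1 p.2

/-- The woman-degree `d_W(M)`. -/
def womanDegree (I : SMI n) (M : PairSet n) : ℕ := M.sup fun p => I.womanRank p.2 p.1

/-- The regret-equality score `r(M) = |d_U(M) - d_W(M)|`. -/
def regretScore (I : SMI n) (M : PairSet n) : ℕ :=
  ((I.manDegree M : ℤ) - (I.womanDegree M : ℤ)).natAbs

/-! # Rotations -/

/-- `IsNext I M i j`: `j = s(i, M)` is the first woman after the partner of `i` on the list of `i`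
who prefers `i` to her own partner in `M`. -/
def IsNext (I : SMI n) (M : PairSet n) (i j : Fin n) : Prop :=
  ∃ j₀, (i, j₀) ∈ M ∧ I.ManPrefers i j₀ j ∧
    (∃ i', (i', j) ∈ M ∧ I.WomanPrefers j i i') ∧
    ∀ k, I.ManPrefers i j₀ k → I.ManPrefers i k j →
      ¬ ∃ i', (i', k) ∈ M ∧ I.WomanPrefers k i i'

/-- `ElimOne I M ρ M'`: the rotation `ρ = {(μ₀, ω₀), …, (μ_q, ω_q)}` is exposed on `M`, that is, its
pairs belong to `M` and `s(μ_i, M) = ω_{i+1}` (cyclically); and eliminating it yields `M'`, where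
the pairs of `ρ` are replaced by the pairs `(μ_i, ω_{i+1})`. A rotation is recorded as its set of
pairs; `i + 1` in `Fin (q + 1)` is addition modulo `q + 1`. -/
def ElimOne (I : SMI n) (M ρ M' : PairSet n) : Prop :=
  ∃ (q : ℕ) (μ ω : Fin (q + 1) → Fin n),
    Function.Injective μ ∧
    ρ = Finset.univ.image (fun i => (μ i, ω i)) ∧
    ρ ⊆ M ∧
    (∀ i, I.IsNext M (μ i) (ω (i + 1))) ∧
    M' = (M \ ρ) ∪ Finset.univ.image (fun i => (μ i, ω (i + 1)))

def Exposed (I : SMI n) (M ρ : PairSet n) : Prop := ∃ M', I.ElimOne M ρ M'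

/-- The set `R` of all rotations: those exposed on some stable matching. -/
def rotations (I : SMI n) : Set (PairSet n) := {ρ | ∃ M, I.IsStable M ∧ I.Exposed M ρ}

/-- Eliminating the rotations of a list, one after the other, each being exposed when its turn
comes. -/
inductive ElimSeq (I : SMI n) : PairSet n → List (PairSet n) → PairSet n → Prop
  | nil (M : PairSet n) : ElimSeq I M [] M
  | cons {M ρ M₁ M₂ : PairSet n} {L : List (PairSet n)} :
      I.ElimOne M ρ M₁ → ElimSeq I M₁ L M₂ → ElimSeq I M (ρ :: L) M₂

/-- `ρ` precedes `τ`: starting from the man-optimal stable matching, `τ` is not exposed until `ρ`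
has been eliminated. -/
def Precedes (I : SMI n) (ρ τ : PairSet n) : Prop :=
  ∀ M₀, I.IsManOptimal M₀ → ∀ L M, I.ElimSeq M₀ L M → I.Exposed M τ → ρ ∈ L

/-- The closure `c(S)` of a set of rotations in the rotation poset. -/
def rotClosure (I : SMI n) (S : Set (PairSet n)) : Set (PairSet n) :=
  {σ | σ ∈ I.rotations ∧ ∃ τ ∈ S, σ = τ ∨ I.Precedes σ τ}

/-- `R_b(M)`: the rotations that contain a pair `(M(w), w)` in which the woman `w` has rank `b` in
`M`. -/
def rotationsAt (I : SMI n) (M : PairSet n) (b : ℕ) : Set (PairSet n) :=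
  {σ | σ ∈ I.rotations ∧ ∃ i j, (i, j) ∈ σ ∧ (i, j) ∈ M ∧ I.womanRank j i = b}

/-- `M' = M / Q`: the rotations of `Q`, each once, are eliminated from `M` in an admissible order. -/
def Elim (I : SMI n) (M : PairSet n) (Q : Set (PairSet n)) (M' : PairSet n) : Prop :=
  ∃ L : List (PairSet n), L.Nodup ∧ (∀ ρ, ρ ∈ L ↔ ρ ∈ Q) ∧ I.ElimSeq M L M'

/-! # The algorithm, line by line

The relations below are the big-step semantics of the pseudocode of REDI and of its subroutine
REDI-COL. They record the sequence of the values taken by the variables. -/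

/-- What an execution records: the results of the setup (man-optimal stable matching, woman-optimal
stable matching, and all rotations), and later the values of the variables `M` and `M_opt`. -/
inductive Event (n : ℕ)
  | setup (M₀ Mz : PairSet n)
  | vars (M Mopt : PairSet n)

/-- The value of `M_opt` after: if `r(M) < r(M_opt)` then `M_opt ← M`. -/
def best (I : SMI n) (M Mopt : PairSet n) : PairSet n :=
  if I.regretScore M < I.regretScore Mopt then M else Mopt

/-- The while loop of REDI-COL, with `a` the man-degree at the time of the call.
`ColRun I a M Q Mopt ev res`: started with local values `M`, `Q`, `Mopt`, it returns `res`. -/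
inductive ColRun (I : SMI n) (a : ℕ) :
    PairSet n → Set (PairSet n) → PairSet n → List (Event n) → PairSet n → Prop
  | degreeStop {M Q Mopt} :
      I.womanDegree M ≤ I.manDegree M →
      ColRun I a M Q Mopt [.vars M (I.best M Mopt)] (I.best M Mopt)
  | elimStop {M Q Mopt Q' M'} :
      I.manDegree M < I.womanDegree M →
      Q' = I.rotClosure (I.rotationsAt M (I.womanDegree M)) \ Q →
      I.Elim M Q' M' →
      (a < I.manDegree M' ∨ I.womanDegree M' = I.womanDegree M) →
      ColRun I a M Q Mopt [.vars M (I.best M Mopt)] (I.best M Mopt)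
  | step {M Q Mopt Q' M' ev res} :
      I.manDegree M < I.womanDegree M →
      Q' = I.rotClosure (I.rotationsAt M (I.womanDegree M)) \ Q →
      I.Elim M Q' M' →
      ¬ (a < I.manDegree M' ∨ I.womanDegree M' = I.womanDegree M) →
      ColRun I a M' (Q ∪ Q') (I.best M Mopt) ev res →
      ColRun I a M Q Mopt (.vars M (I.best M Mopt) :: ev) res

/-- The condition of the while loop of REDI for man `i`, whose partner in `M` is `j`. -/
def LoopCond (I : SMI n) (Mz : PairSet n) (i : Fin n) (M : PairSet n) (j : Fin n) : Prop :=
  (i, j) ∈ M ∧ (i, j) ∉ Mz ∧ I.manDegree M < I.womanDegree M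

/-- The assignments in the body of the while loop: `ρ = φ(i, M(i))` is the rotation that contains
the pair of `i`, `Q' = c(ρ) \ Q`, and `M' = M / Q'`. -/
def Move (I : SMI n) (i j : Fin n) (M : PairSet n) (Q Q' : Set (PairSet n)) (M' : PairSet n) :
    Prop :=
  ∃ ρ ∈ I.rotations, (i, j) ∈ ρ ∧ Q' = I.rotClosure {ρ} \ Q ∧ I.Elim M Q' M'

/-- The condition for a column operation after a move from `M` to `M'`: the man-degree has
increased, and `i` is a worst ranked man in `M'`. -/
def ColCond (I : SMI n) (i : Fin n) (M M' : PairSet n) : Prop :=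
  I.manDegree M < I.manDegree M' ∧ ∃ j, (i, j) ∈ M' ∧ I.manRank i j = I.manDegree M'

/-- The while loop of REDI for man `i`. `ManRun I Mz i M Q Mopt ev res halted`: started with the values
`M`, `Q`, `Mopt`, it ends with the value `res` of `M_opt`, and `halted` tells whether the whole
algorithm returns there (because `r(M_opt) = 0`). -/
inductive ManRun (I : SMI n) (Mz : PairSet n) (i : Fin n) :
    PairSet n → Set (PairSet n) → PairSet n → List (Event n) → PairSet n → Bool → Prop
  | exit {M Q Mopt} : (¬ ∃ j, I.LoopCond Mz i M j) → ManRun I Mz i M Q Mopt [] Mopt false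
  | move {M Q Mopt j Q' M' ev res halted} :
      I.LoopCond Mz i M j → I.Move i j M Q Q' M' → ¬ I.ColCond i M M' →
      ManRun I Mz i M' (Q ∪ Q') Mopt ev res halted →
      ManRun I Mz i M Q Mopt (.vars M' Mopt :: ev) res halted
  | column {M Q Mopt j Q' M' evc Mopt' ev res halted} :
      I.LoopCond Mz i M j → I.Move i j M Q Q' M' → I.ColCond i M M' →
      ColRun I (I.manDegree M') M' (Q ∪ Q') Mopt evc Mopt' → I.regretScore Mopt' ≠ 0 →
      ManRun I Mz i M' (Q ∪ Q') Mopt' ev res halted →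
      ManRun I Mz i M Q Mopt (.vars M' Mopt :: (evc ++ ev)) res halted
  | columnReturn {M Q Mopt j Q' M' evc Mopt'} :
      I.LoopCond Mz i M j → I.Move i j M Q Q' M' → I.ColCond i M M' →
      ColRun I (I.manDegree M') M' (Q ∪ Q') Mopt evc Mopt' → I.regretScore Mopt' = 0 →
      ManRun I Mz i M Q Mopt (.vars M' Mopt :: evc) Mopt' true

/-- The for loop of REDI over the men of a list; for each of them `M ← M₀` and `Q ← ∅` first. -/
inductive MenRun (I : SMI n) (M₀ Mz : PairSet n) :
    List (Fin n) → PairSet n → List (Event n) → PairSet n → Prop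
  | done {Mopt} : MenRun I M₀ Mz [] Mopt [] Mopt
  | next {i l Mopt ev Mopt' ev' res} :
      ManRun I Mz i M₀ ∅ Mopt ev Mopt' false → MenRun I M₀ Mz l Mopt' ev' res →
      MenRun I M₀ Mz (i :: l) Mopt (.vars M₀ Mopt :: (ev ++ ev')) res
  | ret {i l Mopt ev Mopt'} :
      ManRun I Mz i M₀ ∅ Mopt ev Mopt' true →
      MenRun I M₀ Mz (i :: l) Mopt (.vars M₀ Mopt :: ev) Mopt'

/-- `RediRun I M₀ ev out`: a complete execution of REDI on `I`, with man-optimal stable matching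
`M₀`, recorded events `ev` and returned matching `out`. -/
inductive RediRun (I : SMI n) (M₀ : PairSet n) : List (Event n) → PairSet n → Prop
  | returnManOptimal {Mz} :
      I.IsManOptimal M₀ → I.IsWomanOptimal Mz → I.womanDegree M₀ ≤ I.manDegree M₀ →
      RediRun I M₀ [.setup M₀ Mz] M₀
  | returnFirst {Mz evc Mopt} :
      I.IsManOptimal M₀ → I.IsWomanOptimal Mz → I.manDegree M₀ < I.womanDegree M₀ →
      ColRun I (I.manDegree M₀) M₀ ∅ M₀ evc Mopt → I.regretScore Mopt = 0 →
      RediRun I M₀ (.setup M₀ Mz :: evc) Mopt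
  | returnLater {Mz evc Mopt ev out} :
      I.IsManOptimal M₀ → I.IsWomanOptimal Mz → I.manDegree M₀ < I.womanDegree M₀ →
      ColRun I (I.manDegree M₀) M₀ ∅ M₀ evc Mopt → I.regretScore Mopt ≠ 0 →
      MenRun I M₀ Mz (List.finRange n) Mopt ev out →
      RediRun I M₀ (.setup M₀ Mz :: (evc ++ ev)) out

end SMI

/-! # The machine: unit-cost RAM programs with bounded words -/

namespace Ram

/-- The memory: numbered scalar registers and numbered arrays of natural numbers. -/
structure Store where
  var : ℕ → ℕ
  arr : ℕ → ℕ → ℕ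

def Store.setVar (s : Store) (x v : ℕ) : Store :=
  { s with var := Function.update s.var x v }

def Store.setArr (s : Store) (a k v : ℕ) : Store :=
  { s with arr := Function.update s.arr a (Function.update (s.arr a) k v) }

inductive Expr
  | const (k : ℕ)
  | var (x : ℕ)
  | read (a : ℕ) (index : Expr)
  | add (e f : Expr)
  | sub (e f : Expr)
  | lt (e f : Expr)
  | eq (e f : Expr)

/-- Subtraction is truncated; comparisons return 1 (true) or 0 (false). -/
def Expr.eval (s : Store) : Expr → ℕ
  | .const k => k
  | .var x => s.var x
  | .read a e => s.arr a (e.eval s)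
  | .add e f => e.eval s + f.eval s
  | .sub e f => e.eval s - f.eval s
  | .lt e f => if e.eval s < f.eval s then 1 else 0
  | .eq e f => if e.eval s = f.eval s then 1 else 0

/-- Every operation in an expression takes one step. -/
def Expr.cost : Expr → ℕ
  | .const _ => 1
  | .var _ => 1
  | .read _ e => e.cost + 1
  | .add e f => e.cost + f.cost + 1
  | .sub e f => e.cost + f.cost + 1
  | .lt e f => e.cost + f.cost + 1
  | .eq e f => e.cost + f.cost + 1

/-- Programs. `observe` changes nothing: it only appends the present memory to the log of the
execution, which the program itself cannot read. -/
inductive Com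
  | skip
  | assign (x : ℕ) (e : Expr)
  | write (a : ℕ) (index e : Expr)
  | seq (c d : Com)
  | ite (e : Expr) (c d : Com)
  | loop (e : Expr) (c : Com)
  | observe

/-- `Exec B c s log t s'`: started in the memory `s`, the program `c` halts after exactly `t` steps
in the memory `s'`, having logged `log`. The largest number that fits into a memory word is `B`: an
execution that tries to store a larger number, or to write beyond address `B`, does not count. -/
inductive Exec (B : ℕ) : Com → Store → List Store → ℕ → Store → Prop
  | skip {s} : Exec B .skip s [] 1 s
  | assign {s x e} : e.eval s ≤ B → Exec B (.assign x e) s [] (e.cost + 1) (s.setVar x (e.eval s))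
  | write {s a k e} : k.eval s ≤ B → e.eval s ≤ B →
      Exec B (.write a k e) s [] (k.cost + e.cost + 1) (s.setArr a (k.eval s) (e.eval s))
  | seq {s s₁ s₂ c d l₁ l₂ t₁ t₂} : Exec B c s l₁ t₁ s₁ → Exec B d s₁ l₂ t₂ s₂ →
      Exec B (.seq c d) s (l₁ ++ l₂) (t₁ + t₂) s₂
  | iteTrue {s s₁ e c d l t} : e.eval s ≠ 0 → Exec B c s l t s₁ →
      Exec B (.ite e c d) s l (e.cost + 1 + t) s₁
  | iteFalse {s s₁ e c d l t} : e.eval s = 0 → Exec B d s l t s₁ →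
      Exec B (.ite e c d) s l (e.cost + 1 + t) s₁
  | loopExit {s e c} : e.eval s = 0 → Exec B (.loop e c) s [] (e.cost + 1) s
  | loopStep {s s₁ s₂ e c l₁ l₂ t₁ t₂} : e.eval s ≠ 0 → Exec B c s l₁ t₁ s₁ →
      Exec B (.loop e c) s₁ l₂ t₂ s₂ →
      Exec B (.loop e c) s (l₁ ++ l₂) (e.cost + 1 + t₁ + t₂) s₂
  | observe {s} : Exec B .observe s [s] 1 s

/-- Position, in the concatenation of all lists, at which the list number `k` starts. -/
def startOf {n : ℕ} (l : Fin n → List (Fin n)) (k : ℕ) : ℕ :=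
  ((List.ofFn l).take k).flatten.length

/-- Entry number `k` of the concatenation of all lists (0 beyond its end). -/
def entryOf {n : ℕ} (l : Fin n → List (Fin n)) (k : ℕ) : ℕ :=
  ((List.ofFn l).flatten.map Fin.val).getD k 0

/-- The initial memory on input `I`: register 0 holds `n`; arrays 0 and 1 hold the starting
positions and the entries of the concatenated preference lists of the men, arrays 2 and 3 those of
the women; everything else is 0. -/
def inputStore {n : ℕ} (I : SMI n) : Store where
  var x := if x = 0 then n else 0
  arr a k :=
    if a = 0 then (if k ≤ n then startOf I.manList k else 0)
    else if a = 1 then entryOf I.manList k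
    else if a = 2 then (if k ≤ n then startOf I.womanList k else 0)
    else if a = 3 then entryOf I.womanList k
    else 0

/-- The array holds, for each man, his partner in `M`. -/
def HoldsMatching {n : ℕ} (f : ℕ → ℕ) (M : PairSet n) : Prop :=
  ∀ i j : Fin n, (i, j) ∈ M ↔ f i = j

/-- The pairs stored in block number `k` of a list of rotations, with starting positions in array 7,
men in array 8 and women in array 9. -/
def rotationBlock (n : ℕ) (s : Store) (k : ℕ) : Set (Fin n × Fin n) :=
  {p | ∃ x, s.arr 7 k ≤ x ∧ x < s.arr 7 (k + 1) ∧ s.arr 8 x = p.1 ∧ s.arr 9 x = p.2}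

/-- The memory holds the list of all rotations of `I`, without repetition; register 1 holds their
number. -/
def HoldsRotations {n : ℕ} (I : SMI n) (s : Store) : Prop :=
  (∀ ρ : PairSet n, ρ ∈ I.rotations ↔
    ∃ k, k < s.var 1 ∧ rotationBlock n s k = (ρ : Set (Fin n × Fin n))) ∧
  ∀ k l, k < s.var 1 → l < s.var 1 → rotationBlock n s k = rotationBlock n s l → k = l

/-- The memory holds the values recorded by an event: `M` in array 4, `M_opt` in array 5, and in
the setup the woman-optimal stable matching in array 6 and the list of all rotations. -/
def Displays {n : ℕ} (I : SMI n) : SMI.Event n → Store → Prop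
  | .setup M₀ Mz, s => HoldsMatching (s.arr 4) M₀ ∧ HoldsMatching (s.arr 6) Mz ∧ HoldsRotations I s
  | .vars M Mopt, s => HoldsMatching (s.arr 4) M ∧ HoldsMatching (s.arr 5) Mopt

/-- `CarriesOut B P I M₀ t`: within word bound `B`, the program `P` on input `I` carries out a
complete execution of REDI (with man-optimal stable matching `M₀`) and halts after exactly `t` steps:
it passes, in this order, through memories that hold the successive values of the variables of that
execution, and halts with the returned matching in array 5. -/
def CarriesOut {n : ℕ} (B : ℕ) (P : Com) (I : SMI n) (M₀ : PairSet n) (t : ℕ) : Prop :=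
  ∃ (ev : List (SMI.Event n)) (out : PairSet n) (log : List Store) (s : Store),
    I.RediRun M₀ ev out ∧ Exec B P (inputStore I) log t s ∧
      List.Forall₂ (Displays I) ev log ∧ HoldsMatching (s.arr 5) out

end Ram

/-! A program must be shown to compute exactly the values that REDI prescribes, and to pay little
for them.

Correctness rests on the lattice of stable matchings. All of them are perfect, hence permutations,
ordered by the men's preferences (`Dom`). To a stable `M` belongs the set `past I M` of the
rotations passed on the way to it. Eliminating `ρ` adds exactly `ρ` (`past_step`), so the variable
`Q` of REDI always equals `past I M`, and whenever `M` dominates `N`, the matching `N` results from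
`M` by eliminating `past I N \ past I M` (`elim_past`). The program never computes a closure. To
eliminate `c(φ(u, M(u))) \ Q` it searches for the best stable matching below `M` in which `u` has
another partner. That this is the same is `past_break`, proved with meets of stable matchings. A
column operation breaks the pairs of rank `b` one after the other, and `rotClosure_rotationsAt_diff`
identifies the result with the elimination of `c(R_b(M)) \ Q`.

The time bound is an amortised one. The pointers of the men only move down their lists, so all
eliminations that start from one matching take time linear in the total length `m` of the lists
(`slack`, `brk_spec`). The woman-degree is read off a list of positions sorted by rank, by a pointer
that only descends (`findDegree_spec`). Apart from updates of `M_opt`, a column operation therefore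
takes `O(m)`, and so does the while loop of one man without its column operations. The while loop
calls a column operation only after the man-degree has grown from a value below `d_W(M) ≤ d_W(M₀)`,
hence at most `d₀` times for each man; with `n` men this gives `O(d₀ n m)`. Replacing `M_opt` costs
`O(n)` but lowers `r(M_opt)`, so it happens at most `d₀` times in the whole run. The tables, the
sorting, deferred acceptance and the list of all rotations cost `O(n m)`, which explains the factor
`max {1, d₀}`.

Both claims are proved together, by weakest preconditions that carry the log and the number of steps
left. The postconditions build the derivation of the run of REDI while the program proceeds. -/

namespace SMI

/-! ### The lattice of stable matchings and single rotation eliminations. -/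

variable {n : ℕ} {I : SMI n} {M N K M' M₀ : Equiv.Perm (Fin n)}

/-! # Perfect matchings as permutations -/

/-- The set of pairs of a perfect matching. -/
def graph (M : Equiv.Perm (Fin n)) : PairSet n := Finset.univ.image fun i => (i, M i)

@[simp] theorem mem_graph {p : Fin n × Fin n} : p ∈ graph M ↔ M p.1 = p.2 := by
  obtain ⟨i, j⟩ := p
  simp [graph]

theorem graph_injective (h : graph M = graph N) : M = N := by
  ext i
  have : (i, M i) ∈ graph N := h ▸ (by simp)
  simp at this
  rw [this]

/-- For an absent entry `idxOf` returns the length of the list, so its rank lies one beyond the end.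
A rank not exceeding that of a listed entry thus certifies membership, and rank comparisons replace
membership tests from here on. -/
theorem manRank_le_iff {i j : Fin n} : I.manRank i j ≤ (I.manList i).length ↔ j ∈ I.manList i := by
  unfold manRank
  rw [Nat.add_one_le_iff, List.idxOf_lt_length_iff]

theorem womanRank_le_iff {i j : Fin n} :
    I.womanRank j i ≤ (I.womanList j).length ↔ i ∈ I.womanList j := by
  unfold womanRank
  rw [Nat.add_one_le_iff, List.idxOf_lt_length_iff]

theorem womanRank_le (I : SMI n) (i j : Fin n) :
    I.womanRank j i ≤ (I.womanList j).length + 1 := by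
  unfold womanRank
  exact Nat.succ_le_succ List.idxOf_le_length

theorem mem_manList_of_le {i j j' : Fin n} (h : j' ∈ I.manList i)
    (hle : I.manRank i j ≤ I.manRank i j') : j ∈ I.manList i :=
  manRank_le_iff.1 (hle.trans (manRank_le_iff.2 h))

theorem mem_womanList_of_le {i i' j : Fin n} (h : i' ∈ I.womanList j)
    (hle : I.womanRank j i ≤ I.womanRank j i') : i ∈ I.womanList j :=
  womanRank_le_iff.1 (hle.trans (womanRank_le_iff.2 h))

theorem manRank_inj {i j j' : Fin n} (h : j ∈ I.manList i)
    (e : I.manRank i j = I.manRank i j') : j = j' :=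
  (List.idxOf_inj h).1 (Nat.succ_injective e)

theorem womanRank_inj {i i' j : Fin n} (h : i ∈ I.womanList j)
    (e : I.womanRank j i = I.womanRank j i') : i = i' :=
  (List.idxOf_inj h).1 (Nat.succ_injective e)

/-- Stability of a perfect matching. -/
structure Stab (I : SMI n) (M : Equiv.Perm (Fin n)) : Prop where
  mem_man : ∀ i, M i ∈ I.manList i
  mem_woman : ∀ i, i ∈ I.womanList (M i)
  stable : ∀ i j, I.manRank i j < I.manRank i (M i) →
    I.womanRank j (M.symm j) ≤ I.womanRank j i

theorem Stab.mem_woman' (hM : Stab I M) (j : Fin n) : M.symm j ∈ I.womanList j := by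
  simpa using hM.mem_woman (M.symm j)

theorem Stab.stable_lt (hM : Stab I M) {i j : Fin n} (h : I.manRank i j < I.manRank i (M i)) :
    I.womanRank j (M.symm j) < I.womanRank j i := by
  refine lt_of_le_of_ne (hM.stable i j h) fun e => ?_
  have := womanRank_inj (hM.mem_woman' j) e
  rw [← this] at h
  simp at h

/-- `Stab` need not demand that a blocking pair be acceptable: its members prefer each other to
listed partners, so the rank comparisons already place them on each other's lists. -/
theorem isStable_graph_iff : I.IsStable (graph M) ↔ Stab I M := by
  constructor
  · rintro ⟨⟨hacc, -, -⟩, hb⟩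
    have ha : ∀ i, I.Acceptable i (M i) := fun i => hacc _ _ (by simp)
    refine ⟨fun i => (ha i).1, fun i => (ha i).2, fun i j h => ?_⟩
    by_contra! hc
    have hj : j ∈ I.manList i := mem_manList_of_le (ha i).1 h.le
    have hw : M.symm j ∈ I.womanList j := by simpa using (ha (M.symm j)).2
    have hi : i ∈ I.womanList j := mem_womanList_of_le hw hc.le
    exact hb i j ⟨⟨hj, hi⟩, Or.inr ⟨M i, by simp, hj, (ha i).1, h⟩,
      Or.inr ⟨M.symm j, by simp, hi, hw, hc⟩⟩
  · intro hM
    refine ⟨⟨?_, ?_, ?_⟩, ?_⟩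
    · intro i j h
      simp at h
      subst h
      exact ⟨hM.mem_man i, hM.mem_woman i⟩
    · intro i j j' h h'
      simp at h h'
      rw [← h, ← h']
    · intro i i' j h h'
      simp at h h'
      exact M.injective (h.trans h'.symm)
    · rintro i j ⟨-, h1, h2⟩
      rcases h1 with h1 | ⟨j', h1, h1'⟩
      · exact h1 (M i) (by simp)
      rcases h2 with h2 | ⟨i', h2, h2'⟩
      · exact h2 (M.symm j) (by simp)
      simp at h1 h2
      subst h1
      obtain rfl : i' = M.symm j := by rw [← h2]; simp
      exact absurd h2'.2.2 (not_lt.2 (hM.stable i j h1'.2.2))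

/-- Here the hypothesis that everybody is assigned is spent: it turns stable sets of pairs into
permutations. -/
theorem exists_graph_eq (hI : I.AllAssigned) {A : PairSet n} (hA : I.IsStable A) :
    ∃ M, A = graph M ∧ Stab I M := by
  obtain ⟨h1, h2⟩ := hI A hA
  choose f hf using h1
  have hinj : Function.Injective f := fun i i' e => hA.1.2.2 i i' (f i) (hf i) (e ▸ hf i')
  let M : Equiv.Perm (Fin n) := Equiv.ofBijective f (Finite.injective_iff_bijective.1 hinj)
  have hg : A = graph M := by
    ext ⟨i, j⟩
    rw [mem_graph]
    change _ ↔ f i = j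
    exact ⟨fun h => hA.1.2.1 i _ _ (hf i) h, fun h => h ▸ hf i⟩
  exact ⟨M, hg, isStable_graph_iff.1 (hg ▸ hA)⟩

/-- Every man likes his partner in `M` at least as much as the one in `N`. -/
def Dom (I : SMI n) (M N : Equiv.Perm (Fin n)) : Prop :=
  ∀ i, I.manRank i (M i) ≤ I.manRank i (N i)

theorem Dom.refl (I : SMI n) (M : Equiv.Perm (Fin n)) : I.Dom M M := fun _ => le_rfl

theorem Dom.trans (h : I.Dom M N) (h' : I.Dom N K) : I.Dom M K := fun i => (h i).trans (h' i)

theorem Stab.eq_of_rank (hM : Stab I M) {i : Fin n} (h : I.manRank i (M i) = I.manRank i (N i)) :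
    M i = N i := manRank_inj (hM.mem_man i) h

theorem Dom.lt_of_ne (hM : Stab I M) (h : I.Dom M N) {i : Fin n} (hne : N i ≠ M i) :
    I.manRank i (M i) < I.manRank i (N i) :=
  lt_of_le_of_ne (h i) fun e => hne (hM.eq_of_rank e).symm

/-! # The decomposition lemma and meets -/

theorem Stab.woman_lt (hN : Stab I N) {i : Fin n}
    (h : I.manRank i (M i) < I.manRank i (N i)) :
    I.womanRank (M i) (N.symm (M i)) < I.womanRank (M i) i :=
  hN.stable_lt h

/-- Stability of `N` makes the woman `M i` prefer her husband in `N` to `i`. If this husband did not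
prefer his own partner in `M` to her, the two would block `M`. -/
theorem Stab.man_lt (hM : Stab I M) (hN : Stab I N) {i : Fin n}
    (h : I.manRank i (M i) < I.manRank i (N i)) :
    I.manRank (N.symm (M i)) (M (N.symm (M i))) < I.manRank (N.symm (M i)) (M i) := by
  set i' := N.symm (M i) with hi'
  have hNi : N i' = M i := by simp [hi']
  have hw := hN.woman_lt h
  rw [← hi'] at hw
  rcases lt_trichotomy (I.manRank i' (M i')) (I.manRank i' (M i)) with h1 | h1 | h1
  · exact h1
  · have : M i' = M i := manRank_inj (hM.mem_man i') h1
    have : i' = i := M.injective this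
    rw [this] at hw
    exact absurd hw (lt_irrefl _)
  · have := hM.stable_lt h1
    simp at this
    exact absurd this (not_lt.2 hw.le)

/-- If `i` prefers `M` to `N` then his partner in `N` prefers `N` to `M`. -/
theorem Stab.woman_lt' (hM : Stab I M) (hN : Stab I N) {i : Fin n}
    (h : I.manRank i (M i) < I.manRank i (N i)) :
    I.womanRank (N i) i < I.womanRank (N i) (M.symm (N i)) := by
  let A : Finset (Fin n) := Finset.univ.filter fun i => I.manRank i (M i) < I.manRank i (N i)
  have hmaps : ∀ a ∈ A, N.symm (M a) ∈ A := by
    intro a ha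
    simp only [A, Finset.mem_filter, Finset.mem_univ, true_and] at ha ⊢
    simpa using hM.man_lt hN ha
  -- An injective self-map of a finite set is onto, so the woman `N i` is the `M`-partner of some
  -- man of `A`, and `woman_lt` applies to him.
  have hsurj := Finset.surjOn_of_injOn_of_card_le (s := A) (t := A) (fun a => N.symm (M a))
    hmaps (fun a _ b _ e => by simpa using e) le_rfl
  obtain ⟨a, ha, hai⟩ := hsurj (show i ∈ (A : Set (Fin n)) by simpa [A] using h)
  have ha' : I.manRank a (M a) < I.manRank a (N a) := by simpa [A] using ha
  have hNi : N i = M a := by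
    rw [← hai]; simp
  have := hN.woman_lt ha'
  rw [hNi]
  simp only [Equiv.symm_apply_apply] at *
  rwa [hai] at this

/-- If her husband in `M` kept her, nothing would change for the woman; if he preferred `N`, then
`woman_lt'` with the roles of `M` and `N` exchanged would make her prefer `M`. Both contradict her
gain. -/
theorem Stab.rank_of_woman_lt (hM : Stab I M) (hN : Stab I N) {j : Fin n}
    (h : I.womanRank j (N.symm j) < I.womanRank j (M.symm j)) :
    I.manRank (M.symm j) j < I.manRank (M.symm j) (N (M.symm j)) := by
  rcases lt_trichotomy (I.manRank (M.symm j) j) (I.manRank (M.symm j) (N (M.symm j)))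
    with h1 | h1 | h1
  · exact h1
  · have : j = N (M.symm j) := by
      refine manRank_inj ?_ h1
      simpa using hM.mem_man (M.symm j)
    have : N.symm j = M.symm j := by rw [Equiv.symm_apply_eq]; exact this
    rw [this] at h
    exact absurd h (lt_irrefl _)
  · have := hN.woman_lt' hM (i := M.symm j) (by simpa using h1)
    simp at this
    exact absurd this (not_lt.2 h.le)

/-- The interests of the two sides are opposed: the husband of `j` in `N` is either unchanged or
worse off than in `M`, and then `woman_lt'` applies to him. -/
theorem Dom.womanRank_le (hM : Stab I M) (hN : Stab I N) (h : I.Dom M N) (j : Fin n) :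
    I.womanRank j (N.symm j) ≤ I.womanRank j (M.symm j) := by
  by_cases e : N (N.symm j) = M (N.symm j)
  · have : M.symm j = N.symm j := by rw [Equiv.symm_apply_eq, ← e]; simp
    rw [this]
  · have := hM.woman_lt' hN (Dom.lt_of_ne hM h e)
    simpa using this.le

/-- The stable matching in which each man has the worse one of two partners. -/
theorem exists_meet (hM : Stab I M) (hN : Stab I N) :
    ∃ K, Stab I K ∧ ∀ i, I.manRank i (K i) = max (I.manRank i (M i)) (I.manRank i (N i)) := by
  let f : Fin n → Fin n := fun i => if I.manRank i (M i) < I.manRank i (N i) then N i else M i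
  -- No woman is assigned twice. If `a` takes his worse partner `N a = M b`, she gains in `N`, so
  -- her husband `b` in `M` loses in `N` and would have taken `N b`.
  have key : ∀ a b, I.manRank a (M a) < I.manRank a (N a) →
      ¬ I.manRank b (M b) < I.manRank b (N b) → N a = M b → False := by
    intro a b ha hb e
    have h1 := hM.woman_lt' hN ha
    have h2 := hM.rank_of_woman_lt hN (j := N a) (by simpa using h1)
    rw [e] at h2
    simp at h2
    exact hb h2
  have hinj : Function.Injective f := by
    intro a b e
    simp only [f] at e
    split_ifs at e with h1 h2 h2
    · exact N.injective e
    · exact (key a b h1 h2 e).elim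
    · exact (key b a h2 h1 e.symm).elim
    · exact M.injective e
  let K : Equiv.Perm (Fin n) := Equiv.ofBijective f (Finite.injective_iff_bijective.1 hinj)
  have hK : ∀ i, K i = if I.manRank i (M i) < I.manRank i (N i) then N i else M i := fun i => rfl
  have hr : ∀ i, I.manRank i (K i) = max (I.manRank i (M i)) (I.manRank i (N i)) := by
    intro i
    rw [hK]
    split_ifs with h
    · rw [max_eq_right h.le]
    · rw [max_eq_left (not_lt.1 h)]
  -- Each woman gets the better of her two husbands. A pair that blocked `K` would therefore block
  -- `M` or `N`.
  have hs : ∀ j, K.symm j = N.symm j ∧ I.womanRank j (N.symm j) ≤ I.womanRank j (M.symm j) ∨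
      K.symm j = M.symm j ∧ I.womanRank j (M.symm j) ≤ I.womanRank j (N.symm j) := by
    intro j
    have hj := hK (K.symm j)
    split_ifs at hj with h
    · left
      have e : K.symm j = N.symm j := by rw [Equiv.eq_symm_apply, ← hj]; simp
      have h1 := hM.woman_lt' hN h
      rw [e] at h1
      simp at h1
      exact ⟨e, h1.le⟩
    · right
      have e : K.symm j = M.symm j := by rw [Equiv.eq_symm_apply, ← hj]; simp
      refine ⟨e, ?_⟩
      by_contra! hc
      have := hM.rank_of_woman_lt hN hc
      rw [e] at h
      simp at h
      omega
  refine ⟨K, ⟨?_, ?_, ?_⟩, hr⟩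
  · intro i
    rw [hK]
    split_ifs
    · exact hN.mem_man i
    · exact hM.mem_man i
  · intro i
    rw [hK]
    split_ifs
    · exact hN.mem_woman i
    · exact hM.mem_woman i
  · intro i j h
    rw [hr, lt_max_iff] at h
    have hle : I.womanRank j (K.symm j) ≤ I.womanRank j (M.symm j) ∧
        I.womanRank j (K.symm j) ≤ I.womanRank j (N.symm j) := by
      rcases hs j with ⟨e, h'⟩ | ⟨e, h'⟩ <;> rw [e] <;> simp [h']
    rcases h with h | h
    · exact hle.1.trans (hM.stable i j h)
    · exact hle.2.trans (hN.stable i j h)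

/-! # Next women and eliminations -/

/-- `j` is the first woman after the partner of `i` who prefers `i` to her partner. -/
structure Nxt (I : SMI n) (M : Equiv.Perm (Fin n)) (i j : Fin n) : Prop where
  mem : j ∈ I.manList i
  lt : I.manRank i (M i) < I.manRank i j
  woman : I.womanRank j i < I.womanRank j (M.symm j)
  first : ∀ k, I.manRank i (M i) < I.manRank i k → I.manRank i k < I.manRank i j →
    I.womanRank k (M.symm k) ≤ I.womanRank k i

theorem isNext_graph_iff (hM : Stab I M) {i j : Fin n} :
    I.IsNext (graph M) i j ↔ Nxt I M i j := by
  constructor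
  · rintro ⟨j₀, h0, h1, ⟨i', h2, h3⟩, h4⟩
    simp at h0 h2
    subst h0 h2
    refine ⟨h1.2.1, h1.2.2, by simpa using h3.2.2, fun k hk hkj => ?_⟩
    by_contra! hc
    have hkm : k ∈ I.manList i := mem_manList_of_le h1.2.1 hkj.le
    refine h4 k ⟨h1.1, hkm, hk⟩ ⟨hkm, h1.2.1, hkj⟩ ⟨M.symm k, by simp, ?_, hM.mem_woman' k, hc⟩
    exact mem_womanList_of_le (hM.mem_woman' k) hc.le
  · intro h
    refine ⟨M i, by simp, ⟨hM.mem_man i, h.mem, h.lt⟩, ⟨M.symm j, by simp,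
      mem_womanList_of_le (hM.mem_woman' j) h.woman.le, hM.mem_woman' j, h.woman⟩, ?_⟩
    rintro k hk hkj ⟨i', hi', hp⟩
    simp at hi'
    subst hi'
    have := h.first _ hk.2.2 hkj.2.2
    simp at this
    exact absurd hp.2.2 (not_lt.2 this)

/-- If the partner of `i` is worse in the stable matching `N`, then it is at or after the next
woman `j`, and the partner of `j` is worse off too. -/
theorem Nxt.le_and_lt (hM : Stab I M) (hN : Stab I N) {i j : Fin n} (h : Nxt I M i j)
    (hlt : I.manRank i (M i) < I.manRank i (N i)) :
    I.manRank i j ≤ I.manRank i (N i) ∧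
      I.manRank (M.symm j) j < I.manRank (M.symm j) (N (M.symm j)) := by
  -- A stable partner strictly between `M i` and `j` would herself prefer `i` to her husband in `M`,
  -- against the choice of `j` as the first such woman.
  have hle : I.manRank i j ≤ I.manRank i (N i) := by
    by_contra! hc
    exact absurd (h.first _ hlt hc) (not_le.2 (hM.woman_lt' hN hlt))
  -- In `N` the woman `j` has `i` or somebody at least as good, since otherwise she and `i` would
  -- block `N`. So she gains over `M`, and her husband in `M` loses.
  refine ⟨hle, hM.rank_of_woman_lt hN ?_⟩
  rcases hle.lt_or_eq with h1 | h1
  · exact (hN.stable i j h1).trans_lt h.woman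
  · have e := manRank_inj h.mem h1
    rw [e] at h ⊢
    simpa using h.woman

/-- The woman `N i` is a candidate: she comes after `M i` and prefers `i` to her husband in `M`. The
next woman is the candidate that `i` likes best. -/
theorem exists_nxt (hM : Stab I M) (hN : Stab I N) {i : Fin n}
    (hlt : I.manRank i (M i) < I.manRank i (N i)) : ∃ j, Nxt I M i j := by
  classical
  let A : Finset (Fin n) := Finset.univ.filter fun j => I.manRank i (M i) < I.manRank i j ∧
    I.womanRank j i < I.womanRank j (M.symm j)
  have hA : N i ∈ A := by simpa [A] using ⟨hlt, hM.woman_lt' hN hlt⟩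
  obtain ⟨j, hj, hmin⟩ := A.exists_min_image (I.manRank i) ⟨_, hA⟩
  simp only [A, Finset.mem_filter, Finset.mem_univ, true_and] at hj hmin
  refine ⟨j, mem_manList_of_le (hN.mem_man i) (hmin _ (by simpa [A] using hA)), hj.1, hj.2, ?_⟩
  intro k hk hkj
  by_contra! hc
  exact absurd (hmin k ⟨hk, hc⟩) (not_le.2 hkj)

/-- The effect on permutations of eliminating the rotation `ρ`. -/
structure Step (I : SMI n) (M : Equiv.Perm (Fin n)) (ρ : PairSet n) (M' : Equiv.Perm (Fin n)) :
    Prop where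
  nonempty : ρ.Nonempty
  sub : ρ ⊆ graph M
  next : ∀ i, (i, M i) ∈ ρ → Nxt I M i (M' i)
  same : ∀ i, (i, M i) ∉ ρ → M' i = M i
  prop : ∀ N, Stab I N → (∃ p ∈ ρ, I.manRank p.1 p.2 < I.manRank p.1 (N p.1)) →
    ∀ p ∈ ρ, I.manRank p.1 (M' p.1) ≤ I.manRank p.1 (N p.1)

theorem Step.dom (h : Step I M ρ M') : I.Dom M M' := by
  intro i
  by_cases hi : (i, M i) ∈ ρ
  · exact (h.next i hi).lt.le
  · rw [h.same i hi]

theorem Step.stab (hM : Stab I M) (h : Step I M ρ M') : Stab I M' := by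
  have himp : ∀ j, I.womanRank j (M'.symm j) ≤ I.womanRank j (M.symm j) := by
    intro j
    by_cases hi : (M'.symm j, M (M'.symm j)) ∈ ρ
    · have := (h.next _ hi).woman
      simpa using this.le
    · have := h.same _ hi
      simp only [Equiv.apply_symm_apply] at this
      have : M.symm j = M'.symm j := by rw [Equiv.symm_apply_eq]; exact this
      rw [this]
  refine ⟨?_, ?_, ?_⟩
  · intro i
    by_cases hi : (i, M i) ∈ ρ
    · exact (h.next i hi).mem
    · rw [h.same i hi]; exact hM.mem_man i
  · intro i
    by_cases hi : (i, M i) ∈ ρ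
    · exact mem_womanList_of_le (hM.mem_woman' _) (h.next i hi).woman.le
    · rw [h.same i hi]; exact hM.mem_woman i
  · intro i j hlt
    refine (himp j).trans ?_
    rcases lt_trichotomy (I.manRank i j) (I.manRank i (M i)) with h1 | h1 | h1
    · exact hM.stable i j h1
    · have := manRank_inj (hM.mem_man i) h1.symm
      rw [← this]
      simp
    · by_cases hi : (i, M i) ∈ ρ
      · exact (h.next i hi).first j h1 hlt
      · rw [h.same i hi] at hlt
        omega

open Fin.NatCast Fin.CommRing in
/-- Moving every man of a cycle of next women yields a rotation elimination. -/
theorem cycle_elim (hM : Stab I M) {q : ℕ} (μ : Fin (q + 1) → Fin n) (hμ : Function.Injective μ)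
    (hn : ∀ x, Nxt I M (μ x) (M (μ (x + 1)))) :
    ∃ M' : Equiv.Perm (Fin n), (∀ x, M' (μ x) = M (μ (x + 1))) ∧
      (∀ i, (∀ x, μ x ≠ i) → M' i = M i) ∧
      Step I M (Finset.univ.image fun x => (μ x, M (μ x))) M' ∧
      I.ElimOne (graph M) (Finset.univ.image fun x => (μ x, M (μ x))) (graph M') := by
  -- The cyclic shift of the men of the cycle, extended by the identity. Followed by `M` it gives
  -- each of them the partner of his successor.
  let e : Equiv.Perm (Fin n) := (Equiv.addRight (1 : Fin (q + 1))).viaFintypeEmbedding ⟨μ, hμ⟩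
  let M' : Equiv.Perm (Fin n) := e.trans M
  have h1 : ∀ x, M' (μ x) = M (μ (x + 1)) := by
    intro x
    change M (e (μ x)) = _
    congr 1
    exact Equiv.Perm.viaFintypeEmbedding_apply_image (Equiv.addRight (1 : Fin (q + 1))) ⟨μ, hμ⟩ x
  have h2 : ∀ i, (∀ x, μ x ≠ i) → M' i = M i := by
    intro i hi
    change M (e i) = _
    congr 1
    exact Equiv.Perm.viaFintypeEmbedding_apply_notMem_range (Equiv.addRight (1 : Fin (q + 1)))
      ⟨μ, hμ⟩ (by rintro ⟨x, hx⟩; exact hi x hx)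
  have hmem : ∀ i, (i, M i) ∈ (Finset.univ.image fun x => (μ x, M (μ x))) ↔ ∃ x, μ x = i := by
    intro i
    simp only [Finset.mem_image, Finset.mem_univ, true_and, Prod.mk.injEq]
    constructor
    · rintro ⟨x, hx, -⟩; exact ⟨x, hx⟩
    · rintro ⟨x, rfl⟩; exact ⟨x, rfl, rfl⟩
  have hsub : (Finset.univ.image fun x => (μ x, M (μ x))) ⊆ graph M := by
    intro p hp
    simp only [Finset.mem_image, Finset.mem_univ, true_and] at hp
    obtain ⟨x, rfl⟩ := hp
    simp
  refine ⟨M', h1, h2, ⟨?_, hsub, ?_, ?_, ?_⟩, ?_⟩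
  · simp
  · intro i hi
    obtain ⟨x, rfl⟩ := (hmem i).1 hi
    rw [h1]
    exact hn x
  · intro i hi
    refine h2 i fun x hx => hi ((hmem i).2 ⟨x, hx⟩)
  · rintro N hN ⟨p, hp, hlt⟩ p' hp'
    simp only [Finset.mem_image, Finset.mem_univ, true_and] at hp hp'
    obtain ⟨x, rfl⟩ := hp
    obtain ⟨y, rfl⟩ := hp'
    -- Being worse off in `N` passes from each man to the husband of his next woman, hence around
    -- the whole cycle. The man `y` is reached after `y - x` steps modulo `q + 1`.
    have step : ∀ k : ℕ, I.manRank (μ (x + (k : Fin (q + 1)))) (M (μ (x + (k : Fin (q + 1))))) <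
        I.manRank (μ (x + (k : Fin (q + 1)))) (N (μ (x + (k : Fin (q + 1))))) := by
      intro k
      induction k with
      | zero => simpa using hlt
      | succ k ih =>
        have := ((hn _).le_and_lt hM hN ih).2
        simp only [Equiv.symm_apply_apply] at this
        rw [Nat.cast_succ, ← add_assoc]
        exact this
    have hy := step (y - x).val
    rw [Fin.cast_val_eq_self, add_sub_cancel] at hy
    have := ((hn _).le_and_lt hM hN hy).1
    simpa [h1] using this
  · refine ⟨q, μ, fun x => M (μ x), hμ, rfl, hsub, fun x => (isNext_graph_iff hM).2 (hn x), ?_⟩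
    ext ⟨i, j⟩
    simp only [mem_graph, Finset.mem_union, Finset.mem_sdiff, Finset.mem_image, Finset.mem_univ,
      true_and, Prod.mk.injEq]
    by_cases hi : ∃ x, μ x = i
    · obtain ⟨x, rfl⟩ := hi
      rw [h1]
      constructor
      · rintro rfl
        exact Or.inr ⟨x, rfl, rfl⟩
      · rintro (⟨h, h'⟩ | ⟨y, hy, rfl⟩)
        · exact absurd ⟨x, rfl, h⟩ h'
        · rw [hμ hy]
    · push Not at hi
      rw [h2 i hi]
      constructor
      · exact fun h => Or.inl ⟨h, fun ⟨x, hx, _⟩ => hi x hx⟩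
      · rintro (⟨h, -⟩ | ⟨y, hy, -⟩)
        · exact h
        · exact absurd hy (hi y)

theorem elimOne_step (hM : Stab I M) {ρ A : PairSet n} (h : I.ElimOne (graph M) ρ A) :
    ∃ M', A = graph M' ∧ Step I M ρ M' := by
  obtain ⟨q, μ, ω, hμ, rfl, hsub, hn, rfl⟩ := h
  have hω : ∀ x, ω x = M (μ x) := by
    intro x
    have : (μ x, ω x) ∈ graph M := hsub (Finset.mem_image_of_mem (fun x => (μ x, ω x)) (Finset.mem_univ x))
    simp at this
    exact this.symm
  obtain rfl : ω = fun x => M (μ x) := funext hω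
  obtain ⟨M', h1, h2, h3, h4⟩ := cycle_elim hM μ hμ fun x => (isNext_graph_iff hM).1 (hn x)
  refine ⟨M', ?_, h3⟩
  ext ⟨i, j⟩
  simp only [mem_graph, Finset.mem_union, Finset.mem_sdiff, Finset.mem_image, Finset.mem_univ,
      true_and, Prod.mk.injEq]
  by_cases hi : ∃ x, μ x = i
  · obtain ⟨x, rfl⟩ := hi
    rw [h1]
    constructor
    · rintro (⟨h, h'⟩ | ⟨y, hy, rfl⟩)
      · exact absurd ⟨x, rfl, h⟩ h'
      · rw [hμ hy]
    · rintro rfl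
      exact Or.inr ⟨x, rfl, rfl⟩
  · push Not at hi
    rw [h2 i hi]
    constructor
    · rintro (⟨h, -⟩ | ⟨y, hy, -⟩)
      · exact h
      · exact absurd hy (hi y)
    · exact fun h => Or.inl ⟨h, fun ⟨x, hx, _⟩ => hi x hx⟩

end SMI

/-! ### Rotations as units of progress, their precedence, and closures. -/

namespace SMI

variable {n : ℕ} {I : SMI n} {M N K M' M₀ : Equiv.Perm (Fin n)} {ρ σ : PairSet n}

/-! # The rotations that have been passed on the way to a stable matching -/

/-- The rotations all of whose men are worse off in `M` than in the rotation. -/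
def past (I : SMI n) (M : Equiv.Perm (Fin n)) : Set (PairSet n) :=
  {σ | σ ∈ I.rotations ∧ ∃ p ∈ σ, I.manRank p.1 p.2 < I.manRank p.1 (M p.1)}

theorem exists_step_of_mem_rotations (hI : I.AllAssigned) (h : σ ∈ I.rotations) :
    ∃ N N', Stab I N ∧ Stab I N' ∧ Step I N σ N' := by
  obtain ⟨A, hA, B, hB⟩ := h
  obtain ⟨N, rfl, hN⟩ := exists_graph_eq hI hA
  obtain ⟨N', -, hs⟩ := elimOne_step hN hB
  exact ⟨N, N', hN, hs.stab hN, hs⟩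

/-- Monotonicity is immediate because `past` asks for one man only; for stable matchings `Step.prop`
shows that one man who has passed the rotation forces all the others to have passed it. -/
theorem past_mono (h : I.Dom M N) : past I M ⊆ past I N :=
  fun _ ⟨h1, p, hp, h2⟩ => ⟨h1, p, hp, h2.trans_le (h p.1)⟩

theorem Step.changed_iff (h : Step I M ρ M') {i : Fin n} : M' i ≠ M i ↔ (i, M i) ∈ ρ := by
  constructor
  · intro hne
    by_contra hc
    exact hne (h.same i hc)
  · intro hi e
    have := (h.next i hi).lt
    rw [e] at this
    exact lt_irrefl _ this

theorem Step.apply_eq (h : Step I M ρ M') {p : Fin n × Fin n} (hp : p ∈ ρ) : M p.1 = p.2 :=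
  mem_graph.1 (h.sub hp)

theorem Step.lt (h : Step I M ρ M') {p : Fin n × Fin n} (hp : p ∈ ρ) :
    I.manRank p.1 p.2 < I.manRank p.1 (M' p.1) := by
  obtain ⟨i, j⟩ := p
  have := h.apply_eq hp
  simp only at this
  subst this
  exact (h.next i hp).lt

/-- A pair of a rotation that is passed by the elimination of `ρ` belongs to `ρ`. -/
theorem Step.mem_of_passed (hM : Stab I M) (h : Step I M ρ M') (hN : Stab I N) {i : Fin n}
    (h1 : I.manRank i (M i) ≤ I.manRank i (N i)) (h2 : I.manRank i (N i) < I.manRank i (M' i)) :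
    (i, N i) ∈ ρ := by
  have hi : (i, M i) ∈ ρ := by
    rw [← h.changed_iff]
    intro e
    rw [e] at h2
    omega
  -- A stable partner strictly between `M i` and the next woman would contradict the choice of the
  -- next woman, so only the pair that is removed can be passed.
  rcases h1.lt_or_eq with h3 | h3
  · exact absurd ((h.next i hi).first _ h3 h2) (not_le.2 (hM.woman_lt' hN h3))
  · rwa [← hM.eq_of_rank h3]

/-- As one man of `σ` is passed, `Step.prop` puts every man of `σ` at or beyond his target in `M'`.
So the elimination of `ρ` passes every pair of `σ`, and it passes no stable pairs except its own. -/
theorem Step.subset_of_passed (hM : Stab I M) (h : Step I M ρ M') {N' : Equiv.Perm (Fin n)}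
    (hN : Stab I N) (h' : Step I N σ N')
    (h1 : ∀ p ∈ σ, I.manRank p.1 (M p.1) ≤ I.manRank p.1 p.2)
    (h2 : ∃ p ∈ σ, I.manRank p.1 p.2 < I.manRank p.1 (M' p.1)) : σ ⊆ ρ := by
  intro p hp
  have h3 := h'.prop M' (h.stab hM) h2 p hp
  have h4 := h'.lt hp
  have h5 := h1 p hp
  rw [← h'.apply_eq hp] at h4 h5
  have := h.mem_of_passed hM hN h5 (h4.trans_le h3)
  rwa [h'.apply_eq hp] at this

/-- The inclusion `σ ⊆ ρ` is `subset_of_passed`. The reverse one is the same lemma with the roles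
exchanged; it applies because a matching that exposes `σ` cannot have passed `ρ`: it still contains
pairs of `σ ⊆ ρ`, whose men would otherwise be at or beyond their targets. -/
theorem not_past_of_step (h : Step I M ρ M') (hM : Stab I M) (hI : I.AllAssigned)
    (hσ : σ ∈ I.rotations) (hnot : σ ∉ past I M) (hp : σ ∈ past I M') : σ = ρ := by
  obtain ⟨N, N', hN, -, h'⟩ := exists_step_of_mem_rotations hI hσ
  have h1 : ∀ p ∈ σ, I.manRank p.1 (M p.1) ≤ I.manRank p.1 p.2 := by
    intro p hp
    by_contra! hc
    exact hnot ⟨hσ, p, hp, hc⟩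
  have hsub := h.subset_of_passed hM hN h' h1 hp.2
  refine Finset.Subset.antisymm hsub ?_
  refine h'.subset_of_passed hN hM h (fun p hp => ?_) ?_
  · by_contra! hc
    obtain ⟨p', hp'⟩ := h'.nonempty
    have hge := h.prop N hN ⟨p, hp, hc⟩ p' (hsub hp')
    have := h.lt (hsub hp')
    rw [h'.apply_eq hp'] at hge
    omega
  · obtain ⟨p', hp'⟩ := h'.nonempty
    exact ⟨p', hsub hp', h'.lt hp'⟩

theorem Step.mem_rotations (hM : Stab I M) (h : I.ElimOne (graph M) ρ A) : ρ ∈ I.rotations :=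
  ⟨graph M, isStable_graph_iff.2 hM, A, h⟩

/-- This is why a set of rotations can serve as the coordinate of a stable matching, and why the
variable `Q` of the algorithm is `past I M`. -/
theorem past_step (hI : I.AllAssigned) (hM : Stab I M) (hr : ρ ∈ I.rotations)
    (h : Step I M ρ M') : past I M' = insert ρ (past I M) := by
  ext σ
  rw [Set.mem_insert_iff]
  constructor
  · intro hσ
    by_cases hn : σ ∈ past I M
    · exact Or.inr hn
    · exact Or.inl (not_past_of_step h hM hI hσ.1 hn hσ)
  · rintro (rfl | hσ)
    · obtain ⟨p, hp⟩ := h.nonempty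
      exact ⟨hr, p, hp, h.lt hp⟩
    · exact past_mono h.dom hσ

theorem Step.not_mem_past (h : Step I M ρ M') : ρ ∉ past I M := by
  rintro ⟨-, p, hp, hlt⟩
  rw [h.apply_eq hp] at hlt
  exact lt_irrefl _ hlt

/-! # Elimination sequences -/

theorem ElimSeq.append {A B D : PairSet n} {L L' : List (PairSet n)} (h : I.ElimSeq A L B)
    (h' : I.ElimSeq B L' D) : I.ElimSeq A (L ++ L') D := by
  induction h with
  | nil => exact h'
  | cons h1 _ ih => exact .cons h1 (ih h')

/-- The order of the eliminations does not matter: the rotations used between two matchings are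
determined by the end points, each occurring once. The last clause finds the rotation responsible
for the first move of a man. -/
theorem elimSeq_spec (hI : I.AllAssigned) {L : List (PairSet n)} {A : PairSet n} (hM : Stab I M)
    (h : I.ElimSeq (graph M) L A) :
    ∃ N, A = graph N ∧ Stab I N ∧ I.Dom M N ∧ L.Nodup ∧
      (∀ σ, σ ∈ L ↔ σ ∈ past I N \ past I M) ∧
      ∀ i, N i ≠ M i → ∃ ρ ∈ L, (i, M i) ∈ ρ := by
  induction L generalizing M with
  | nil =>
    cases h
    exact ⟨M, rfl, hM, Dom.refl I M, by simp, by simp, by simp⟩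
  | cons ρ L ih =>
    cases h with
    | cons h1 h2 =>
    have hr := Step.mem_rotations hM h1
    obtain ⟨M', rfl, hs⟩ := elimOne_step hM h1
    obtain ⟨N, rfl, hN, hd, hnd, hp, hc⟩ := ih (hs.stab hM) h2
    have hpast := past_step hI hM hr hs
    have hρ : ρ ∈ past I M' := by rw [hpast]; exact Set.mem_insert _ _
    refine ⟨N, rfl, hN, hs.dom.trans hd, ?_, ?_, ?_⟩
    · rw [List.nodup_cons]
      refine ⟨fun h => ?_, hnd⟩
      exact ((hp ρ).1 h).2 hρ
    · intro σ
      rw [List.mem_cons, hp]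
      rw [hpast]
      constructor
      · rintro (rfl | ⟨h3, h4⟩)
        · exact ⟨past_mono hd hρ, hs.not_mem_past⟩
        · exact ⟨h3, fun h => h4 (Or.inr h)⟩
      · rintro ⟨h3, h4⟩
        by_cases e : σ = ρ
        · exact Or.inl e
        · exact Or.inr ⟨h3, by rintro (h | h); exacts [e h, h4 h]⟩
    · intro i hi
      by_cases hm : (i, M i) ∈ ρ
      · exact ⟨ρ, by simp, hm⟩
      · have e := hs.same i hm
        obtain ⟨τ, h3, h4⟩ := hc i (by rw [e]; exact hi)
        exact ⟨τ, by simp [h3], e ▸ h4⟩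

theorem ElimSeq.exists_exposed {A B : PairSet n} {L : List (PairSet n)} (h : I.ElimSeq A L B)
    (hρ : ρ ∈ L) : ∃ L' D, (∀ σ ∈ L', σ ∈ L) ∧ I.ElimSeq A L' D ∧ I.Exposed D ρ := by
  induction h with
  | nil => simp at hρ
  | @cons A ρ' B C L h1 h2 ih =>
    by_cases e : ρ = ρ'
    · subst e
      exact ⟨[], A, by simp, .nil _, B, h1⟩
    · obtain ⟨L', D, h3, h4, h5⟩ := ih (by simpa [e] using hρ)
      refine ⟨ρ' :: L', D, ?_, .cons h1 h4, h5⟩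
      intro σ hσ
      rcases List.mem_cons.1 hσ with h | h
      · simp [h]
      · simp [h3 σ h]

/-- Under dominance there is an exposed rotation whose elimination preserves dominance. -/
theorem exists_step_of_dom (hM : Stab I M) (hN : Stab I N) (hd : I.Dom M N) (hne : M ≠ N) :
    ∃ ρ M', Step I M ρ M' ∧ I.ElimOne (graph M) ρ (graph M') ∧ I.Dom M' N := by
  classical
  let D := {i // I.manRank i (M i) < I.manRank i (N i)}
  -- The husband of the next woman is again worse off in `N`, so passing to him is a self-map of the
  -- finite set `D`. An orbit becomes periodic, and its cycle is an exposed rotation.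
  have hstep : ∀ i : D, ∃ i' : D, Nxt I M i.1 (M i'.1) := by
    rintro ⟨i, hi⟩
    obtain ⟨j, hj⟩ := exists_nxt hM hN hi
    refine ⟨⟨M.symm j, ?_⟩, by simpa using hj⟩
    simpa using (hj.le_and_lt hM hN hi).2
  choose f hf using hstep
  obtain ⟨i₀, hi₀⟩ : ∃ i, N i ≠ M i := by
    by_contra! hc
    exact hne (Equiv.ext fun i => (hc i).symm)
  let x₀ : D := ⟨i₀, Dom.lt_of_ne hM hd hi₀⟩
  obtain ⟨a, b, hab, he⟩ : ∃ a b : ℕ, a < b ∧ f^[a] x₀ = f^[b] x₀ := by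
    obtain ⟨a, b, hab, he⟩ := Finite.exists_ne_map_eq_of_infinite (fun k : ℕ => f^[k] x₀)
    rcases lt_or_gt_of_ne hab with h | h
    · exact ⟨a, b, h, he⟩
    · exact ⟨b, a, h, he.symm⟩
  set y : D := f^[a] x₀ with hy
  have hper : Function.IsPeriodicPt f (b - a) y := by
    rw [Function.IsPeriodicPt, Function.IsFixedPt, hy, ← Function.iterate_add_apply,
      Nat.sub_add_cancel hab.le, ← he]
  have hpos : 0 < Function.minimalPeriod f y := hper.minimalPeriod_pos (by omega)
  obtain ⟨q, hq⟩ : ∃ q, Function.minimalPeriod f y = q + 1 := ⟨_, (Nat.succ_pred_eq_of_pos hpos).symm⟩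
  let μ : Fin (q + 1) → Fin n := fun x => (f^[x.val] y).1
  have hμ : Function.Injective μ := by
    intro x x' e
    have := Function.iterate_injOn_Iio_minimalPeriod (f := f) (x := y)
      (by simp [hq, x.2] : x.val ∈ _) (by simp [hq, x'.2] : x'.val ∈ _) (Subtype.ext e)
    exact Fin.ext this
  have hnext : ∀ x : Fin (q + 1), (f^[(x + 1).val] y) = f (f^[x.val] y) := by
    intro x
    have e : (x + 1).val = (x.val + 1) % (q + 1) := by
      rw [Fin.val_add, Fin.val_one', Nat.add_mod_mod]
    have h := Function.iterate_mod_minimalPeriod_eq (f := f) (x := y) (n := x.val + 1)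
    rw [hq] at h
    rw [← Function.iterate_succ_apply' f, e]
    exact h
  obtain ⟨M', h1, h2, h3, h4⟩ := cycle_elim hM μ hμ (fun x => by
    simp only [μ]; rw [hnext]; exact hf _)
  refine ⟨_, M', h3, h4, ?_⟩
  intro i
  by_cases hi : ∃ x, μ x = i
  · obtain ⟨x, rfl⟩ := hi
    have := (hf (f^[x.val] y)).le_and_lt hM hN (f^[x.val] y).2
    rw [h1]
    simp only [μ]
    rw [hnext]
    exact this.1
  · push Not at hi
    rw [h2 i hi]
    exact hd i

/-- Eliminations that keep dominance over `N` are repeated; the total rank distance to `N` falls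
strictly, so the process ends in `N`. -/
theorem exists_elimSeq (hM : Stab I M) (hN : Stab I N) (hd : I.Dom M N) :
    ∃ L, I.ElimSeq (graph M) L (graph N) := by
  induction hk : ∑ i, (I.manRank i (N i) - I.manRank i (M i)) using Nat.strong_induction_on
    generalizing M with
  | _ k ih =>
  by_cases e : M = N
  · subst e
    exact ⟨[], .nil _⟩
  obtain ⟨ρ, M', hs, he, hd'⟩ := exists_step_of_dom hM hN hd e
  obtain ⟨L, hL⟩ := ih _ (by
    rw [← hk]
    refine Finset.sum_lt_sum (fun i _ => ?_) ?_
    · have := hs.dom i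
      omega
    · obtain ⟨p, hp⟩ := hs.nonempty
      refine ⟨p.1, Finset.mem_univ _, ?_⟩
      have h1 := hs.lt hp
      rw [← hs.apply_eq hp] at h1
      have := hd' p.1
      omega) (hs.stab hM) hd' rfl
  exact ⟨ρ :: L, .cons he hL⟩

theorem elim_past (hI : I.AllAssigned) (hM : Stab I M) (hN : Stab I N) (hd : I.Dom M N) :
    I.Elim (graph M) (past I N \ past I M) (graph N) := by
  obtain ⟨L, hL⟩ := exists_elimSeq hM hN hd
  obtain ⟨N', e, -, -, h1, h2, -⟩ := elimSeq_spec hI hM hL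
  obtain rfl := graph_injective e
  exact ⟨L, h1, h2, hL⟩

/-! # Closures -/

/-- `M₀` is the man-optimal stable matching. -/
def ManOpt (I : SMI n) (M₀ : Equiv.Perm (Fin n)) : Prop :=
  Stab I M₀ ∧ ∀ N, Stab I N → I.Dom M₀ N

theorem ManOpt.isManOptimal (hI : I.AllAssigned) (h : ManOpt I M₀) : I.IsManOptimal (graph M₀) := by
  refine ⟨isStable_graph_iff.2 h.1, fun A hA i j hij => ?_⟩
  obtain ⟨N, rfl, hN⟩ := exists_graph_eq hI hA
  simp at hij
  subst hij
  exact ⟨M₀ i, by simp, h.2 N hN i⟩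

theorem manOpt_of_isManOptimal (hI : I.AllAssigned) {A : PairSet n} (h : I.IsManOptimal A) :
    ∃ M₀, A = graph M₀ ∧ ManOpt I M₀ := by
  obtain ⟨M₀, rfl, hM₀⟩ := exists_graph_eq hI h.1
  refine ⟨M₀, rfl, hM₀, fun N hN i => ?_⟩
  obtain ⟨j, hj, hle⟩ := h.2 (graph N) (isStable_graph_iff.2 hN) i (N i) (by simp)
  simp at hj
  rwa [hj]

theorem ManOpt.past_eq (hI : I.AllAssigned) (h : ManOpt I M₀) : past I M₀ = ∅ := by
  ext σ
  simp only [Set.mem_empty_iff_false, iff_false]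
  rintro ⟨hσ, p, hp, hlt⟩
  obtain ⟨N, N', hN, -, hs⟩ := exists_step_of_mem_rotations hI hσ
  have := h.2 N hN p.1
  rw [hs.apply_eq hp] at this
  omega

/-- An elimination sequence from `M₀` to `N` contains each `τ ∈ S` and exposes it at some moment.
Every predecessor of `τ` must have been eliminated before that moment, hence lies in the past of
`N`. -/
theorem rotClosure_subset_past (hI : I.AllAssigned) (h₀ : ManOpt I M₀) (hN : Stab I N)
    {S : Set (PairSet n)} (hS : S ⊆ past I N) : I.rotClosure S ⊆ past I N := by
  rintro σ ⟨hσ, τ, hτ, rfl | hp⟩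
  · exact hS hτ
  · obtain ⟨L, hL⟩ := exists_elimSeq h₀.1 hN (h₀.2 N hN)
    obtain ⟨N', e, -, -, -, h2, -⟩ := elimSeq_spec hI h₀.1 hL
    obtain rfl := graph_injective e
    rw [h₀.past_eq hI] at h2
    have hτL : τ ∈ L := (h2 τ).2 ⟨hS hτ, by simp⟩
    obtain ⟨L', D, h3, h4, h5⟩ := hL.exists_exposed hτL
    exact ((h2 σ).1 (h3 σ (hp _ (h₀.isManOptimal hI) _ _ h4 h5))).1

/-- The best stable matching below `M` in which `i` has another partner is the elimination of the
predecessors of the rotation that contains the pair of `i`. -/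
theorem past_break (hI : I.AllAssigned) (hM : Stab I M) (hM' : Stab I M')
    (hd : I.Dom M M') {i : Fin n} (hne : M' i ≠ M i)
    (hbest : ∀ N, Stab I N → I.Dom M N → N i ≠ M i → I.Dom M' N) :
    (∃ ρ ∈ I.rotations, (i, M i) ∈ ρ) ∧ ∀ ρ ∈ I.rotations, (i, M i) ∈ ρ →
      ρ ∈ past I M' ∧ past I M' ⊆ past I M ∪ I.rotClosure {ρ} := by
  constructor
  · obtain ⟨L, hL⟩ := exists_elimSeq hM hM' hd
    obtain ⟨N', e, -, -, -, h2, h3⟩ := elimSeq_spec hI hM hL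
    obtain rfl := graph_injective e
    obtain ⟨ρ, hρ, hi⟩ := h3 i hne
    exact ⟨ρ, ((h2 ρ).1 hρ).1.1, hi⟩
  intro ρ hρ hi
  refine ⟨⟨hρ, _, hi, Dom.lt_of_ne hM hd hne⟩, fun σ hσ => ?_⟩
  by_cases hσM : σ ∈ past I M
  · exact Or.inl hσM
  refine Or.inr ⟨hσ.1, ρ, rfl, ?_⟩
  by_cases e : σ = ρ
  · exact Or.inl e
  right
  intro A hA L B hL hex
  obtain ⟨M₀, rfl, h₀⟩ := manOpt_of_isManOptimal hI hA
  obtain ⟨K, rfl, hK, -, -, h2, -⟩ := elimSeq_spec hI h₀.1 hL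
  obtain ⟨C, hC⟩ := hex
  obtain ⟨K', rfl, hs⟩ := elimOne_step hK hC
  have hK' := hs.stab hK
  -- To see that `σ` precedes `ρ`, let `ρ` be exposed on `K` and lead to `K'`. The meet of `M` and
  -- `K'` lies below `M` and moves `i`, so `M'` dominates it and `σ` is past there. Since `σ` is not
  -- past at `M`, it is past at `K'`, and being different from `ρ` it was eliminated on the way to
  -- `K`.
  obtain ⟨N, hN, hr⟩ := exists_meet hM hK'
  have hlt := hs.lt hi
  simp only at hlt
  have hdN : I.Dom M' N := by
    refine hbest N hN (fun a => ?_) fun e => ?_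
    · rw [hr]; exact le_max_left _ _
    · have := hr i
      rw [e] at this
      have := le_max_right (I.manRank i (M i)) (I.manRank i (K' i))
      omega
  obtain ⟨-, p, hp, hlt'⟩ := past_mono hdN hσ
  rw [hr, lt_max_iff] at hlt'
  rcases hlt' with h | h
  · exact absurd ⟨hσ.1, p, hp, h⟩ hσM
  · have : σ ∈ past I K' := ⟨hσ.1, p, hp, h⟩
    rw [past_step hI hK hρ hs] at this
    rcases this with h | h
    · exact absurd h e
    · rw [h2, h₀.past_eq hI]
      exact ⟨h, by simp⟩

end SMI

/-! ### Program logic with time credits, and the layout of the memory. -/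

namespace Ram

/-! # Weakest preconditions with time credits -/

/-- Started in `s` with the log `l` so far and `r` steps left, the program `c` halts in time, and
the resulting log, number of steps left, and memory satisfy `Q`. -/
def WP (B : ℕ) (c : Com) (Q : List Store → ℕ → Store → Prop) (l : List Store) (r : ℕ) (s : Store) :
    Prop :=
  ∃ log t s', Exec B c s log t s' ∧ t ≤ r ∧ Q (l ++ log) (r - t) s'

variable {B : ℕ} {Q Q' : List Store → ℕ → Store → Prop} {l : List Store} {r : ℕ} {s : Store}
  {c d : Com} {e k : Expr}

theorem WP.mono (h : WP B c Q l r s) (hQ : ∀ l' r' s', Q l' r' s' → Q' l' r' s') :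
    WP B c Q' l r s := by
  obtain ⟨log, t, s', h1, h2, h3⟩ := h
  exact ⟨log, t, s', h1, h2, hQ _ _ _ h3⟩

/-- Hides the postcondition behind an opaque predicate, so that simplifying a piece of program does
not also rewrite a large invariant. -/
theorem WP.abstract (h : ∀ P : List Store → ℕ → Store → Prop,
    (∀ l' r' s', Q l' r' s' → P l' r' s') → WP B c P l r s) : WP B c Q l r s :=
  h Q fun _ _ _ h => h

@[simp] theorem WP_skip : WP B .skip Q l r s ↔ 1 ≤ r ∧ Q l (r - 1) s := by
  constructor
  · rintro ⟨log, t, s', h1, h2, h3⟩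
    cases h1
    exact ⟨h2, by simpa using h3⟩
  · rintro ⟨h1, h2⟩
    exact ⟨_, _, _, .skip, h1, by simpa using h2⟩

@[simp] theorem WP_observe : WP B .observe Q l r s ↔ 1 ≤ r ∧ Q (l ++ [s]) (r - 1) s := by
  constructor
  · rintro ⟨log, t, s', h1, h2, h3⟩
    cases h1
    exact ⟨h2, h3⟩
  · rintro ⟨h1, h2⟩
    exact ⟨_, _, _, .observe, h1, h2⟩

@[simp] theorem WP_assign {x : ℕ} : WP B (.assign x e) Q l r s ↔
    e.eval s ≤ B ∧ e.cost + 1 ≤ r ∧ Q l (r - (e.cost + 1)) (s.setVar x (e.eval s)) := by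
  constructor
  · rintro ⟨log, t, s', h1, h2, h3⟩
    cases h1 with
    | assign h => exact ⟨h, h2, by simpa using h3⟩
  · rintro ⟨h, h1, h2⟩
    exact ⟨_, _, _, .assign h, h1, by simpa using h2⟩

@[simp] theorem WP_write {a : ℕ} : WP B (.write a k e) Q l r s ↔
    k.eval s ≤ B ∧ e.eval s ≤ B ∧ k.cost + e.cost + 1 ≤ r ∧
      Q l (r - (k.cost + e.cost + 1)) (s.setArr a (k.eval s) (e.eval s)) := by
  constructor
  · rintro ⟨log, t, s', h1, h2, h3⟩
    cases h1 with
    | write h h' => exact ⟨h, h', h2, by simpa using h3⟩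
  · rintro ⟨h, h', h1, h2⟩
    exact ⟨_, _, _, .write h h', h1, by simpa using h2⟩

@[simp] theorem WP_seq : WP B (.seq c d) Q l r s ↔ WP B c (WP B d Q) l r s := by
  constructor
  · rintro ⟨log, t, s', h1, h2, h3⟩
    cases h1 with
    | seq h h' =>
      exact ⟨_, _, _, h, by omega, _, _, _, h', by omega, by
        rw [List.append_assoc, Nat.sub_sub]; exact h3⟩
  · rintro ⟨log, t, s', h1, h2, log', t', s'', h3, h4, h5⟩
    exact ⟨_, _, _, .seq h1 h3, by omega, by
      rw [← List.append_assoc, ← Nat.sub_sub]; exact h5⟩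

@[simp] theorem WP_ite : WP B (.ite e c d) Q l r s ↔ e.cost + 1 ≤ r ∧
    (e.eval s ≠ 0 → WP B c Q l (r - (e.cost + 1)) s) ∧
    (e.eval s = 0 → WP B d Q l (r - (e.cost + 1)) s) := by
  constructor
  · rintro ⟨log, t, s', h1, h2, h3⟩
    cases h1 with
    | iteTrue h h' =>
      exact ⟨by omega, fun _ => ⟨_, _, _, h', by omega, by rw [Nat.sub_sub]; exact h3⟩,
        fun h'' => absurd h'' h⟩
    | iteFalse h h' =>
      exact ⟨by omega, fun h'' => absurd h h'',
        fun _ => ⟨_, _, _, h', by omega, by rw [Nat.sub_sub]; exact h3⟩⟩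
  · rintro ⟨h1, h2, h3⟩
    by_cases h : e.eval s = 0
    · obtain ⟨log, t, s', h4, h5, h6⟩ := h3 h
      exact ⟨_, _, _, .iteFalse h h4, by omega, by rw [← Nat.sub_sub]; exact h6⟩
    · obtain ⟨log, t, s', h4, h5, h6⟩ := h2 h
      exact ⟨_, _, _, .iteTrue h h4, by omega, by rw [← Nat.sub_sub]; exact h6⟩

/-- A loop may be run as long as an invariant that pays for each test from the remaining time is
maintained. -/
theorem WP_loop (Inv : List Store → ℕ → Store → Prop) (h0 : Inv l r s)
    (hstep : ∀ l r s, Inv l r s → e.cost + 1 ≤ r ∧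
      (e.eval s = 0 → Q l (r - (e.cost + 1)) s) ∧
      (e.eval s ≠ 0 → WP B c Inv l (r - (e.cost + 1)) s)) :
    WP B (.loop e c) Q l r s := by
  -- Every test costs at least one step, so the remaining time itself is the termination measure.
  induction r using Nat.strong_induction_on generalizing l s with
  | _ r ih =>
  obtain ⟨h1, h2, h3⟩ := hstep l r s h0
  by_cases h : e.eval s = 0
  · exact ⟨_, _, _, .loopExit h, h1, by simpa using h2 h⟩
  · obtain ⟨log, t, s', h4, h5, h6⟩ := h3 h
    obtain ⟨log', t', s'', h7, h8, h9⟩ := ih _ (by omega) h6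
    refine ⟨_, _, _, .loopStep h h4 h7, by omega, ?_⟩
    rw [← List.append_assoc]
    convert h9 using 1
    omega

attribute [irreducible] WP

attribute [simp] Expr.eval Expr.cost

@[simp] theorem Store.setVar_var (s : Store) (x v y : ℕ) :
    (s.setVar x v).var y = if y = x then v else s.var y := by
  simp [Store.setVar, Function.update_apply]

@[simp] theorem Store.setVar_arr (s : Store) (x v : ℕ) : (s.setVar x v).arr = s.arr := rfl

@[simp] theorem Store.setArr_var (s : Store) (a k v : ℕ) : (s.setArr a k v).var = s.var := rfl

@[simp] theorem Store.setArr_arr (s : Store) (a k v b : ℕ) :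
    (s.setArr a k v).arr b = if b = a then Function.update (s.arr a) k v else s.arr b := by
  simp [Store.setArr, Function.update_apply]

/-- The working memory of the elimination procedures is the only part of the memory that changes. -/
structure Frame (s s' : Store) : Prop where
  arr : ∀ a, (a < 4 ∨ a = 5 ∨ a = 6 ∨ (10 ≤ a ∧ a < 20)) → s'.arr a = s.arr a
  var : ∀ x, (x = 0 ∨ (3 ≤ x ∧ x < 20)) → s'.var x = s.var x

theorem Frame.refl (s : Store) : Frame s s := ⟨fun _ _ => rfl, fun _ _ => rfl⟩

theorem Frame.trans {s s' s'' : Store} (h : Frame s s') (h' : Frame s' s'') : Frame s s'' :=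
  ⟨fun a ha => (h'.arr a ha).trans (h.arr a ha), fun x hx => (h'.var x hx).trans (h.var x hx)⟩

theorem Frame.setVar {s s' : Store} (h : Frame s s') {x v : ℕ} (hx : 1 ≤ x ∧ (x < 3 ∨ 20 ≤ x)) :
    Frame s (s'.setVar x v) :=
  ⟨h.arr, fun y hy => by rw [Store.setVar_var, if_neg (by omega)]; exact h.var y hy⟩

theorem Frame.setArr {s s' : Store} (h : Frame s s') {a k v : ℕ}
    (ha : a = 4 ∨ (7 ≤ a ∧ a < 10) ∨ 20 ≤ a) : Frame s (s'.setArr a k v) :=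
  ⟨fun b hb => by rw [Store.setArr_arr, if_neg (by omega)]; exact h.arr b hb, h.var⟩

/-! # Positions in the concatenated lists -/

variable {n : ℕ}

theorem startOf_zero (L : Fin n → List (Fin n)) : startOf L 0 = 0 := by simp [startOf]

theorem startOf_succ (L : Fin n → List (Fin n)) (i : Fin n) :
    startOf L (i + 1) = startOf L i + (L i).length := by
  have h : (i : ℕ) < (List.ofFn L).length := by simp
  unfold startOf
  rw [List.take_succ_eq_append_getElem h]
  simp

theorem startOf_mono (L : Fin n → List (Fin n)) : Monotone (startOf L) := by
  intro a b hab
  unfold startOf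
  obtain ⟨k, rfl⟩ := Nat.exists_eq_add_of_le hab
  rw [List.take_add]
  simp

theorem startOf_eq_sum (L : Fin n → List (Fin n)) : startOf L n = ∑ i, (L i).length := by
  have : startOf L n = ((List.ofFn L).flatten).length := by
    unfold startOf
    rw [List.take_of_length_le (by simp)]
  rw [this, List.length_flatten, List.map_ofFn, List.sum_ofFn]
  rfl

theorem entryOf_startOf (L : Fin n → List (Fin n)) (i : Fin n) (x : ℕ) (hx : x < (L i).length) :
    entryOf L (startOf L i + x) = (L i)[x] := by
  have h : (i : ℕ) < (List.ofFn L).length := by simp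
  have hsplit : (List.ofFn L).flatten = ((List.ofFn L).take i).flatten ++
      (L i ++ ((List.ofFn L).drop (i + 1)).flatten) := by
    conv_lhs => rw [← List.take_append_drop i (List.ofFn L)]
    rw [List.flatten_append, List.drop_eq_getElem_cons h]
    simp
  unfold entryOf startOf
  rw [hsplit, List.getD_eq_getElem?_getD, List.getElem?_map,
    List.getElem?_append_right (by simp), Nat.add_sub_cancel_left,
    List.getElem?_append_left hx, List.getElem?_eq_getElem hx]
  rfl

variable (I : SMI n)

/-- The number of entries of the men's lists. -/
def manTotal : ℕ := startOf I.manList n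

/-- The position of the entry `j` of the list of man `i`. -/
def pos (i j : Fin n) : ℕ := startOf I.manList i + (I.manList i).idxOf j

variable {I}

theorem pos_add_one (i j : Fin n) : pos I i j + 1 = startOf I.manList i + I.manRank i j := rfl

theorem pos_lt {i j : Fin n} (h : j ∈ I.manList i) : pos I i j < startOf I.manList (i + 1) := by
  have := List.idxOf_lt_length_of_mem h
  rw [startOf_succ]
  unfold pos
  omega

theorem startOf_le_manTotal {k : ℕ} (h : k ≤ n) : startOf I.manList k ≤ manTotal I :=
  startOf_mono _ h

theorem pos_lt_manTotal {i j : Fin n} (h : j ∈ I.manList i) : pos I i j < manTotal I :=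
  (pos_lt h).trans_le (startOf_le_manTotal i.2)

theorem exists_pos {i : Fin n} {k : ℕ} (h1 : startOf I.manList i ≤ k)
    (h2 : k < startOf I.manList (i + 1)) : ∃ j ∈ I.manList i, pos I i j = k := by
  rw [startOf_succ] at h2
  have hx : k - startOf I.manList i < (I.manList i).length := by omega
  refine ⟨(I.manList i)[k - startOf I.manList i], by simp, ?_⟩
  unfold pos
  rw [(I.manList_nodup i).idxOf_getElem _ hx]
  omega

theorem pos_lt_pos_iff {i j j' : Fin n} : pos I i j < pos I i j' ↔ I.manRank i j < I.manRank i j' := by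
  have := pos_add_one (I := I) i j
  have := pos_add_one (I := I) i j'
  omega

theorem pos_inj {i j j' : Fin n} (h : j ∈ I.manList i) (e : pos I i j = pos I i j') : j = j' := by
  refine SMI.manRank_inj h ?_
  have := pos_add_one (I := I) i j
  have := pos_add_one (I := I) i j'
  omega

theorem entryOf_pos {i j : Fin n} (h : j ∈ I.manList i) : entryOf I.manList (pos I i j) = j := by
  rw [pos, entryOf_startOf _ _ _ (List.idxOf_lt_length_of_mem h), List.getElem_idxOf]

theorem exists_pos_of_lt {k : ℕ} (h : k < manTotal I) :
    ∃ i j : Fin n, j ∈ I.manList i ∧ pos I i j = k := by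
  have key : ∀ q ≤ n, k < startOf I.manList q →
      ∃ i j : Fin n, j ∈ I.manList i ∧ pos I i j = k := by
    intro q
    induction q with
    | zero => intro _ h; rw [startOf_zero] at h; omega
    | succ q ih =>
      intro hq hk
      by_cases h' : k < startOf I.manList q
      · exact ih (by omega) h'
      · obtain ⟨j, hj, e⟩ := exists_pos (i := ⟨q, hq⟩) (not_lt.1 h') hk
        exact ⟨_, j, hj, e⟩
  exact key n le_rfl h

theorem manTotal_le : manTotal I ≤ I.totalLength := by
  unfold manTotal SMI.totalLength
  rw [startOf_eq_sum]
  omega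

theorem womanList_length_le (j : Fin n) : (I.womanList j).length ≤ n := by
  simpa using (I.womanList_nodup j).length_le_card

theorem manList_length_le (j : Fin n) : (I.manList j).length ≤ n := by
  simpa using (I.manList_nodup j).length_le_card

/-! # Slack: the total distance of the men's pointers from the ends of their lists -/

variable (I) in
def slack (f : ℕ → ℕ) : ℕ := ∑ i : Fin n, (startOf I.manList (i + 1) - f i)

/-- Slack is the potential of the amortised analysis: pointers only advance, and an advance releases
exactly its length. By `slack_le` the initial amount is at most the total length of the men's lists.
-/
theorem slack_update {f : ℕ → ℕ} {i : Fin n} {v : ℕ} (h1 : f i ≤ v)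
    (h2 : v ≤ startOf I.manList (i + 1)) :
    slack I (Function.update f i v) + (v - f i) = slack I f := by
  unfold slack
  rw [← Finset.add_sum_erase _ _ (Finset.mem_univ i),
    ← Finset.add_sum_erase _ (fun i : Fin n => startOf I.manList (i + 1) - f i) (Finset.mem_univ i),
    Function.update_self]
  have : ∀ x ∈ Finset.univ.erase i, startOf I.manList ((x : ℕ) + 1) - Function.update f i v x =
      startOf I.manList ((x : ℕ) + 1) - f x := by
    intro x hx
    rw [Function.update_of_ne]
    intro e
    exact (Finset.mem_erase.1 hx).1 (Fin.ext e)
  rw [Finset.sum_congr rfl this]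
  omega

theorem slack_le {f : ℕ → ℕ} (h : ∀ i : Fin n, startOf I.manList i ≤ f i) :
    slack I f ≤ manTotal I := by
  unfold slack manTotal
  rw [startOf_eq_sum]
  refine Finset.sum_le_sum fun i _ => ?_
  have := h i
  rw [startOf_succ]
  omega

theorem slack_congr {f g : ℕ → ℕ} (h : ∀ i : Fin n, f i = g i) : slack I f = slack I g := by
  unfold slack
  exact Finset.sum_congr rfl fun i _ => by rw [h i]

theorem update_fin {α : Type*} (f : ℕ → α) (i i' : Fin n) (v : α) :
    Function.update f i v i' = if i' = i then v else f i' := by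
  rw [Function.update_apply]
  simp [Fin.ext_iff]

end Ram

namespace SMI

variable {n : ℕ} {I : SMI n} {M N : Equiv.Perm (Fin n)}

/-! # Degrees -/

theorem manRank_le_manDegree (i : Fin n) : I.manRank i (M i) ≤ I.manDegree (graph M) :=
  Finset.le_sup (f := fun p : Fin n × Fin n => I.manRank p.1 p.2) (b := (i, M i)) (by simp)

theorem womanRank_le_womanDegree (i : Fin n) : I.womanRank (M i) i ≤ I.womanDegree (graph M) :=
  Finset.le_sup (f := fun p : Fin n × Fin n => I.womanRank p.2 p.1) (b := (i, M i)) (by simp)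

theorem manDegree_eq {d : ℕ} (h : ∀ i, I.manRank i (M i) ≤ d) (h' : ∃ i, d ≤ I.manRank i (M i)) :
    I.manDegree (graph M) = d := by
  refine le_antisymm (Finset.sup_le ?_) ?_
  · rintro ⟨i, j⟩ hp
    simp at hp
    subst hp
    exact h i
  · obtain ⟨i, hi⟩ := h'
    exact hi.trans (manRank_le_manDegree i)

theorem womanDegree_eq {d : ℕ} (h : ∀ i, I.womanRank (M i) i ≤ d)
    (h' : ∃ i, d ≤ I.womanRank (M i) i) : I.womanDegree (graph M) = d := by
  refine le_antisymm (Finset.sup_le ?_) ?_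
  · rintro ⟨i, j⟩ hp
    simp at hp
    subst hp
    exact h i
  · obtain ⟨i, hi⟩ := h'
    exact hi.trans (womanRank_le_womanDegree i)

theorem exists_manRank_eq (hn : 0 < n) (I : SMI n) (M : Equiv.Perm (Fin n)) :
    ∃ i, I.manRank i (M i) = I.manDegree (graph M) := by
  have : Nonempty (Fin n) := ⟨⟨0, hn⟩⟩
  obtain ⟨i, hi⟩ := Finite.exists_max fun i => I.manRank i (M i)
  exact ⟨i, (manDegree_eq hi ⟨i, le_rfl⟩).symm⟩

theorem exists_womanRank_eq (hn : 0 < n) (I : SMI n) (M : Equiv.Perm (Fin n)) :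
    ∃ i, I.womanRank (M i) i = I.womanDegree (graph M) := by
  have : Nonempty (Fin n) := ⟨⟨0, hn⟩⟩
  obtain ⟨i, hi⟩ := Finite.exists_max fun i => I.womanRank (M i) i
  exact ⟨i, (womanDegree_eq hi ⟨i, le_rfl⟩).symm⟩

theorem Dom.manDegree_le (h : I.Dom M N) : I.manDegree (graph M) ≤ I.manDegree (graph N) := by
  refine Finset.sup_le ?_
  rintro ⟨i, j⟩ hp
  simp at hp
  subst hp
  exact (h i).trans (manRank_le_manDegree i)

theorem Dom.womanDegree_le (hM : Stab I M) (hN : Stab I N) (h : I.Dom M N) :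
    I.womanDegree (graph N) ≤ I.womanDegree (graph M) := by
  refine Finset.sup_le ?_
  rintro ⟨i, j⟩ hp
  simp at hp
  subst hp
  have h1 := Dom.womanRank_le hM hN h (N i)
  simp at h1
  have h2 := womanRank_le_womanDegree (I := I) (M := M) (M.symm (N i))
  simp at h2
  exact h1.trans h2

end SMI

namespace Ram

variable {B : ℕ} {Q : List Store → ℕ → Store → Prop} {l : List Store} {r : ℕ} {s : Store} {n : ℕ}
  {I : SMI n} {M : Equiv.Perm (Fin n)}

infixr:67 " ;; " => Com.seq

/-! # Counting loops -/

/-- `for x < n do c`, where `n` is in register 0. -/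
def forLoop (x : ℕ) (c : Com) : Com :=
  .assign x (.const 0) ;;
    .loop (.lt (.var x) (.var 0)) (c ;; .assign x (.add (.var x) (.const 1)))

/-- Added to the cost `c` of the body are 4 steps for the test and 4 for the increment; the final 8
cover the initial assignment and the last test. The body has to hand back the counter and `n`
unchanged. -/
theorem WP_forLoop {x c : ℕ} {body : Com} (Inv : ℕ → Store → Prop) (hx : x ≠ 0)
    (hn : s.var 0 = n) (hB : n ≤ B) (h0 : Inv 0 (s.setVar x 0)) (hr : (c + 8) * n + 8 ≤ r)
    (hbody : ∀ q s r, q < n → Inv q s → s.var x = q → s.var 0 = n → c ≤ r →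
      WP B body (fun l' r' s' => l' = l ∧ r ≤ r' + c ∧ s'.var x = q ∧ s'.var 0 = n ∧
        Inv (q + 1) (s'.setVar x (q + 1))) l r s)
    (hQ : ∀ r' s', Inv n s' → s'.var x = n → s'.var 0 = n → r ≤ r' + ((c + 8) * n + 8) →
      Q l r' s') : WP B (forLoop x body) Q l r s := by
  unfold forLoop
  simp only [WP_seq, WP_assign, Expr.eval, Expr.cost]
  refine ⟨by omega, by omega, ?_⟩
  refine WP_loop (fun l' r' s' => ∃ q ≤ n, l' = l ∧ s'.var x = q ∧ s'.var 0 = n ∧ Inv q s' ∧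
    (c + 8) * (n - q) + 4 ≤ r' ∧ r ≤ r' + 2 + (c + 8) * q) ?_ ?_
  · refine ⟨0, by omega, rfl, by simp, ?_, h0, by simp; omega, by omega⟩
    rw [Store.setVar_var, if_neg (by omega), hn]
  · rintro l' r' s' ⟨q, hq, rfl, h1, h2, h3, h4, h5⟩
    simp only [Expr.eval, Expr.cost, h1, h2]
    refine ⟨by omega, fun h => ?_, fun h => ?_⟩
    · have hqn : q = n := by
        by_contra hc
        rw [if_pos (by omega)] at h
        exact one_ne_zero h
      subst hqn
      exact hQ _ _ h3 h1 h2 (by omega)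
    · have hqn : q < n := by
        by_contra hc
        rw [if_neg hc] at h
        exact h rfl
      obtain ⟨d, rfl⟩ : ∃ d, n = q + 1 + d := ⟨n - (q + 1), by omega⟩
      have e1 : q + 1 + d - q = d + 1 := by omega
      rw [e1, Nat.mul_succ] at h4
      rw [WP_seq]
      refine (hbody q s' _ hqn h3 h1 h2 (by omega)).mono ?_
      rintro l₂ r₂ s₂ ⟨rfl, h6, h7, h8, h9⟩
      simp only [WP_assign, Expr.eval, Expr.cost, h7]
      refine ⟨by omega, by omega, q + 1, by omega, trivial, by simp, ?_, h9, ?_, ?_⟩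
      · rw [Store.setVar_var, if_neg (by omega), h8]
      · have : q + 1 + d - (q + 1) = d := by omega
        rw [this]
        omega
      · rw [Nat.mul_succ]
        omega

/-- Copy the first `n` entries of array `a` to array `b`. -/
def copy (a b : ℕ) : Com := forLoop 28 (.write b (.var 28) (.read a (.var 28)))

theorem copy_spec {a b : ℕ} (hab : a ≠ b) (hn : s.var 0 = n) (hB : n ≤ B)
    (ha : ∀ i < n, s.arr a i ≤ B) (hr : 14 * n + 8 ≤ r)
    (hQ : ∀ r' s', r ≤ r' + (14 * n + 8) → (∀ c, c ≠ b → s'.arr c = s.arr c) →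
      (∀ y, y ≠ 28 → s'.var y = s.var y) → (∀ i < n, s'.arr b i = s.arr a i) → Q l r' s') :
    WP B (copy a b) Q l r s := by
  refine WP_forLoop (c := 6) (fun q s' => (∀ c, c ≠ b → s'.arr c = s.arr c) ∧
    (∀ y, y ≠ 28 → s'.var y = s.var y) ∧ (∀ i < q, s'.arr b i = s.arr a i)) (by decide) hn hB
    ?_ (by omega) ?_ ?_
  · refine ⟨by simp, fun y hy => ?_, by simp⟩
    simp [hy]
  · rintro q s' r' hq ⟨h1, h2, h3⟩ h4 h5 hr'
    simp only [WP_write, Expr.eval, Expr.cost, h4, h1 a hab]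
    refine ⟨by omega, ha q hq, by omega, trivial, by omega, by simp [h4], by simp [h5], ?_, ?_, ?_⟩
    · intro c hc
      simp [hc, h1 c hc]
    · intro y hy
      simp [hy, h2 y hy]
    · intro i hi
      simp only [Store.setVar_arr, Store.setArr_arr, if_true, Function.update_apply]
      split_ifs with h
      · rw [h]
      · exact h3 i (by omega)
  · rintro r' s' ⟨h1, h2, h3⟩ - - h4
    exact hQ r' s' (by omega) h1 h2 h3

/-! # Representation of matchings -/

/-- The tables computed from the input: in array 10 the ranks of the men at the positions of the
men's lists. -/
structure Tab (I : SMI n) (s : Store) : Prop where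
  size : s.var 0 = n
  start : ∀ k ≤ n, s.arr 0 k = startOf I.manList k
  entry : ∀ i j, j ∈ I.manList i → s.arr 1 (pos I i j) = j
  rank : ∀ i j, j ∈ I.manList i → s.arr 10 (pos I i j) = I.womanRank j i

theorem Tab.frame {s' : Store} (h : Tab I s) (hf : Frame s s') : Tab I s' := by
  constructor
  · rw [hf.var 0 (by omega)]; exact h.size
  · rw [hf.arr 0 (by omega)]; exact h.start
  · rw [hf.arr 1 (by omega)]; exact h.entry
  · rw [hf.arr 10 (by omega)]; exact h.rank

/-- The memory represents the matching `M`: positions of the partners of the men (array 20),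
partners (array 4), husbands (array 22) and their ranks (array 23), man-degree (register 20). -/
structure Rep (I : SMI n) (s : Store) (M : Equiv.Perm (Fin n)) : Prop where
  pos : ∀ i : Fin n, s.arr 20 i = pos I i (M i)
  part : ∀ i : Fin n, s.arr 4 i = M i
  husb : ∀ i : Fin n, s.arr 22 (M i) = i
  crk : ∀ i : Fin n, s.arr 23 (M i) = I.womanRank (M i) i
  deg : s.var 20 = I.manDegree (SMI.graph M)

/-- No elimination procedure is under way. -/
def Idle (n : ℕ) (s : Store) : Prop := ∀ i : Fin n, s.arr 21 i = s.arr 20 i ∧ s.arr 24 i = 0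

theorem Rep.holds (h : Rep I s M) : HoldsMatching (s.arr 4) (SMI.graph M) := by
  intro i j
  rw [h.part, SMI.mem_graph, Fin.val_inj]

/-- Like `Frame`, and the list of rotations does not change either. -/
structure LoadFrame (s s' : Store) : Prop where
  frame : Frame s s'
  arr : ∀ a, 7 ≤ a → a < 10 → s'.arr a = s.arr a
  var : ∀ x, 1 ≤ x → x < 3 → s'.var x = s.var x
  fail : s'.var 21 = s.var 21

theorem LoadFrame.trans {s s' s'' : Store} (h : LoadFrame s s') (h' : LoadFrame s' s'') :
    LoadFrame s s'' :=
  ⟨h.frame.trans h'.frame, fun a h1 h2 => (h'.arr a h1 h2).trans (h.arr a h1 h2),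
    fun x h1 h2 => (h'.var x h1 h2).trans (h.var x h1 h2), h'.fail.trans h.fail⟩

/-- Set up the representation of the matching whose positions are in array `a`. -/
def load (a : ℕ) : Com :=
  .assign 20 (.const 0) ;;
  forLoop 28 (
    .assign 24 (.read a (.var 28)) ;;
    .assign 25 (.read 1 (.var 24)) ;;
    .write 20 (.var 28) (.var 24) ;;
    .write 21 (.var 28) (.var 24) ;;
    .write 24 (.var 28) (.const 0) ;;
    .write 4 (.var 28) (.var 25) ;;
    .write 22 (.var 25) (.var 28) ;;
    .write 23 (.var 25) (.read 10 (.var 24)) ;;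
    .ite (.lt (.var 20) (.sub (.add (.var 24) (.const 1)) (.read 0 (.var 28))))
      (.assign 20 (.sub (.add (.var 24) (.const 1)) (.read 0 (.var 28)))) .skip)

theorem load_spec {a : ℕ} (ha : a = 12 ∨ a = 13 ∨ a = 26) (hn : 0 < n) (hB : n + I.totalLength + 2 ≤ B)
    (ht : Tab I s) (hM : ∀ i, M i ∈ I.manList i) (hMw : ∀ i, i ∈ I.womanList (M i))
    (hp : ∀ i : Fin n, s.arr a i = pos I i (M i)) (hr : 70 * n + 20 ≤ r)
    (hQ : ∀ r' s', r ≤ r' + (70 * n + 20) → LoadFrame s s' → Rep I s' M → Idle n s' → Q l r' s') :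
    WP B (load a) Q l r s := by
  have hmt := manTotal_le (I := I)
  unfold load
  simp only [WP_seq, WP_assign, Expr.eval, Expr.cost]
  refine ⟨by omega, by omega, ?_⟩
  refine WP_forLoop (c := 60) (fun q s' => LoadFrame s s' ∧ s'.arr a = s.arr a ∧
    (∀ i : Fin n, i < q → s'.arr 20 i = pos I i (M i) ∧ s'.arr 21 i = pos I i (M i) ∧
      s'.arr 24 i = 0 ∧ s'.arr 4 i = M i ∧ s'.arr 22 (M i) = i ∧
      s'.arr 23 (M i) = I.womanRank (M i) i ∧ I.manRank i (M i) ≤ s'.var 20) ∧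
      ∃ i, s'.var 20 ≤ I.manRank i (M i)) (by decide) (n := n) (by simp [ht.size]) (by omega)
    ?_ (by omega) ?_ ?_
  · refine ⟨⟨((Frame.refl s).setVar (by omega)).setVar (by omega), by simp, ?_, by simp⟩, by simp, by simp,
      ⟨⟨0, hn⟩, by simp⟩⟩
    intro x h1 h2
    simp [show x ≠ 28 by omega, show x ≠ 20 by omega]
  · rintro q s' r' hq ⟨h1, h2, h3, i0, h4⟩ h5 h6 hr'
    have ht' := ht.frame h1.frame
    let i : Fin n := ⟨q, hq⟩
    have hi : (i : ℕ) = q := rfl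
    have e1 : s'.arr a q = pos I i (M i) := by rw [h2]; exact hp i
    have e2 := ht'.entry i (M i) (hM i)
    have e3 := ht'.rank i (M i) (hM i)
    have e4 : s'.arr 0 q = startOf I.manList i := ht'.start q (by omega)
    have b1 := pos_lt_manTotal (hM i)
    have b2 := pos_add_one (I := I) i (M i)
    have b3 : I.womanRank (M i) i ≤ n :=
      (SMI.womanRank_le_iff.2 (hMw i)).trans (womanList_length_le _)
    have b4 := (M i).2
    have hne : a ≠ 20 ∧ a ≠ 21 ∧ a ≠ 24 ∧ a ≠ 4 ∧ a ≠ 22 ∧ a ≠ 23 := by omega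
    -- Common to both outcomes of the comparison that maintains the maximum: `d` is the new content
    -- of register 20, an upper bound for the ranks seen so far that does not exceed some actual
    -- rank.
    have key : ∀ d, (I.manRank i (M i) ≤ d) → (∃ i, d ≤ I.manRank i (M i)) → s'.var 20 ≤ d → ∀ t,
        LoadFrame s t → t.arr a = s'.arr a → t.var 20 = d →
        t.arr 20 = Function.update (s'.arr 20) q (pos I i (M i)) →
        t.arr 21 = Function.update (s'.arr 21) q (pos I i (M i)) →
        t.arr 24 = Function.update (s'.arr 24) q 0 →
        t.arr 4 = Function.update (s'.arr 4) q (M i) →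
        t.arr 22 = Function.update (s'.arr 22) (M i) q →
        t.arr 23 = Function.update (s'.arr 23) (M i) (I.womanRank (M i) i) →
        LoadFrame s t ∧ t.arr a = s.arr a ∧
    (∀ i : Fin n, i < q + 1 → t.arr 20 i = pos I i (M i) ∧ t.arr 21 i = pos I i (M i) ∧
      t.arr 24 i = 0 ∧ t.arr 4 i = M i ∧ t.arr 22 (M i) = i ∧
      t.arr 23 (M i) = I.womanRank (M i) i ∧ I.manRank i (M i) ≤ t.var 20) ∧
      ∃ i, t.var 20 ≤ I.manRank i (M i) := by
      intro d d1 d2 d3 t t1 t2 t3 t4 t5 t6 t7 t8 t9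
      refine ⟨t1, t2.trans h2, fun i' hi' => ?_, by rw [t3]; exact d2⟩
      rw [t3, t4, t5, t6, t7, t8, t9, ← hi]
      simp only [update_fin, EmbeddingLike.apply_eq_iff_eq]
      by_cases hii : i' = i
      · subst hii
        simp [d1]
      · have hlt : (i' : ℕ) < q := by
          have : (i' : ℕ) ≠ q := fun e => hii (Fin.ext e)
          omega
        have := h3 i' hlt
        simp only [hii, if_false]
        exact ⟨this.1, this.2.1, this.2.2.1, this.2.2.2.1, this.2.2.2.2.1, this.2.2.2.2.2.1,
          this.2.2.2.2.2.2.trans d3⟩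
    refine WP.abstract fun P hP => ?_
    simp [h5, e1, e2, e3, e4]
    repeat (refine ⟨by omega, ?_⟩)
    refine ⟨fun hc => ?_, fun hc => ?_⟩
    · repeat (refine ⟨by omega, ?_⟩)
      refine hP _ _ _ ⟨rfl, by omega, by simp [h5], by simp [ht'.size], ?_⟩
      refine key (pos I i (M i) + 1 - startOf I.manList i) (by omega) ⟨i, by omega⟩ (by omega) _
        (h1.trans ⟨?_, fun b hb hb' => ?_, fun x hx hx' => ?_, by simp⟩) ?_ ?_ ?_ ?_ ?_ ?_ ?_ ?_
      · repeat first
          | exact Frame.refl _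
          | refine Frame.setVar ?_ (by omega)
          | refine Frame.setArr ?_ (by omega)
      · simp [show b ≠ 20 ∧ b ≠ 21 ∧ b ≠ 24 ∧ b ≠ 4 ∧ b ≠ 22 ∧ b ≠ 23 by omega]
      · simp [show x ≠ 20 ∧ x ≠ 24 ∧ x ≠ 25 ∧ x ≠ 28 by omega]
      all_goals simp [hne]
    · repeat (refine ⟨by omega, ?_⟩)
      refine hP _ _ _ ⟨rfl, by omega, by simp [h5], by simp [ht'.size], ?_⟩
      refine key (s'.var 20) (by omega) ⟨i0, h4⟩ (by omega) _
        (h1.trans ⟨?_, fun b hb hb' => ?_, fun x hx hx' => ?_, by simp⟩) ?_ ?_ ?_ ?_ ?_ ?_ ?_ ?_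
      · repeat first
          | exact Frame.refl _
          | refine Frame.setVar ?_ (by omega)
          | refine Frame.setArr ?_ (by omega)
      · simp [show b ≠ 20 ∧ b ≠ 21 ∧ b ≠ 24 ∧ b ≠ 4 ∧ b ≠ 22 ∧ b ≠ 23 by omega]
      · simp [show x ≠ 20 ∧ x ≠ 24 ∧ x ≠ 25 ∧ x ≠ 28 by omega]
      all_goals simp [hne]
  · rintro r' s' ⟨h1, h2, h3, h4⟩ h5 h6 h7
    refine hQ r' s' (by simp at h7; omega) h1 ⟨fun i => (h3 i i.2).1, fun i => (h3 i i.2).2.2.2.1,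
      fun i => (h3 i i.2).2.2.2.2.1, fun i => (h3 i i.2).2.2.2.2.2.1, ?_⟩ fun i => ?_
    · exact (SMI.manDegree_eq (fun i => (h3 i i.2).2.2.2.2.2.2) h4).symm
    · rw [(h3 i i.2).1, (h3 i i.2).2.1]
      exact ⟨rfl, (h3 i i.2).2.2.1⟩

end Ram

/-! ### Eliminating rotations with a stack in amortised linear time. -/

namespace Ram

variable {B : ℕ} {Q : List Store → ℕ → Store → Prop} {l : List Store} {r : ℕ} {s : Store} {n : ℕ}
  {I : SMI n} {M M' : Equiv.Perm (Fin n)}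

/-! # Eliminating a cycle from the top of the stack -/

/-- Move the man at the top of the stack (array 25, height in register 22) to his next woman, and
record his old pair in arrays 8 and 9. -/
def pop : Com :=
  .assign 22 (.sub (.var 22) (.const 1)) ;;
  .assign 23 (.read 25 (.var 22)) ;;
  .assign 24 (.read 21 (.var 23)) ;;
  .assign 25 (.read 1 (.var 24)) ;;
  .write 8 (.var 2) (.var 23) ;;
  .write 9 (.var 2) (.read 4 (.var 23)) ;;
  .assign 2 (.add (.var 2) (.const 1)) ;;
  .write 20 (.var 23) (.var 24) ;;
  .write 4 (.var 23) (.var 25) ;;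
  .write 22 (.var 25) (.var 23) ;;
  .write 23 (.var 25) (.read 10 (.var 24)) ;;
  .write 24 (.var 23) (.const 0) ;;
  .ite (.lt (.var 20) (.sub (.add (.var 24) (.const 1)) (.read 0 (.var 23))))
    (.assign 20 (.sub (.add (.var 24) (.const 1)) (.read 0 (.var 23)))) .skip

def popLoop : Com := .loop (.lt (.var 26) (.var 22)) pop

/-- The memory when the men `st x`, `h ≤ x < h₁`, have been moved from their partners in `M` to
those in `M'`, starting from the memory `s₀`. -/
structure Popped (I : SMI n) (M M' : Equiv.Perm (Fin n)) (st : ℕ → Fin n) (p h₁ : ℕ) (s₀ : Store)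
    (h : ℕ) (s : Store) : Prop where
  le : p ≤ h
  le' : h ≤ h₁
  height : s.var 22 = h
  base : s.var 26 = p
  frame : Frame s₀ s
  next : s.arr 21 = s₀.arr 21
  stack : s.arr 25 = s₀.arr 25
  starts : s.arr 7 = s₀.arr 7
  count : s.var 1 = s₀.var 1
  fail : s.var 21 = s₀.var 21
  top : s.var 2 = s₀.var 2 + (h₁ - h)
  recMan : ∀ y < h₁ - h, s.arr 8 (s₀.var 2 + y) = st (h₁ - 1 - y)
  recWoman : ∀ y < h₁ - h, s.arr 9 (s₀.var 2 + y) = M (st (h₁ - 1 - y))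
  recOld : ∀ y < s₀.var 2, s.arr 8 y = s₀.arr 8 y ∧ s.arr 9 y = s₀.arr 9 y
  moved : ∀ x, h ≤ x → x < h₁ → s.arr 20 (st x) = pos I (st x) (M' (st x)) ∧
    s.arr 4 (st x) = M' (st x) ∧ s.arr 24 (st x) = 0 ∧ s.arr 22 (M' (st x)) = st x ∧
    s.arr 23 (M' (st x)) = I.womanRank (M' (st x)) (st x) ∧
    I.manRank (st x) (M' (st x)) ≤ s.var 20
  unmoved : ∀ i : Fin n, (∀ x, h ≤ x → x < h₁ → st x ≠ i) → s.arr 20 i = pos I i (M i) ∧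
    s.arr 4 i = M i ∧ s.arr 24 i = s₀.arr 24 i
  woman : ∀ j : Fin n, (∀ x, h ≤ x → x < h₁ → M' (st x) ≠ j) → s.arr 22 j = M.symm j ∧
    s.arr 23 j = I.womanRank j (M.symm j)
  deg : I.manDegree (SMI.graph M) ≤ s.var 20
  deg' : s.var 20 ≤ I.manDegree (SMI.graph M) ∨ ∃ i, s.var 20 ≤ I.manRank i (M' i)
  slack_le : slack I (s.arr 20) + s.var 2 ≤ slack I (s₀.arr 20) + s₀.var 2

/-- Stated for any store with the prescribed updates, so that it serves both outcomes of the degree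
comparison. The moving man releases at least one unit of slack, which makes up for the pair
recorded; so slack plus number of pairs does not grow, and the addresses stay bounded. -/
theorem Popped.step {st : ℕ → Fin n} {p h₁ h : ℕ} {s₀ s t : Store}
    (hs : Popped I M M' st p h₁ s₀ (h + 1) s) (hp : p ≤ h)
    (hinj : ∀ x y, x < h₁ → y < h₁ → st x = st y → x = y)
    (hlt : I.manRank (st h) (M (st h)) < I.manRank (st h) (M' (st h)))
    (hmem : M' (st h) ∈ I.manList (st h))
    (h22 : t.var 22 = h) (hf : Frame s t) (h26 : t.var 26 = s.var 26)
    (h21 : t.arr 21 = s.arr 21) (h25 : t.arr 25 = s.arr 25) (h7 : t.arr 7 = s.arr 7)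
    (h1 : t.var 1 = s.var 1) (hfail : t.var 21 = s.var 21) (h2 : t.var 2 = s.var 2 + 1)
    (h8 : t.arr 8 = Function.update (s.arr 8) (s.var 2) (st h))
    (h9 : t.arr 9 = Function.update (s.arr 9) (s.var 2) (M (st h)))
    (h20 : t.arr 20 = Function.update (s.arr 20) (st h) (pos I (st h) (M' (st h))))
    (h4 : t.arr 4 = Function.update (s.arr 4) (st h) (M' (st h)))
    (h22a : t.arr 22 = Function.update (s.arr 22) (M' (st h)) (st h))
    (h23 : t.arr 23 = Function.update (s.arr 23) (M' (st h)) (I.womanRank (M' (st h)) (st h)))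
    (h24 : t.arr 24 = Function.update (s.arr 24) (st h) 0)
    (hd : t.var 20 = max (s.var 20) (I.manRank (st h) (M' (st h)))) :
    Popped I M M' st p h₁ s₀ h t := by
  have hle' := hs.le'
  have hun := hs.unmoved (st h) (fun x h1 h2 e => by
    have := hinj x h h2 (by omega) e
    omega)
  have htop := hs.top
  constructor
  case le => exact hp
  case le' => omega
  case height => exact h22
  case base => rw [h26, hs.base]
  case frame => exact hs.frame.trans hf
  case next => rw [h21, hs.next]
  case stack => rw [h25, hs.stack]
  case starts => rw [h7, hs.starts]
  case count => rw [h1, hs.count]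
  case fail => rw [hfail, hs.fail]
  case top => omega
  case recMan =>
    intro y hy
    rw [h8, Function.update_apply]
    split_ifs with e
    · rw [show h₁ - 1 - y = h by omega]
    · exact hs.recMan y (by omega)
  case recWoman =>
    intro y hy
    rw [h9, Function.update_apply]
    split_ifs with e
    · rw [show h₁ - 1 - y = h by omega]
    · exact hs.recWoman y (by omega)
  case recOld =>
    intro y hy
    rw [h8, h9, Function.update_of_ne (by omega), Function.update_of_ne (by omega)]
    exact hs.recOld y hy
  case moved =>
    intro x hx hx'
    rw [h20, h4, h24, h22a, h23, hd]
    simp only [update_fin, EmbeddingLike.apply_eq_iff_eq]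
    by_cases e : st x = st h
    · simp [e]
    · have hne : x ≠ h := fun h => e (by rw [h])
      have := hs.moved x (by omega) hx'
      simp only [e, if_false]
      exact ⟨this.1, this.2.1, this.2.2.1, this.2.2.2.1, this.2.2.2.2.1,
        this.2.2.2.2.2.trans (le_max_left _ _)⟩
  case unmoved =>
    intro i hi
    have hne : i ≠ st h := fun e => hi h le_rfl (by omega) e.symm
    rw [h20, h4, h24]
    simp only [update_fin, hne, if_false]
    exact hs.unmoved i fun x h1 h2 => hi x (by omega) h2
  case woman =>
    intro j hj
    have hne : j ≠ M' (st h) := fun e => hj h le_rfl (by omega) e.symm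
    rw [h22a, h23]
    simp only [update_fin, hne, if_false]
    exact hs.woman j fun x h1 h2 => hj x (by omega) h2
  case deg => rw [hd]; exact hs.deg.trans (le_max_left _ _)
  case deg' =>
    rw [hd]
    rcases le_total (I.manRank (st h) (M' (st h))) (s.var 20) with h | h
    · rw [max_eq_left h]; exact hs.deg'
    · rw [max_eq_right h]; exact Or.inr ⟨_, le_rfl⟩
  case slack_le =>
    have h3 := slack_update (I := I) (f := s.arr 20) (i := st h) (v := pos I (st h) (M' (st h)))
      (by rw [hun.1]; exact (pos_lt_pos_iff.2 hlt).le) (pos_lt hmem).le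
    rw [hun.1] at h3
    have h4 := pos_lt_pos_iff.2 hlt
    have h5 := hs.slack_le
    rw [h20, h2]
    omega

theorem popLoop_spec {st : ℕ → Fin n} {p h₁ : ℕ} (hB : n + I.totalLength + 2 ≤ B)
    (ht : Tab I s) (hs : Rep I s M) (hp : p ≤ h₁) (hh : s.var 22 = h₁) (hb : s.var 26 = p)
    (hinj : ∀ x y, x < h₁ → y < h₁ → st x = st y → x = y)
    (hst : ∀ x < h₁, s.arr 25 x = st x)
    (hnx : ∀ x, p ≤ x → x < h₁ → s.arr 21 (st x) = pos I (st x) (M' (st x)))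
    (hlt : ∀ x, p ≤ x → x < h₁ → I.manRank (st x) (M (st x)) < I.manRank (st x) (M' (st x)))
    (hmem : ∀ i, M' i ∈ I.manList i) (hmem' : ∀ i, i ∈ I.womanList (M' i))
    (hcap : slack I (s.arr 20) + s.var 2 ≤ manTotal I)
    (hr : 100 * (h₁ - p) + 10 ≤ r)
    (hQ : ∀ r' s', r ≤ r' + 100 * (h₁ - p) + 10 → Popped I M M' st p h₁ s p s' → Q l r' s') :
    WP B popLoop Q l r s := by
  have hmt := manTotal_le (I := I)
  -- The men on the stack are distinct, so the height fits into a memory word.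
  have hn : h₁ ≤ n := by
    simpa using Fintype.card_le_of_injective (fun x : Fin h₁ => st x)
      fun x y e => Fin.ext (hinj x y x.2 y.2 e)
  refine WP_loop (fun l' r' s' => l' = l ∧ ∃ h, Popped I M M' st p h₁ s h s' ∧
    100 * (h - p) + 5 ≤ r' ∧ r ≤ r' + 100 * (h₁ - h)) ?_ ?_
  · refine ⟨rfl, h₁, ?_, by omega, by omega⟩
    exact { le := hp, le' := le_rfl, height := hh, base := hb, frame := Frame.refl s, next := rfl,
            stack := rfl, starts := rfl, count := rfl, fail := rfl, top := by omega,
            recMan := by omega, recWoman := by omega, recOld := fun _ _ => ⟨rfl, rfl⟩,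
            moved := by omega, unmoved := fun i _ => ⟨hs.pos i, hs.part i, rfl⟩,
            woman := fun j _ => ⟨by simpa using hs.husb (M.symm j), by simpa using hs.crk (M.symm j)⟩,
            deg := hs.deg.ge, deg' := Or.inl hs.deg.le, slack_le := le_rfl }
  · rintro l' r' s' ⟨rfl, h, hP, h1, h2⟩
    have hple := hP.le
    simp only [Expr.eval, Expr.cost, hP.base, hP.height]
    refine ⟨by omega, fun h3 => ?_, fun h3 => ?_⟩
    · have : h = p := by
        by_contra hc
        rw [if_pos (by omega)] at h3
        exact one_ne_zero h3
      subst this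
      exact hQ _ _ (by omega) hP
    · have hlt' : p < h := by
        by_contra hc
        rw [if_neg (by omega)] at h3
        exact h3 rfl
      obtain ⟨h, rfl⟩ : ∃ h', h = h' + 1 := ⟨h - 1, by omega⟩
      have hle' := hP.le'
      have ht' := ht.frame hP.frame
      have e1 : s'.arr 25 h = st h := by rw [hP.stack]; exact hst h (by omega)
      have e2 : s'.arr 21 (st h) = pos I (st h) (M' (st h)) := by
        rw [hP.next]; exact hnx h (by omega) (by omega)
      have e3 := ht'.entry (st h) (M' (st h)) (hmem _)
      have e4 := ht'.rank (st h) (M' (st h)) (hmem _)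
      have e5 : s'.arr 0 (st h) = startOf I.manList (st h) := ht'.start _ (by omega)
      have e6 : s'.arr 4 (st h) = M (st h) := (hP.unmoved (st h) fun x h1 h2 e => by
        have := hinj x h h2 (by omega) e
        omega).2.1
      have b1 := pos_lt_manTotal (hmem (st h))
      have b2 := pos_add_one (I := I) (st h) (M' (st h))
      have b3 : I.womanRank (M' (st h)) (st h) ≤ n :=
        (SMI.womanRank_le_iff.2 (hmem' _)).trans (womanList_length_le _)
      have b4 := (M' (st h)).2
      have b5 := (M (st h)).2
      have b6 := (st h).2
      have b7 := hP.slack_le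
      have b8 := hP.top
      have b9 := hP.height
      refine WP.abstract fun P hPost => ?_
      unfold pop
      simp [b9, e1, e2, e3, e4, e5, e6]
      repeat (refine ⟨by omega, ?_⟩)
      refine ⟨fun hc => ?_, fun hc => ?_⟩
      all_goals
        repeat (refine ⟨by omega, ?_⟩)
        refine hPost _ _ _ ⟨rfl, h, ?_, by omega, by omega⟩
        refine hP.step (by omega) hinj (hlt h (by omega) (by omega)) (hmem _)
          ?_ ?_ ?_ ?_ ?_ ?_ ?_ ?_ ?_ ?_ ?_ ?_ ?_ ?_ ?_ ?_ ?_
        case refine_2 =>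
          repeat first
            | exact Frame.refl _
            | refine Frame.setVar ?_ (by omega)
            | refine Frame.setArr ?_ (by omega)
        all_goals simp
        all_goals omega

end Ram

namespace Ram

variable {B : ℕ} {Q : List Store → ℕ → Store → Prop} {l : List Store} {r : ℕ} {s : Store} {n : ℕ}
  {I : SMI n} {M M' : Equiv.Perm (Fin n)}

/-! # Moving a man to the next possible partner -/

/-- The memory holds the list `L` of rotations: number in register 1, number of pairs in
register 2, starting positions in array 7, pairs in arrays 8 and 9. -/
structure Rec (n : ℕ) (s : Store) (L : List (PairSet n)) : Prop where
  count : s.var 1 = L.length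
  count_le : s.var 1 ≤ s.var 2
  zero : s.arr 7 0 = 0
  last : s.arr 7 L.length = s.var 2
  le : ∀ k ≤ L.length, s.arr 7 k ≤ s.var 2
  block : ∀ k (hk : k < L.length), rotationBlock n s k = (L[k] : Set (Fin n × Fin n))

theorem Rep.congr {t : Store} (h : Rep I s M) (h20 : t.arr 20 = s.arr 20) (h4 : t.arr 4 = s.arr 4)
    (h22 : t.arr 22 = s.arr 22) (h23 : t.arr 23 = s.arr 23) (hd : t.var 20 = s.var 20) :
    Rep I t M :=
  ⟨by rw [h20]; exact h.pos, by rw [h4]; exact h.part, by rw [h22]; exact h.husb,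
    by rw [h23]; exact h.crk, by rw [hd]; exact h.deg⟩

theorem Rec.congr {t : Store} {L : List (PairSet n)} (h : Rec n s L) (h1 : t.var 1 = s.var 1)
    (h2 : t.var 2 = s.var 2) (h7 : t.arr 7 = s.arr 7) (h8 : t.arr 8 = s.arr 8)
    (h9 : t.arr 9 = s.arr 9) : Rec n t L := by
  refine ⟨by rw [h1, h.count], by rw [h1, h2]; exact h.count_le, by rw [h7]; exact h.zero,
    by rw [h7, h2]; exact h.last, by rw [h7, h2]; exact h.le, fun k hk => ?_⟩
  rw [← h.block k hk]
  unfold rotationBlock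
  rw [h7, h8, h9]

/-- The new block is written beyond the old pairs, so the old blocks keep their contents. As it is
nonempty, there are never more rotations than pairs, which bounds the addresses used in array 7. -/
theorem Rec.append {t : Store} {L : List (PairSet n)} {ρ : PairSet n} (h : Rec n s L)
    (h1 : t.var 1 = s.var 1 + 1) (hlt : s.var 2 < t.var 2)
    (h7 : t.arr 7 = Function.update (s.arr 7) (s.var 1 + 1) (t.var 2))
    (hold : ∀ y < s.var 2, t.arr 8 y = s.arr 8 y ∧ t.arr 9 y = s.arr 9 y)
    (hnew : ∀ p : Fin n × Fin n, p ∈ ρ ↔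
      ∃ y, s.var 2 ≤ y ∧ y < t.var 2 ∧ t.arr 8 y = p.1 ∧ t.arr 9 y = p.2) :
    Rec n t (L ++ [ρ]) := by
  have hc := h.count
  have hcl := h.count_le
  have e1 : t.arr 7 (L.length + 1) = t.var 2 := by rw [h7, ← hc, Function.update_self]
  have e2 : ∀ k ≤ L.length, t.arr 7 k = s.arr 7 k := by
    intro k hk
    rw [h7, Function.update_of_ne (by omega)]
  constructor
  · simp; omega
  · omega
  · rw [e2 0 (by omega), h.zero]
  · simpa using e1
  · intro k hk
    simp only [List.length_append, List.length_singleton] at hk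
    rcases Nat.lt_or_ge L.length k with h' | h'
    · rw [show k = L.length + 1 by omega, e1]
    · rw [e2 k h']
      exact (h.le k h').trans hlt.le
  · intro k hk
    simp only [List.length_append, List.length_singleton] at hk
    rcases Nat.lt_or_ge k L.length with h' | h'
    · rw [List.getElem_append_left h', ← h.block k h']
      unfold rotationBlock
      rw [e2 k h'.le, e2 (k + 1) h']
      ext p
      refine exists_congr fun x => ?_
      refine and_congr_right fun _ => and_congr_right fun hx => ?_
      have := hold x (hx.trans_le (h.le _ h'))
      rw [this.1, this.2]
    · obtain rfl : k = L.length := by omega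
      rw [List.getElem_append_right le_rfl]
      unfold rotationBlock
      rw [e2 _ le_rfl, e1, h.last]
      ext p
      simpa using (hnew p).symm

/-- One step of a depth-first search along next women. Array 21 holds for each man a pointer at or
beyond his partner; array 24 holds one plus the index of a man on the stack, and 0 for the others.
If the woman under the pointer of the top man does not prefer him, the pointer advances. Otherwise
her husband is pushed, unless he is on the stack already: then the men from him upwards form an
exposed rotation, which is eliminated and popped. A pointer at the end of the list means failure; an
empty stack without failure means that the bottom man has moved. -/
def brkStep : Com :=
  .assign 23 (.read 25 (.sub (.var 22) (.const 1))) ;;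
  .assign 24 (.read 21 (.var 23)) ;;
  .ite (.lt (.var 24) (.read 0 (.add (.var 23) (.const 1))))
    (.assign 25 (.read 1 (.var 24)) ;;
      .ite (.lt (.read 10 (.var 24)) (.read 23 (.var 25)))
        (.assign 27 (.read 22 (.var 25)) ;;
          .ite (.read 24 (.var 27))
            (.assign 26 (.sub (.read 24 (.var 27)) (.const 1)) ;;
              popLoop ;;
              .assign 1 (.add (.var 1) (.const 1)) ;;
              .write 7 (.var 1) (.var 2))
            (.write 25 (.var 22) (.var 27) ;;
              .assign 22 (.add (.var 22) (.const 1)) ;;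
              .write 24 (.var 27) (.var 22)))
        (.write 21 (.var 23) (.add (.var 24) (.const 1))))
    (.assign 21 (.const 1) ;; .assign 22 (.const 0))

/-- Eliminate rotations until the man in register 3 has a new partner. On failure, register 21 is 1:
the man has no other partner in any stable matching below. -/
def brk : Com :=
  .write 25 (.const 0) (.var 3) ;;
  .write 24 (.var 3) (.const 1) ;;
  .assign 22 (.const 1) ;;
  .assign 21 (.const 0) ;;
  .loop (.var 22) brkStep ;;
  .ite (.var 21) (copy 20 26 ;; load 26) .skip

/-- The state while the men `st 0, …, st (h - 1)` are on the stack. -/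
structure BrkInv (I : SMI n) (M₁ : Equiv.Perm (Fin n)) (i : Fin n) (L₀ : List (PairSet n))
    (s₀ s : Store) (M : Equiv.Perm (Fin n)) (L : List (PairSet n)) (st : ℕ → Fin n) (h : ℕ) :
    Prop where
  stab : SMI.Stab I M
  seq : I.ElimSeq (SMI.graph M₁) L (SMI.graph M)
  best : ∀ N, SMI.Stab I N → I.Dom M₁ N → N i ≠ M₁ i → I.Dom M N
  frame : Frame s₀ s
  rep : Rep I s M
  record : Rec n s (L₀ ++ L)
  cap : slack I (s.arr 20) + s.var 2 ≤ manTotal I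
  height : s.var 22 = h
  fail : s.var 21 = 0
  stack : ∀ x < h, s.arr 25 x = st x ∧ s.arr 24 (st x) = x + 1
  off : ∀ v : Fin n, s.arr 24 v = 0 ∨ ∃ x < h, st x = v
  nxt_ge : ∀ v : Fin n, s.arr 20 v ≤ s.arr 21 v
  nxt_le : ∀ v : Fin n, s.arr 21 v ≤ startOf I.manList (v + 1)
  idle : ∀ v : Fin n, s.arr 24 v = 0 → s.arr 21 v = s.arr 20 v
  seen : ∀ v j : Fin n, pos I v (M v) ≤ pos I v j → pos I v j < s.arr 21 v →
    I.womanRank j (M.symm j) ≤ I.womanRank j v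
  chain : ∀ x, x + 1 < h → s.arr 21 (st x) = pos I (st x) (M (st (x + 1))) ∧
    SMI.Nxt I M (st x) (M (st (x + 1)))
  bottom : 0 < h → st 0 = i ∧ M i = M₁ i
  done : h = 0 → M i ≠ M₁ i

section

variable {M₁ : Equiv.Perm (Fin n)} {i : Fin n} {L₀ L : List (PairSet n)} {s₀ t : Store}
  {st : ℕ → Fin n} {h : ℕ}

theorem BrkInv.inj (hs : BrkInv I M₁ i L₀ s₀ s M L st h) :
    ∀ x y, x < h → y < h → st x = st y → x = y := by
  intro x y hx hy e
  have h1 := (hs.stack x hx).2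
  have h2 := (hs.stack y hy).2
  rw [e] at h1
  omega

theorem BrkInv.height_le (hs : BrkInv I M₁ i L₀ s₀ s M L st h) : h ≤ n := by
  simpa using Fintype.card_le_of_injective (fun x : Fin h => st x)
    fun x y e => Fin.ext (hs.inj x y x.2 y.2 e)

/-- The pointer has passed only women who do not prefer `v`, and it is not at his own partner, who
does not strictly prefer him to himself. So the first woman to prefer him is the one under the
pointer. -/
theorem BrkInv.nxt (hs : BrkInv I M₁ i L₀ s₀ s M L st h) {v w : Fin n} (hw : w ∈ I.manList v)
    (hp : pos I v w = s.arr 21 v) (hlt : I.womanRank w v < I.womanRank w (M.symm w)) :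
    SMI.Nxt I M v w := by
  have hge := hs.nxt_ge v
  rw [hs.rep.pos, ← hp] at hge
  refine ⟨hw, ?_, hlt, fun k hk hkw => ?_⟩
  · rw [← pos_lt_pos_iff]
    refine lt_of_le_of_ne hge fun e => ?_
    rw [← pos_inj (hs.stab.mem_man v) e] at hlt
    simp at hlt
  · rw [← pos_lt_pos_iff] at hk hkw
    exact hs.seen v k hk.le (hp ▸ hkw)

theorem BrkInv.advance (hs : BrkInv I M₁ i L₀ s₀ s M L st (h + 1)) {w : Fin n}
    (hw : w ∈ I.manList (st h))
    (hp : s.arr 21 (st h) = pos I (st h) w)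
    (hnot : I.womanRank w (M.symm w) ≤ I.womanRank w (st h))
    (hf : Frame s t)
    (hvar : ∀ x, x = 1 ∨ x = 2 ∨ x = 20 ∨ x = 21 ∨ x = 22 → t.var x = s.var x)
    (harr : ∀ a, a ≠ 21 → t.arr a = s.arr a)
    (h21 : t.arr 21 = Function.update (s.arr 21) (st h) (pos I (st h) w + 1)) :
    BrkInv I M₁ i L₀ s₀ t M L st (h + 1) := by
  have hne : ∀ x, x < h → st x ≠ st h := fun x hx e => by
    have := hs.inj x h (by omega) (by omega) e
    omega
  constructor
  case stab => exact hs.stab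
  case seq => exact hs.seq
  case best => exact hs.best
  case frame => exact hs.frame.trans hf
  case rep =>
    exact hs.rep.congr (harr _ (by omega)) (harr _ (by omega)) (harr _ (by omega))
      (harr _ (by omega)) (hvar _ (by omega))
  case record =>
    exact hs.record.congr (hvar _ (by omega)) (hvar _ (by omega)) (harr _ (by omega))
      (harr _ (by omega)) (harr _ (by omega))
  case cap => rw [harr _ (by omega), hvar _ (by omega)]; exact hs.cap
  case height => rw [hvar _ (by omega)]; exact hs.height
  case fail => rw [hvar _ (by omega)]; exact hs.fail
  case stack => rw [harr _ (by omega), harr _ (by omega)]; exact hs.stack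
  case off => rw [harr _ (by omega)]; exact hs.off
  case nxt_ge =>
    intro v
    rw [harr _ (by omega), h21, update_fin]
    have := hs.nxt_ge v
    split_ifs with e
    · rw [e] at this ⊢
      omega
    · exact this
  case nxt_le =>
    intro v
    rw [h21, update_fin]
    split_ifs with e
    · rw [e]
      exact pos_lt hw
    · exact hs.nxt_le v
  case idle =>
    intro v hv
    rw [harr _ (by omega)] at hv
    have : v ≠ st h := by
      rintro rfl
      have := (hs.stack h (by omega)).2
      omega
    rw [h21, update_fin, if_neg this, harr _ (by omega)]
    exact hs.idle v hv
  case seen =>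
    intro v j h1 h2
    rw [h21, update_fin] at h2
    split_ifs at h2 with e
    · rcases Nat.lt_succ_iff_lt_or_eq.1 h2 with h3 | h3
      · exact hs.seen v j h1 (by rw [e, hp, ← e]; rw [e] at h3 ⊢; exact h3)
      · rw [e] at h3 ⊢
        rw [← pos_inj hw h3.symm]
        exact hnot
    · exact hs.seen v j h1 h2
  case chain =>
    intro x hx
    rw [h21, update_fin, if_neg (hne x (by omega))]
    exact hs.chain x hx
  case bottom => exact hs.bottom
  case done => exact hs.done

theorem BrkInv.push (hs : BrkInv I M₁ i L₀ s₀ s M L st (h + 1)) {w : Fin n}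
    (hw : w ∈ I.manList (st h))
    (hp : s.arr 21 (st h) = pos I (st h) w)
    (hlt : I.womanRank w (st h) < I.womanRank w (M.symm w))
    (hoff : s.arr 24 (M.symm w) = 0)
    (hf : Frame s t)
    (hvar : ∀ x, x = 1 ∨ x = 2 ∨ x = 20 ∨ x = 21 → t.var x = s.var x)
    (hh : t.var 22 = h + 2)
    (harr : ∀ a, a ≠ 24 → a ≠ 25 → t.arr a = s.arr a)
    (h24 : t.arr 24 = Function.update (s.arr 24) (M.symm w) (h + 2))
    (h25 : t.arr 25 = Function.update (s.arr 25) (h + 1) (M.symm w)) :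
    BrkInv I M₁ i L₀ s₀ t M L (Function.update st (h + 1) (M.symm w)) (h + 2) := by
  have hne : ∀ x, x < h + 1 → st x ≠ M.symm w := fun x hx e => by
    have := (hs.stack x hx).2
    rw [e] at this
    omega
  have hst : ∀ x, x < h + 1 → Function.update st (h + 1) (M.symm w) x = st x := fun x hx =>
    Function.update_of_ne (by omega) _ _
  constructor
  case stab => exact hs.stab
  case seq => exact hs.seq
  case best => exact hs.best
  case frame => exact hs.frame.trans hf
  case rep =>
    exact hs.rep.congr (harr _ (by omega) (by omega)) (harr _ (by omega) (by omega))
      (harr _ (by omega) (by omega)) (harr _ (by omega) (by omega)) (hvar _ (by omega))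
  case record =>
    exact hs.record.congr (hvar _ (by omega)) (hvar _ (by omega)) (harr _ (by omega) (by omega))
      (harr _ (by omega) (by omega)) (harr _ (by omega) (by omega))
  case cap => rw [harr _ (by omega) (by omega), hvar _ (by omega)]; exact hs.cap
  case height => exact hh
  case fail => rw [hvar _ (by omega)]; exact hs.fail
  case stack =>
    intro x hx
    rw [h24, h25]
    rcases Nat.lt_succ_iff_lt_or_eq.1 hx with h' | rfl
    · rw [hst x h', update_fin, if_neg (hne x h'), Function.update_of_ne (by omega)]
      exact hs.stack x h'
    · simp
  case off =>
    intro v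
    rw [h24, update_fin]
    by_cases e : v = M.symm w
    · exact Or.inr ⟨h + 1, by omega, by simp [e]⟩
    · rw [if_neg e]
      rcases hs.off v with h' | ⟨x, hx, h'⟩
      · exact Or.inl h'
      · exact Or.inr ⟨x, by omega, by rw [hst x hx, h']⟩
  case nxt_ge => rw [harr _ (by omega) (by omega), harr _ (by omega) (by omega)]; exact hs.nxt_ge
  case nxt_le => rw [harr _ (by omega) (by omega)]; exact hs.nxt_le
  case idle =>
    intro v hv
    rw [harr _ (by omega) (by omega), harr _ (by omega) (by omega)]
    rw [h24, update_fin] at hv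
    split_ifs at hv with e
    exact hs.idle v hv
  case seen => rw [harr _ (by omega) (by omega)]; exact hs.seen
  case chain =>
    intro x hx
    rw [harr _ (by omega) (by omega)]
    rcases Nat.lt_succ_iff_lt_or_eq.1 (show x < h + 1 by omega) with h' | rfl
    · rw [hst x (by omega), hst (x + 1) (by omega)]
      exact hs.chain x (by omega)
    · rw [hst x (by omega), Function.update_self, Equiv.apply_symm_apply]
      exact ⟨hp, hs.nxt hw hp.symm hlt⟩
  case bottom =>
    intro _
    rw [hst 0 (by omega)]
    exact hs.bottom (by omega)
  case done => omega

/-- If the top of the stack has no next woman, then nobody on the stack can be moved. -/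
theorem BrkInv.stuck (hs : BrkInv I M₁ i L₀ s₀ s M L st (h + 1))
    (hend : startOf I.manList (st h + 1) ≤ s.arr 21 (st h)) {N : Equiv.Perm (Fin n)}
    (hN : SMI.Stab I N) (hd : I.Dom M N) : N i = M i := by
  have htop : N (st h) = M (st h) := by
    by_contra hne
    have hlt := SMI.Dom.lt_of_ne hs.stab hd hne
    have h1 := pos_lt (hN.mem_man (st h))
    exact absurd (hs.seen (st h) (N (st h)) (pos_lt_pos_iff.2 hlt).le (by omega))
      (not_le.2 (hs.stab.woman_lt' hN hlt))
  -- If a man on the stack moved, then by `le_and_lt` so would the man above him. Immobility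
  -- therefore descends from the top to the bottom.
  have key : ∀ d ≤ h, N (st (h - d)) = M (st (h - d)) := by
    intro d
    induction d with
    | zero => intro _; exact htop
    | succ d ih =>
      intro hd'
      by_contra hne
      have hlt := SMI.Dom.lt_of_ne hs.stab hd hne
      have h1 := (hs.chain (h - (d + 1)) (by omega)).2
      have h2 := (h1.le_and_lt hs.stab hN hlt).2
      rw [Equiv.symm_apply_apply, show h - (d + 1) + 1 = h - d by omega, ih (by omega)] at h2
      exact lt_irrefl _ h2
  have := key h le_rfl
  rw [Nat.sub_self, (hs.bottom (by omega)).1] at this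
  exact this

/-- The men on the stack from `p` on form an exposed rotation. -/
theorem BrkInv.exists_cycle (hs : BrkInv I M₁ i L₀ s₀ s M L st (h + 1)) {w : Fin n}
    (hw : w ∈ I.manList (st h)) (hp : s.arr 21 (st h) = pos I (st h) w)
    (hlt : I.womanRank w (st h) < I.womanRank w (M.symm w)) {p : ℕ} (hph : p ≤ h)
    (hu : st p = M.symm w) :
    ∃ M' ρ, SMI.Step I M ρ M' ∧ I.ElimOne (SMI.graph M) ρ (SMI.graph M') ∧
      (∀ a b, (a, b) ∈ ρ ↔ ∃ x, p ≤ x ∧ x < h + 1 ∧ st x = a ∧ M (st x) = b) ∧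
      (∀ x, p ≤ x → x < h + 1 → s.arr 21 (st x) = pos I (st x) (M' (st x)) ∧
        SMI.Nxt I M (st x) (M' (st x))) ∧
      ∀ a, (∀ x, p ≤ x → x < h + 1 → st x ≠ a) → M' a = M a := by
  obtain ⟨q, rfl⟩ := Nat.exists_eq_add_of_le hph
  let μ : Fin (q + 1) → Fin n := fun x => st (p + x)
  have hμ : Function.Injective μ := fun x y e => by
    have := hs.inj (p + x) (p + y) (by omega) (by omega) e
    exact Fin.ext (by omega)
  have hval : ∀ x : Fin (q + 1), x.val < q → (x + 1).val = x.val + 1 := fun x hx => by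
    rw [Fin.val_add_one]
    rw [if_neg]
    intro e
    rw [e] at hx
    simp at hx
  have hlast : ∀ x : Fin (q + 1), x.val = q → (x + 1).val = 0 := fun x hx => by
    rw [Fin.val_add_one, if_pos]
    exact Fin.ext (by simpa using hx)
  -- Below the top the links of the cycle are those of the stack; the top man is linked back to `st
  -- p`, the husband of `w`.
  have hn : ∀ x : Fin (q + 1), s.arr 21 (μ x) = pos I (μ x) (M (μ (x + 1))) ∧
      SMI.Nxt I M (μ x) (M (μ (x + 1))) := by
    intro x
    simp only [μ]
    rcases Nat.lt_or_ge x.val q with hx | hx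
    · rw [hval x hx]
      exact hs.chain (p + x) (by omega)
    · have hx' : x.val = q := by omega
      rw [hlast x hx', hx', Nat.add_zero, hu, Equiv.apply_symm_apply]
      exact ⟨hp, hs.nxt hw hp.symm hlt⟩
  obtain ⟨M', h1, h2, h3, h4⟩ := SMI.cycle_elim hs.stab μ hμ fun x => (hn x).2
  refine ⟨M', _, h3, h4, fun a b => ?_, fun x hx hx' => ?_, fun a ha => ?_⟩
  · simp only [Finset.mem_image, Finset.mem_univ, true_and, Prod.mk.injEq]
    constructor
    · rintro ⟨x, h5, h6⟩
      exact ⟨p + x, by omega, by omega, h5, h6⟩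
    · rintro ⟨x, h5, h6, h7, h8⟩
      refine ⟨⟨x - p, by omega⟩, ?_⟩
      simp only [μ]
      rw [show p + (x - p) = x by omega]
      exact ⟨h7, h8⟩
  · have := hn ⟨x - p, by omega⟩
    rw [← h1] at this
    simp only [μ] at this
    rwa [show p + (x - p) = x by omega] at this
  · exact h2 a fun x e => ha (p + x) (by omega) (by omega) e

end

end Ram

namespace Ram

variable {B : ℕ} {Q : List Store → ℕ → Store → Prop} {l : List Store} {r : ℕ} {s : Store} {n : ℕ}
  {I : SMI n} {M M' : Equiv.Perm (Fin n)}
  {M₁ : Equiv.Perm (Fin n)} {i : Fin n} {L₀ L : List (PairSet n)} {s₀ s₁ t : Store}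
  {st : ℕ → Fin n} {h p : ℕ} {ρ : PairSet n}

theorem BrkInv.setVar (hs : BrkInv I M₁ i L₀ s₀ s M L st h) {x v : ℕ} (hx : 23 ≤ x) :
    BrkInv I M₁ i L₀ s₀ (s.setVar x v) M L st h := by
  have e : ∀ y < 23, (s.setVar x v).var y = s.var y := fun y hy => by
    rw [Store.setVar_var, if_neg (by omega)]
  exact { hs with
    frame := hs.frame.setVar (by omega)
    rep := hs.rep.congr rfl rfl rfl rfl (e _ (by omega))
    record := hs.record.congr (e _ (by omega)) (e _ (by omega)) rfl rfl rfl
    cap := by rw [e _ (by omega)]; exact hs.cap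
    height := by rw [e _ (by omega)]; exact hs.height
    fail := by rw [e _ (by omega)]; exact hs.fail }

/-- The search need not restart after an elimination. Men below `p` keep their partners and women
only gain, so rejections stay valid and the links of the remaining stack are still next women. The
pointers of the popped men already stand at their new partners. -/
theorem BrkInv.eliminate (hs : BrkInv I M₁ i L₀ s₀ s M L st (h + 1)) (hp : p ≤ h)
    (hstep : SMI.Step I M ρ M') (helim : I.ElimOne (SMI.graph M) ρ (SMI.graph M'))
    (hρ : ∀ a b, (a, b) ∈ ρ ↔ ∃ x, p ≤ x ∧ x < h + 1 ∧ st x = a ∧ M (st x) = b)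
    (hnx : ∀ x, p ≤ x → x < h + 1 → s.arr 21 (st x) = pos I (st x) (M' (st x)) ∧
        SMI.Nxt I M (st x) (M' (st x)))
    (hsame : ∀ a, (∀ x, p ≤ x → x < h + 1 → st x ≠ a) → M' a = M a)
    (hP : Popped I M M' st p (h + 1) s p s₁)
    (hf : Frame s₁ t) (h1 : t.var 1 = s₁.var 1 + 1) (hvar : ∀ x, x ≠ 1 → t.var x = s₁.var x)
    (h7 : t.arr 7 = Function.update (s₁.arr 7) (s₁.var 1 + 1) (s₁.var 2))
    (harr : ∀ a, a ≠ 7 → t.arr a = s₁.arr a) :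
    BrkInv I M₁ i L₀ s₀ t M' (L ++ [ρ]) st p := by
  have hM' := hstep.stab hs.stab
  have hdom := hstep.dom
  have hwr := fun j => SMI.Dom.womanRank_le hs.stab hM' hdom j
  have hdec : ∀ a : Fin n, (∃ x, p ≤ x ∧ x < h + 1 ∧ st x = a) ∨
      ∀ x, p ≤ x → x < h + 1 → st x ≠ a := by
    intro a
    by_cases hc : ∃ x, p ≤ x ∧ x < h + 1 ∧ st x = a
    · exact Or.inl hc
    · exact Or.inr fun x h1 h2 e => hc ⟨x, h1, h2, e⟩
  have hlow : ∀ x, x < p → ∀ y, p ≤ y → y < h + 1 → st y ≠ st x := by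
    intro x hx y hy hy' e
    have := hs.inj y x hy' (by omega) e
    omega
  have e2 : t.var 2 = s₁.var 2 := hvar _ (by omega)
  have htop := hP.top
  have hoff : ∀ v : Fin n, s₁.arr 24 v = 0 → s.arr 24 v = 0 ∨ ∃ x, p ≤ x ∧ x < h + 1 ∧ st x = v := by
    intro v hv
    rcases hdec v with hc | hc
    · exact Or.inr hc
    · rw [(hP.unmoved v hc).2.2] at hv
      exact Or.inl hv
  constructor
  case stab => exact hM'
  case seq => exact hs.seq.append (.cons helim (.nil _))
  -- If the bottom man moves in `N`, then so does every man on the stack, link by link. The rotation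
  -- at the top is thus unavoidable, and each of its men is in `N` at or beyond his next woman.
  case best =>
    intro N hN hd hne a
    have hdM := hs.best N hN hd hne
    obtain ⟨hb1, hb2⟩ := hs.bottom (by omega)
    have hch : ∀ x, x < h + 1 → I.manRank (st x) (M (st x)) < I.manRank (st x) (N (st x)) := by
      intro x
      induction x with
      | zero =>
        intro _
        rw [hb1]
        exact SMI.Dom.lt_of_ne hs.stab hdM (by rw [hb2]; exact hne)
      | succ x ih =>
        intro hx
        have := ((hs.chain x hx).2.le_and_lt hs.stab hN (ih (by omega))).2
        simpa using this
    rcases hdec a with ⟨x, hx, hx', rfl⟩ | hc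
    · exact ((hnx x hx hx').2.le_and_lt hs.stab hN (hch x hx')).1
    · rw [hsame a hc]
      exact hdM a
  case frame => exact (hs.frame.trans hP.frame).trans hf
  case rep =>
    constructor
    · intro a
      rw [harr _ (by omega)]
      rcases hdec a with ⟨x, hx, hx', rfl⟩ | hc
      · exact (hP.moved x hx hx').1
      · rw [hsame a hc]
        exact (hP.unmoved a hc).1
    · intro a
      rw [harr _ (by omega)]
      rcases hdec a with ⟨x, hx, hx', rfl⟩ | hc
      · exact (hP.moved x hx hx').2.1
      · rw [hsame a hc]
        exact (hP.unmoved a hc).2.1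
    · intro a
      rw [harr _ (by omega)]
      rcases hdec a with ⟨x, hx, hx', rfl⟩ | hc
      · exact (hP.moved x hx hx').2.2.2.1
      · rw [(hP.woman (M' a) fun x h1 h2 e => hc x h1 h2 (M'.injective e)).1, hsame a hc]
        simp
    · intro a
      rw [harr _ (by omega)]
      rcases hdec a with ⟨x, hx, hx', rfl⟩ | hc
      · exact (hP.moved x hx hx').2.2.2.2.1
      · rw [(hP.woman (M' a) fun x h1 h2 e => hc x h1 h2 (M'.injective e)).2, hsame a hc]
        simp
    · rw [hvar _ (by omega)]
      refine (SMI.manDegree_eq (fun a => ?_) ?_).symm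
      · rcases hdec a with ⟨x, hx, hx', rfl⟩ | hc
        · exact (hP.moved x hx hx').2.2.2.2.2
        · rw [hsame a hc]
          exact (SMI.manRank_le_manDegree a).trans hP.deg
      · rcases hP.deg' with hc | hc
        · obtain ⟨a, ha⟩ := SMI.exists_manRank_eq (st h).pos I M
          exact ⟨a, hc.trans (ha ▸ hdom a)⟩
        · exact hc
  case record =>
    rw [← List.append_assoc]
    have hr := hs.record
    have hr' : Rec n { var := fun x => s.var x, arr := fun a => s.arr a } (L₀ ++ L) := hr
    refine hr.append (by rw [h1, hP.count]) (by omega) (by rw [h7, hP.starts, hP.count, e2]) ?_ ?_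
    · intro y hy
      rw [harr _ (by omega), harr _ (by omega)]
      exact hP.recOld y hy
    · rintro ⟨a, b⟩
      rw [hρ, harr _ (by omega), harr _ (by omega), e2]
      constructor
      · rintro ⟨x, hx, hx', rfl, rfl⟩
        refine ⟨s.var 2 + (h - x), by omega, by omega, ?_, ?_⟩
        · rw [hP.recMan _ (by omega), show h + 1 - 1 - (h - x) = x by omega]
        · rw [hP.recWoman _ (by omega), show h + 1 - 1 - (h - x) = x by omega]
      · rintro ⟨y, hy, hy', h3, h4⟩
        obtain ⟨z, rfl⟩ := Nat.exists_eq_add_of_le hy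
        rw [hP.recMan _ (by omega)] at h3
        rw [hP.recWoman _ (by omega)] at h4
        exact ⟨h + 1 - 1 - z, by omega, by omega, Fin.ext h3, Fin.ext h4⟩
  case cap =>
    rw [harr _ (by omega), e2]
    exact hP.slack_le.trans hs.cap
  case height => rw [hvar _ (by omega)]; exact hP.height
  case fail => rw [hvar _ (by omega), hP.fail]; exact hs.fail
  case stack =>
    intro x hx
    rw [harr _ (by omega), harr _ (by omega), hP.stack, (hP.unmoved (st x) (hlow x hx)).2.2]
    exact hs.stack x (by omega)
  case off =>
    intro v
    rw [harr _ (by omega)]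
    rcases hdec v with ⟨x, hx, hx', rfl⟩ | hc
    · exact Or.inl (hP.moved x hx hx').2.2.1
    · rw [(hP.unmoved v hc).2.2]
      rcases hs.off v with h3 | ⟨x, hx, h3⟩
      · exact Or.inl h3
      · refine Or.inr ⟨x, ?_, h3⟩
        by_contra hc'
        exact hc x (by omega) hx h3
  case nxt_ge =>
    intro v
    rw [harr _ (by omega), harr _ (by omega), hP.next]
    rcases hdec v with ⟨x, hx, hx', rfl⟩ | hc
    · rw [(hP.moved x hx hx').1, (hnx x hx hx').1]
    · rw [(hP.unmoved v hc).1, ← hs.rep.pos]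
      exact hs.nxt_ge v
  case nxt_le =>
    rw [harr _ (by omega), hP.next]
    exact hs.nxt_le
  case idle =>
    intro v hv
    rw [harr _ (by omega)] at hv
    rw [harr _ (by omega), harr _ (by omega), hP.next]
    rcases hdec v with ⟨x, hx, hx', rfl⟩ | hc
    · rw [(hP.moved x hx hx').1, (hnx x hx hx').1]
    · rw [(hP.unmoved v hc).2.2] at hv
      rw [(hP.unmoved v hc).1, ← hs.rep.pos]
      exact hs.idle v hv
  case seen =>
    intro v j h3 h4
    rw [harr _ (by omega), hP.next] at h4
    rcases hdec v with ⟨x, hx, hx', rfl⟩ | hc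
    · rw [(hnx x hx hx').1] at h4
      omega
    · rw [hsame v hc] at h3
      exact (hwr j).trans (hs.seen v j h3 h4)
  case chain =>
    intro x hx
    have hs1 := hsame (st x) (hlow x (by omega))
    have hs2 := hsame (st (x + 1)) (hlow (x + 1) hx)
    obtain ⟨h3, h4⟩ := hs.chain x (by omega)
    rw [harr _ (by omega), hP.next, hs2]
    refine ⟨h3, h4.mem, by rw [hs1]; exact h4.lt, ?_, fun k hk hk' => ?_⟩
    · rw [← hs2]
      have := h4.woman
      simp only [Equiv.symm_apply_apply] at this ⊢
      rwa [hs2]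
    · rw [hs1] at hk
      exact (hwr k).trans (h4.first k hk hk')
  case bottom =>
    intro hp0
    obtain ⟨hb1, hb2⟩ := hs.bottom (by omega)
    refine ⟨hb1, ?_⟩
    rw [← hb2, ← hb1]
    exact hsame _ (hlow 0 hp0)
  case done =>
    rintro rfl
    obtain ⟨hb1, hb2⟩ := hs.bottom (by omega)
    rw [← hb2, ← hb1]
    intro e
    have := (hnx 0 le_rfl (by omega)).2.lt
    rw [e] at this
    exact lt_irrefl _ this

/-- The state after `brk` has given up. -/
structure BrkFail (I : SMI n) (M₁ : Equiv.Perm (Fin n)) (i : Fin n) (L₀ : List (PairSet n))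
    (s₀ s : Store) (M : Equiv.Perm (Fin n)) (L : List (PairSet n)) : Prop where
  stab : SMI.Stab I M
  seq : I.ElimSeq (SMI.graph M₁) L (SMI.graph M)
  frame : Frame s₀ s
  rep : Rep I s M
  record : Rec n s (L₀ ++ L)
  cap : slack I (s.arr 20) + s.var 2 ≤ manTotal I
  fail : s.var 21 = 1
  same : M i = M₁ i
  stuck : ∀ N, SMI.Stab I N → I.Dom M N → N i = M i

/-- The state after `brk` has succeeded. -/
structure BrkDone (I : SMI n) (M₁ : Equiv.Perm (Fin n)) (i : Fin n) (L₀ : List (PairSet n))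
    (s₀ s : Store) (M : Equiv.Perm (Fin n)) (L : List (PairSet n)) : Prop where
  stab : SMI.Stab I M
  seq : I.ElimSeq (SMI.graph M₁) L (SMI.graph M)
  best : ∀ N, SMI.Stab I N → I.Dom M₁ N → N i ≠ M₁ i → I.Dom M N
  frame : Frame s₀ s
  rep : Rep I s M
  idle : Idle n s
  record : Rec n s (L₀ ++ L)
  cap : slack I (s.arr 20) + s.var 2 ≤ manTotal I
  fail : s.var 21 = 0
  moved : M i ≠ M₁ i

end Ram

namespace Ram

variable {B : ℕ} {Q : List Store → ℕ → Store → Prop} {l : List Store} {r : ℕ} {s : Store} {n : ℕ}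
  {I : SMI n} {M M' : Equiv.Perm (Fin n)}
  {M₁ : Equiv.Perm (Fin n)} {i : Fin n} {L₀ L : List (PairSet n)} {s₀ s₁ t : Store}
  {st : ℕ → Fin n} {h p : ℕ} {ρ : PairSet n}

/-- The potential is 300 times twice the slack of array 20 plus the slack of array 21, with a debt
of 300 for each man on the stack. Advancing a pointer is paid by array 21, a push by borrowing. A
popped man has moved by at least one place, which releases 600: one half repays his debt, the other
half pays for the elimination. -/
theorem brkStep_spec (hB : n + I.totalLength + 2 ≤ B) (ht : Tab I s₀)
    (hs : BrkInv I M₁ i L₀ s₀ s M L st (h + 1)) (hr : 100 * (h + 1) + 100 ≤ r)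
    (hQ : ∀ r' s' M' L' st' h', BrkInv I M₁ i L₀ s₀ s' M' L' st' h' →
      r + 300 * (2 * slack I (s'.arr 20) + slack I (s'.arr 21)) + 300 * (h + 1) + 10 ≤
        r' + 300 * (2 * slack I (s.arr 20) + slack I (s.arr 21)) + 300 * h' → Q l r' s')
    (hQ' : ∀ r' s', BrkFail I M₁ i L₀ s₀ s' M L → s'.var 22 = 0 → r ≤ r' + 60 → Q l r' s') :
    WP B brkStep Q l r s := by
  have hmt := manTotal_le (I := I)
  have ht' := ht.frame hs.frame
  have hh := hs.height
  have hn := hs.height_le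
  have hcap := hs.cap
  have e1 := (hs.stack h (by omega)).1
  have e2 : s.arr 0 (st h + 1) = startOf I.manList (st h + 1) := ht'.start _ (st h).2
  have b1 := (st h).2
  have b2 := startOf_le_manTotal (I := I) (k := st h + 1) (st h).2
  have b3 := hs.nxt_le (st h)
  unfold brkStep
  by_cases hk : s.arr 21 (st h) < startOf I.manList (st h + 1)
  · obtain ⟨w, hw, hpw⟩ := exists_pos (i := st h)
      (le_trans (by rw [hs.rep.pos]; exact Nat.le_add_right _ _) (hs.nxt_ge (st h))) hk
    have e3 := ht'.entry (st h) w hw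
    have e4 := ht'.rank (st h) w hw
    have e5 : s.arr 22 w = M.symm w := by simpa using hs.rep.husb (M.symm w)
    have e6 : s.arr 23 w = I.womanRank w (M.symm w) := by simpa using hs.rep.crk (M.symm w)
    have b4 := w.2
    rw [← hpw] at hk
    by_cases hlt : I.womanRank w (st h) < I.womanRank w (M.symm w)
    · have b5 := (M.symm w).2
      by_cases hoff : s.arr 24 (M.symm w) = 0
      · simp [hh, e1, ← hpw, e2, hk, e3, e4, e5, e6, hlt, hoff]
        repeat (refine ⟨by omega, ?_⟩)
        refine hQ _ _ M L _ (h + 2) (hs.push hw hpw.symm hlt hoff ?_ ?_ ?_ ?_ ?_ ?_) ?_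
        case refine_1 =>
          repeat first
            | exact Frame.refl _
            | refine Frame.setVar ?_ (by omega)
            | refine Frame.setArr ?_ (by omega)
        case refine_2 =>
          intro x hx
          simp [show x ≠ 22 ∧ x ≠ 23 ∧ x ≠ 24 ∧ x ≠ 25 ∧ x ≠ 27 by omega]
        case refine_4 =>
          intro a ha ha'
          simp [ha, ha']
        all_goals simp
        omega
      · obtain ⟨p, hp, hup⟩ := (hs.off (M.symm w)).resolve_left hoff
        have e7 : s.arr 24 (M.symm w) = p + 1 := by rw [← hup]; exact (hs.stack p hp).2
        obtain ⟨M', ρ, h1, h2, h3, h4, h5⟩ := hs.exists_cycle hw hpw.symm hlt (by omega) hup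
        have hM' := h1.stab hs.stab
        simp [hh, e1, ← hpw, e2, hk, e3, e4, e5, e6, hlt, e7]
        repeat (refine ⟨by omega, ?_⟩)
        generalize hs'' : ((((s.setVar 23 ↑(st h)).setVar 24 (pos I (st h) w)).setVar 25
          ↑w).setVar 27 ↑(M.symm w)).setVar 26 p = s'
        have hs' : BrkInv I M₁ i L₀ s₀ s' M L st (h + 1) := by
          rw [← hs'']
          exact ((((hs.setVar (by omega)).setVar (by omega)).setVar (by omega)).setVar
            (by omega)).setVar (by omega)
        have ha : s'.arr = s.arr := by rw [← hs'']; rfl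
        have hcap' := hs'.cap
        refine popLoop_spec (st := st) (p := p) (h₁ := h + 1) hB (ht.frame hs'.frame) hs'.rep
          (by omega) hs'.height (by rw [← hs'']; simp) hs'.inj (fun x hx => (hs'.stack x hx).1)
          (fun x hx hx' => by rw [ha]; exact (h4 x hx hx').1)
          (fun x hx hx' => (h4 x hx hx').2.lt) hM'.mem_man hM'.mem_woman hs'.cap (by omega)
          fun r' s₂ hr' hP => ?_
        have hsl := hP.slack_le
        have htop := hP.top
        have hcl := hs'.record.count_le
        have hc1 := hP.count
        simp
        repeat (refine ⟨by omega, ?_⟩)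
        refine hQ _ _ M' _ st p (hs'.eliminate (by omega) h1 h2 h3 (by rw [ha]; exact h4) h5 hP
          ?_ ?_ ?_ ?_ ?_) ?_
        · repeat first
            | exact Frame.refl _
            | refine Frame.setVar ?_ (by omega)
            | refine Frame.setArr ?_ (by omega)
        · simp
        · intro x hx
          simp [hx]
        · simp
        · intro a ha'
          simp [ha']
        · simp only [Store.setArr_arr, Store.setVar_arr]
          simp only [Nat.reduceEqDiff, if_false, hP.next]
          rw [ha] at hsl ⊢
          omega
    · simp [hh, e1, ← hpw, e2, hk, e3, e4, e6, hlt]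
      repeat (refine ⟨by omega, ?_⟩)
      have hsl := slack_update (I := I) (f := s.arr 21) (i := st h) (v := pos I (st h) w + 1)
        (by omega) (by omega)
      refine hQ _ _ M L _ (h + 1) (hs.advance hw hpw.symm (not_lt.1 hlt) ?_ ?_ ?_ ?_) ?_
      case refine_1 =>
        repeat first
          | exact Frame.refl _
          | refine Frame.setVar ?_ (by omega)
          | refine Frame.setArr ?_ (by omega)
      case refine_2 =>
        intro x hx
        simp [show x ≠ 23 ∧ x ≠ 24 ∧ x ≠ 25 by omega]
      case refine_3 =>
        intro a ha
        simp [ha]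
      all_goals simp
      omega
  · simp [hh, e1, e2, hk]
    repeat (refine ⟨by omega, ?_⟩)
    refine hQ' _ _ ⟨hs.stab, hs.seq, hs.frame.trans ?_, hs.rep.congr rfl rfl rfl rfl (by simp),
      hs.record.congr (by simp) (by simp) rfl rfl rfl, by simpa using hs.cap, by simp,
      (hs.bottom (by omega)).2, fun N hN hd => hs.stuck (not_lt.1 hk) hN hd⟩ (by simp) (by omega)
    repeat first
      | exact Frame.refl _
      | refine Frame.setVar ?_ (by omega)

/-- Between searches the two pointer arrays agree, so the potential is 900 times the slack. Failure
leaves up to `300 n` of unpaid debt as well as shifted pointers and marks; rebuilding the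
representation takes linear time, and this makes up the additional `700 n`. -/
theorem brk_spec (hB : n + I.totalLength + 2 ≤ B) (ht : Tab I s) (hM : SMI.Stab I M)
    (hs : Rep I s M) (hid : Idle n s) (hrec : Rec n s L₀)
    (hcap : slack I (s.arr 20) + s.var 2 ≤ manTotal I) (hi : s.var 3 = i)
    (hr : 900 * slack I (s.arr 20) + 700 * n + 700 ≤ r)
    (hQ : ∀ r' s' M' L, BrkDone I M i L₀ s s' M' L →
      r + 900 * slack I (s'.arr 20) ≤ r' + 900 * slack I (s.arr 20) + 400 → Q l r' s')
    (hQ' : ∀ r' s' M' L, BrkFail I M i L₀ s s' M' L → Idle n s' →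
      r ≤ r' + 900 * slack I (s.arr 20) + 700 * n + 700 → Q l r' s') :
    WP B brk Q l r s := by
  have hmt := manTotal_le (I := I)
  have hi' := i.2
  unfold brk
  simp [hi]
  repeat (refine ⟨by omega, ?_⟩)
  refine WP_loop (fun l' r' s' => l' = l ∧
    ((∃ M' L st h, BrkInv I M i L₀ s s' M' L st h ∧
      r + 300 * (2 * slack I (s'.arr 20) + slack I (s'.arr 21)) ≤
        r' + 900 * slack I (s.arr 20) + 300 * h + 30) ∨
    (∃ M' L, BrkFail I M i L₀ s s' M' L ∧ s'.var 22 = 0 ∧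
      r ≤ r' + 900 * slack I (s.arr 20) + 300 * n + 100))) ?_ ?_
  · refine ⟨rfl, Or.inl ⟨M, [], fun _ => i, 1, ?_, ?_⟩⟩
    · constructor
      case stab => exact hM
      case seq => exact .nil _
      case best => exact fun N _ hd _ => hd
      case frame =>
        repeat first
          | exact Frame.refl _
          | refine Frame.setVar ?_ (by omega)
          | refine Frame.setArr ?_ (by omega)
      case rep =>
        exact hs.congr (by simp) (by simp) (by simp) (by simp) (by simp)
      case record =>
        rw [List.append_nil]
        exact hrec.congr (by simp) (by simp) (by simp) (by simp) (by simp)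
      case cap => simpa using hcap
      case height => simp
      case fail => simp
      case stack =>
        intro x hx
        obtain rfl : x = 0 := by omega
        simp
      case off =>
        intro v
        by_cases e : v = i
        · exact Or.inr ⟨0, by omega, e.symm⟩
        · left
          simp [update_fin, e, (hid v).2]
      case nxt_ge => intro v; simp [(hid v).1]
      case nxt_le =>
        intro v
        simp [(hid v).1, hs.pos]
        exact (pos_lt (hM.mem_man v)).le
      case idle => intro v _; simp [(hid v).1]
      case seen =>
        intro v j h1 h2
        simp [(hid v).1, hs.pos] at h2
        omega
      case chain => omega
      case bottom => exact fun _ => ⟨rfl, rfl⟩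
      case done => omega
    · simp only [Store.setArr_arr, Store.setVar_arr]
      simp only [Nat.reduceEqDiff, if_false]
      rw [slack_congr (f := s.arr 21) (g := s.arr 20) fun v => (hid v).1]
      omega
  · rintro l' r' s' ⟨rfl, ⟨M', L, st, h, hI, hc⟩ | ⟨M', L, hF, h22, hc⟩⟩
    · have hle : h ≤ n := by
        exact hI.height_le
      simp only [Expr.eval, Expr.cost, hI.height]
      refine ⟨by omega, fun h0 => ?_, fun h0 => ?_⟩
      · subst h0
        simp [hI.fail]
        refine ⟨by omega, by omega, ?_⟩
        have hid' : Idle n s' := by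
          intro v
          have : s'.arr 24 v = 0 := by
            rcases hI.off v with h | ⟨x, hx, -⟩
            · exact h
            · omega
          exact ⟨hI.idle v this, this⟩
        refine hQ _ _ M' L ⟨hI.stab, hI.seq, hI.best, hI.frame, hI.rep, hid', hI.record, hI.cap,
          hI.fail, hI.done rfl⟩ ?_
        rw [slack_congr (f := s'.arr 21) (g := s'.arr 20) fun v => (hid' v).1] at hc
        omega
      · obtain ⟨h, rfl⟩ : ∃ h', h = h' + 1 := ⟨h - 1, by omega⟩
        refine brkStep_spec hB ht hI (by omega) ?_ ?_
        · intro r₂ s₂ M₂ L₂ st₂ h₂ hI₂ hc₂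
          exact ⟨rfl, Or.inl ⟨M₂, L₂, st₂, h₂, hI₂, by omega⟩⟩
        · intro r₂ s₂ hF h22 hc₂
          exact ⟨rfl, Or.inr ⟨M', L, hF, h22, by omega⟩⟩
    · simp [h22, hF.fail]
      refine ⟨by omega, by omega, ?_⟩
      have ht' := ht.frame hF.frame
      -- Loading the present positions again clears the marks and puts the search pointers back to
      -- the partners.
      refine copy_spec (by decide) ht'.size (by omega) ?_ (by omega) ?_
      · intro x hx
        rw [hF.rep.pos ⟨x, hx⟩]
        have := pos_lt_manTotal (hF.stab.mem_man ⟨x, hx⟩)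
        omega
      · intro r₂ s₂ h1 h2 h3 h4
        have hf2 : LoadFrame s' s₂ := by
          refine ⟨⟨fun a ha => h2 a (by omega), fun x hx => h3 x (by omega)⟩,
            fun a ha ha' => h2 a (by omega), fun x hx hx' => h3 x (by omega), h3 _ (by omega)⟩
        have hpos : ∀ v : Fin n, s₂.arr 26 v = pos I v (M' v) := fun v => by
          rw [h4 v v.2, hF.rep.pos]
        refine load_spec (a := 26) (by omega) i.pos hB (ht'.frame hf2.frame) hF.stab.mem_man
          hF.stab.mem_woman hpos (by omega) ?_
        intro r₃ s₃ h5 h6 h7 h8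
        have hlf := hf2.trans h6
        refine hQ' _ _ M' L ⟨hF.stab, hF.seq, hF.frame.trans hlf.frame, h7, hF.record.congr
          (hlf.var 1 (by omega) (by omega)) (hlf.var 2 (by omega) (by omega))
          (hlf.arr 7 (by omega) (by omega)) (hlf.arr 8 (by omega) (by omega))
          (hlf.arr 9 (by omega) (by omega)), ?_, by rw [hlf.fail]; exact hF.fail, hF.same, hF.stuck⟩
          h8 (by omega)
        rw [hlf.var 2 (by omega) (by omega), slack_congr (g := s'.arr 20) fun v => by
          rw [h7.pos, hF.rep.pos]]
        exact hF.cap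

end Ram

/-! ### Preprocessing: table of ranks, sorting, deferred acceptance. -/

namespace Ram

variable {B : ℕ} {Q : List Store → ℕ → Store → Prop} {l : List Store} {r : ℕ} {s : Store} {n : ℕ}
  {I : SMI n} {M M' : Equiv.Perm (Fin n)}

/-! # The table of ranks -/

/-- The memory still holds the input. -/
structure Input (I : SMI n) (s : Store) : Prop where
  size : s.var 0 = n
  start : ∀ k ≤ n, s.arr 0 k = startOf I.manList k
  entry : s.arr 1 = entryOf I.manList
  womanStart : ∀ k ≤ n, s.arr 2 k = startOf I.womanList k
  womanEntry : s.arr 3 = entryOf I.womanList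

theorem input_inputStore (I : SMI n) : Input I (inputStore I) := by
  refine ⟨by simp [inputStore], fun k hk => by simp [inputStore, hk], by ext; simp [inputStore],
    fun k hk => by simp [inputStore, hk], by ext; simp [inputStore]⟩

theorem Input.congr {t : Store} (h : Input I s) (h0 : t.var 0 = s.var 0)
    (ha : ∀ a < 4, t.arr a = s.arr a) : Input I t :=
  ⟨by rw [h0, h.size], by rw [ha 0 (by omega)]; exact h.start,
    by rw [ha 1 (by omega)]; exact h.entry, by rw [ha 2 (by omega)]; exact h.womanStart,
    by rw [ha 3 (by omega)]; exact h.womanEntry⟩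

theorem womanStart_le {k : ℕ} (hk : k ≤ n) : startOf I.womanList k ≤ I.totalLength := by
  refine (startOf_mono _ hk).trans ?_
  rw [startOf_eq_sum]
  exact Nat.le_add_left _ _

/-- Compute the rank of man number `28` on the list of the woman at position `24`. -/
def rankEntry : Com :=
  .assign 25 (.read 1 (.var 24)) ;;
  .assign 27 (.read 2 (.var 25)) ;;
  .write 10 (.var 24)
    (.add (.sub (.read 2 (.add (.var 25) (.const 1))) (.read 2 (.var 25))) (.const 1)) ;;
  .loop (.lt (.var 27) (.read 2 (.add (.var 25) (.const 1))))
    (.ite (.eq (.read 3 (.var 27)) (.var 28))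
      (.write 10 (.var 24) (.sub (.add (.var 27) (.const 1)) (.read 2 (.var 25)))) .skip ;;
      .assign 27 (.add (.var 27) (.const 1))) ;;
  .assign 24 (.add (.var 24) (.const 1))

def rankTable : Com :=
  .assign 24 (.const 0) ;;
  .assign 28 (.const 0) ;;
  .loop (.lt (.var 24) (.read 0 (.var 0)))
    (.ite (.lt (.var 24) (.read 0 (.add (.var 28) (.const 1)))) rankEntry
      (.assign 28 (.add (.var 28) (.const 1))))

/-- The value one beyond the length of the woman's list is written first and survives if she does
not list the man. Such a man then compares worse than any husband, and no later procedure needs to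
test acceptability. -/
theorem rankEntry_spec {i j : Fin n} (hB : n + I.totalLength + 2 ≤ B) (hI : Input I s)
    (hj : j ∈ I.manList i) (hk : s.var 24 = pos I i j) (hi : s.var 28 = i)
    (hr : 40 * n + 60 ≤ r)
    (hQ : ∀ r' s', r ≤ r' + 40 * n + 60 → s'.var 24 = pos I i j + 1 → s'.var 28 = (i : ℕ) →
      s'.var 0 = n → (∀ a, a ≠ 10 → s'.arr a = s.arr a) →
      s'.arr 10 = Function.update (s.arr 10) (pos I i j) (I.womanRank j i) → Q l r' s') :
    WP B rankEntry Q l r s := by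
  have hmt := manTotal_le (I := I)
  have b1 := pos_lt_manTotal hj
  have e1 : s.arr 1 (pos I i j) = j := by rw [hI.entry]; exact entryOf_pos hj
  have e2 := hI.womanStart j j.2.le
  have e3 := hI.womanStart (j + 1) j.2
  have e4 := startOf_succ I.womanList j
  have b2 := womanList_length_le (I := I) j
  have b3 := womanStart_le (I := I) (k := j + 1) j.2
  have b4 := j.2
  have hidx : (I.womanList j).idxOf i ≤ (I.womanList j).length := List.idxOf_le_length
  have hnd := I.womanList_nodup j
  unfold rankEntry
  simp [hk, e1, e2, e3]
  repeat (refine ⟨by omega, ?_⟩)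
  refine WP_loop (fun l' r' s' => l' = l ∧ ∃ y ≤ (I.womanList j).length,
    s'.var 27 = startOf I.womanList j + y ∧ s'.var 24 = pos I i j ∧ s'.var 25 = j ∧ s'.var 28 = i ∧
    s'.var 0 = n ∧ (∀ a, a ≠ 10 → s'.arr a = s.arr a) ∧
    s'.arr 10 = Function.update (s.arr 10) (pos I i j)
      (if (I.womanList j).idxOf i < y then (I.womanList j).idxOf i + 1
        else (I.womanList j).length + 1) ∧
    40 * ((I.womanList j).length - y) + 20 ≤ r' ∧ r ≤ r' + 30 + 40 * y) ?_ ?_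
  · refine ⟨rfl, 0, by omega, by simp, by simp [hk], by simp, by simp [hi], by simp [hI.size],
      fun a ha => by simp [ha], ?_, by omega, by omega⟩
    simp
    congr 1
    omega
  · rintro l' r' s' ⟨rfl, y, hy, h1, h2, h3, h4, h5, h6, h7, h8, h9⟩
    have e5 : s'.arr 2 (j + 1) = startOf I.womanList (j + 1) := by rw [h6 2 (by omega), e3]
    have e6 : s'.arr 2 j = startOf I.womanList j := by rw [h6 2 (by omega), e2]
    simp only [Expr.eval, Expr.cost, h1, h3, e5]
    refine ⟨by omega, fun h => ?_, fun h => ?_⟩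
    · have hyl : y = (I.womanList j).length := by
        by_contra hc
        rw [if_pos (by omega)] at h
        exact one_ne_zero h
      simp [h2]
      repeat (refine ⟨by omega, ?_⟩)
      refine hQ _ _ (by omega) (by simp) (by simp [h4]) (by simp [h5])
        (fun a ha => by simp [h6 a ha]) ?_
      simp only [Store.setVar_arr, h7]
      congr 1
      unfold SMI.womanRank
      split_ifs <;> omega
    · have hyl : y < (I.womanList j).length := by
        by_contra hc
        rw [if_neg (by omega)] at h
        exact h rfl
      have e7 : s'.arr 3 (startOf I.womanList j + y) = (I.womanList j)[y] := by
        rw [h6 3 (by omega), hI.womanEntry]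
        exact entryOf_startOf _ _ _ hyl
      have hidx' : (I.womanList j)[y] = i ↔ (I.womanList j).idxOf i = y := by
        constructor
        · intro e
          rw [← e]
          exact hnd.idxOf_getElem y hyl
        · rintro rfl
          simp
      refine WP.abstract fun P hP => ?_
      by_cases he : (I.womanList j)[y] = i
      · have hy' := hidx'.1 he
        simp [h1, h2, h3, h4, e6, e7, he]
        repeat (refine ⟨by omega, ?_⟩)
        refine hP _ _ _ ⟨rfl, y + 1, by omega, by simp; omega, by simp [h2], by simp [h3], by simp [h4],
          by simp [h5], fun a ha => by simp [h6 a ha, ha], ?_, by omega, by omega⟩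
        simp [h7, hy']
        congr 1
        omega
      · have hy' := mt hidx'.2 he
        simp [h1, h2, h3, h4, e6, e7, Fin.val_inj, he]
        repeat (refine ⟨by omega, ?_⟩)
        refine hP _ _ _ ⟨rfl, y + 1, by omega, by simp; omega, by simp [h2], by simp [h3], by simp [h4],
          by simp [h5], fun a ha => by simp [h6 a ha], ?_, by omega, by omega⟩
        simp only [Store.setVar_arr, h7]
        congr 1
        split_ifs <;> omega

/-- Every iteration either treats a position, in time linear in `n`, or passes to the next man.
There are at most `manTotal I + n` iterations, which also covers empty lists. -/
theorem rankTable_spec (hB : n + I.totalLength + 2 ≤ B) (hI : Input I s)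
    (hr : (40 * n + 100) * manTotal I + 40 * n + 40 ≤ r)
    (hQ : ∀ r' s', r ≤ r' + (40 * n + 100) * manTotal I + 40 * n + 40 → Input I s' → Tab I s' →
      Q l r' s') :
    WP B rankTable Q l r s := by
  have hmt := manTotal_le (I := I)
  unfold rankTable
  simp
  refine ⟨by omega, by omega, ?_⟩
  refine WP_loop (fun l' r' s' => l' = l ∧ Input I s' ∧ ∃ k q, k ≤ manTotal I ∧ q ≤ n ∧
    s'.var 24 = k ∧ s'.var 28 = q ∧ startOf I.manList q ≤ k ∧
    (∀ i j, j ∈ I.manList i → pos I i j < k → s'.arr 10 (pos I i j) = I.womanRank j i) ∧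
    (40 * n + 100) * (manTotal I - k) + 40 * (n - q) + 20 ≤ r' ∧
    r ≤ r' + (40 * n + 100) * k + 40 * q + 20) ?_ ?_
  · refine ⟨rfl, hI.congr (by simp) (by simp), 0, 0, by omega, by omega, by simp, by simp,
      by simp [startOf_zero], by omega, ?_, by omega⟩
    rw [Nat.sub_zero]
    omega
  · rintro l' r' s' ⟨rfl, hI', k, q, hk, hq, h1, h2, h3, h4, h5, h6⟩
    have e1 : s'.arr 0 n = manTotal I := hI'.start n le_rfl
    simp only [Expr.eval, Expr.cost, h1, hI'.size, e1]
    refine ⟨by omega, fun h => ?_, fun h => ?_⟩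
    · have hkm : k = manTotal I := by
        by_contra hc
        rw [if_pos (by omega)] at h
        exact one_ne_zero h
      subst hkm
      refine hQ _ _ (by omega) hI' ⟨hI'.size, hI'.start, fun i j hj => ?_, fun i j hj =>
        h4 i j hj (pos_lt_manTotal hj)⟩
      rw [hI'.entry]
      exact entryOf_pos hj
    · have hkm : k < manTotal I := by
        by_contra hc
        rw [if_neg (by omega)] at h
        exact h rfl
      have hqn : q < n := by
        by_contra hc
        obtain rfl : q = n := by omega
        unfold manTotal at hkm
        omega
      have e2 := hI'.start (q + 1) hqn
      refine WP.abstract fun P hP => ?_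
      by_cases hc : k < startOf I.manList (q + 1)
      · obtain ⟨d, hd⟩ : ∃ d, manTotal I - k = d + 1 := ⟨manTotal I - k - 1, by omega⟩
        have hd' : manTotal I - (k + 1) = d := by omega
        rw [hd, Nat.mul_succ] at h5
        simp [h1, h2, e2, hc]
        repeat (refine ⟨by omega, ?_⟩)
        obtain ⟨j, hj, hp⟩ := exists_pos (i := ⟨q, hqn⟩) h3 hc
        refine rankEntry_spec (i := ⟨q, hqn⟩) (j := j) hB hI' hj (by omega) h2 (by omega) ?_
        intro r₂ s₂ g1 g2 g3 g4 g5 g6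
        refine hP _ _ _ ⟨rfl, hI'.congr (by rw [g4, hI'.size]) fun a ha => g5 a (by omega), k + 1, q,
          by omega, by omega, by omega, g3, by omega, ?_, by rw [hd']; omega, ?_⟩
        · intro i' j' hj' hlt
          rw [g6, Function.update_apply]
          split_ifs with e
          -- The intervals of positions of different men are disjoint, so a position determines its
          -- man.
          · have hi' : i' = ⟨q, hqn⟩ := by
              rcases lt_trichotomy i' ⟨q, hqn⟩ with h' | h' | h'
              · have h7 := pos_lt hj'
                have h8 := startOf_mono I.manList (show (i' : ℕ) + 1 ≤ q from h')
                omega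
              · exact h'
              · have h7 : startOf I.manList i' ≤ pos I i' j' := Nat.le_add_right _ _
                have h8 := startOf_mono I.manList (show q + 1 ≤ (i' : ℕ) from h')
                omega
            subst hi'
            rw [pos_inj hj e.symm]
          · exact h4 i' j' hj' (by omega)
        · rw [Nat.mul_succ]
          omega
      · simp [h1, h2, e2, hc]
        repeat (refine ⟨by omega, ?_⟩)
        refine hP _ _ _ ⟨rfl, hI'.congr (by simp) (by simp), k, q + 1, by omega, by omega, by simp [h1],
          by simp, by omega, by simpa using h4, by omega, by omega⟩

/-! # Sorting the positions by rank -/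

/-- The first `s.var 4` entries of array 11 are the positions of ranks at most `n`, sorted. -/
structure Sorted (I : SMI n) (s : Store) : Prop where
  le : s.var 4 ≤ manTotal I
  lt : ∀ y < s.var 4, s.arr 11 y < manTotal I
  mono : ∀ y y', y ≤ y' → y' < s.var 4 → s.arr 10 (s.arr 11 y) ≤ s.arr 10 (s.arr 11 y')
  surj : ∀ k < manTotal I, 1 ≤ s.arr 10 k → s.arr 10 k ≤ n → ∃ y < s.var 4, s.arr 11 y = k

theorem Sorted.frame {s' : Store} (h : Sorted I s) (hf : Frame s s') : Sorted I s' := by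
  have h4 := hf.var 4 (by omega)
  have h10 := hf.arr 10 (by omega)
  have h11 := hf.arr 11 (by omega)
  exact ⟨by rw [h4]; exact h.le, by rw [h4, h11]; exact h.lt, by rw [h4, h10, h11]; exact h.mono,
    by rw [h4, h10, h11]; exact h.surj⟩

/-- One pass over all positions for each rank from 1 to `n`. Within a pass positions are appended in
increasing order, so the result is sorted lexicographically by rank and position. -/
def sort : Com :=
  .assign 4 (.const 0) ;;
  forLoop 28 (
    .assign 24 (.const 0) ;;
    .loop (.lt (.var 24) (.read 0 (.var 0)))
      (.ite (.eq (.read 10 (.var 24)) (.add (.var 28) (.const 1)))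
        (.write 11 (.var 4) (.var 24) ;; .assign 4 (.add (.var 4) (.const 1))) .skip ;;
      .assign 24 (.add (.var 24) (.const 1))))

/-- The state of `sort` when the ranks up to `q`, and for the rank `q + 1` the positions up to `k`,
have been treated. -/
structure SortInv (I : SMI n) (V : ℕ → ℕ) (q k : ℕ) (s : Store) : Prop where
  bound : ∀ y < s.var 4, s.arr 11 y < manTotal I ∧
    (V (s.arr 11 y) ≤ q ∨ V (s.arr 11 y) = q + 1 ∧ s.arr 11 y < k)
  lex : ∀ y y', y < y' → y' < s.var 4 → V (s.arr 11 y) < V (s.arr 11 y') ∨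
    V (s.arr 11 y) = V (s.arr 11 y') ∧ s.arr 11 y < s.arr 11 y'
  surj : ∀ x < manTotal I, 1 ≤ V x → V x ≤ q ∨ V x = q + 1 ∧ x < k → ∃ y < s.var 4, s.arr 11 y = x

/-- The order is strict, so the stored positions are distinct and there are at most as many as men's
entries; this bounds the addresses written. -/
theorem SortInv.le {V : ℕ → ℕ} {q k : ℕ} (h : SortInv I V q k s) : s.var 4 ≤ manTotal I := by
  have := Fintype.card_le_of_injective
    (fun y : Fin (s.var 4) => (⟨s.arr 11 y, (h.bound y y.2).1⟩ : Fin (manTotal I))) (by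
      intro y y' e
      have e' : s.arr 11 y = s.arr 11 y' := by simpa using e
      rcases lt_trichotomy y y' with h' | h' | h'
      · have := h.lex y y' h' y'.2
        rw [e'] at this
        omega
      · exact h'
      · have := h.lex y' y h' y.2
        rw [e'] at this
        omega)
  simpa using this

theorem sort_spec (hB : n + I.totalLength + 2 ≤ B) (ht : Tab I s)
    (hr : (40 * manTotal I + 60) * n + 40 ≤ r)
    (hQ : ∀ r' s', r ≤ r' + (40 * manTotal I + 60) * n + 40 → (∀ a, a ≠ 11 → s'.arr a = s.arr a) →
      s'.var 0 = n → Tab I s' → Sorted I s' → Q l r' s') :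
    WP B sort Q l r s := by
  have hmt := manTotal_le (I := I)
  have key : (40 * manTotal I + 52 + 8) * n = (40 * manTotal I + 60) * n := by ring
  unfold sort
  simp
  refine ⟨by omega, ?_⟩
  refine WP_forLoop (c := 40 * manTotal I + 52) (n := n) (fun q s' =>
    (∀ a, a ≠ 11 → s'.arr a = s.arr a) ∧ SortInv I (s.arr 10) q 0 s') (by decide)
    (by simp [ht.size]) (by omega) ?_ (by omega) ?_ ?_
  · refine ⟨by simp, by simp, by simp, ?_⟩
    intro x _ h1 h2
    omega
  · rintro q s' r' hq ⟨h1, h2⟩ h3 h4 hr'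
    refine WP.abstract fun P hP => ?_
    simp
    refine ⟨by omega, ?_⟩
    refine WP_loop (fun l' r₂ s₂ => l' = l ∧ ∃ k ≤ manTotal I, s₂.var 24 = k ∧ s₂.var 28 = q ∧
      s₂.var 0 = n ∧ (∀ a, a ≠ 11 → s₂.arr a = s.arr a) ∧ SortInv I (s.arr 10) q k s₂ ∧
      40 * (manTotal I - k) + 20 ≤ r₂ ∧ r' ≤ r₂ + 40 * k + 20) ?_ ?_
    · refine ⟨rfl, 0, by omega, by simp, by simp [h3], by simp [h4], by simpa using h1, ?_,
        by omega, by omega⟩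
      exact ⟨by simpa using h2.bound, by simpa using h2.lex, by simpa using h2.surj⟩
    · rintro l' r₂ s₂ ⟨rfl, k, hk, g1, g2, g3, g4, g5, g6, g7⟩
      have e1 : s₂.arr 0 n = manTotal I := by
        rw [g4 0 (by omega)]
        exact ht.start n le_rfl
      have hle := g5.le
      simp only [Expr.eval, Expr.cost, g1, g3, e1]
      refine ⟨by omega, fun h => ?_, fun h => ?_⟩
      · have hkm : k = manTotal I := by
          by_contra hc
          rw [if_pos (by omega)] at h
          exact one_ne_zero h
        subst hkm
        refine hP _ _ _ ⟨rfl, by omega, g2, g3, by simpa using g4, ?_, ?_, ?_⟩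
        · intro y hy
          have := g5.bound y (by simpa using hy)
          refine ⟨this.1, Or.inl ?_⟩
          have := this.2
          simp
          omega
        · simpa using g5.lex
        · intro x hx hx1 hx2
          simpa using g5.surj x hx hx1 (by omega)
      · have hkm : k < manTotal I := by
          by_contra hc
          rw [if_neg (by omega)] at h
          exact h rfl
        have e2 : s₂.arr 10 k = s.arr 10 k := by rw [g4 10 (by omega)]
        refine WP.abstract fun P' hP' => ?_
        by_cases hc : s.arr 10 k = q + 1
        · simp [g1, g2, e2, hc]
          repeat (refine ⟨by omega, ?_⟩)
          refine hP' _ _ _ ⟨rfl, k + 1, by omega, by simp, by simp [g2], by simp [g3],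
            fun a ha => by simp [g4 a ha, ha], ⟨?_, ?_, ?_⟩, by omega, by omega⟩
          · intro y hy
            simp at hy
            simp only [Store.setVar_arr, Store.setArr_arr, if_true, Function.update_apply]
            split_ifs with e
            · exact ⟨hkm, Or.inr ⟨hc, by omega⟩⟩
            · have := g5.bound y (by omega)
              exact ⟨this.1, by omega⟩
          · intro y y' hy hy'
            simp at hy'
            simp only [Store.setVar_arr, Store.setArr_arr, if_true, Function.update_apply]
            rw [if_neg (show y ≠ s₂.var 4 by omega)]
            split_ifs with e
            · have := (g5.bound y (by omega)).2
              omega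
            · exact g5.lex y y' hy (by omega)
          · intro x hx hx1 hx2
            by_cases e : x = k
            · exact ⟨s₂.var 4, by simp, by simp [e]⟩
            · obtain ⟨y, hy, hy'⟩ := g5.surj x hx hx1 (by omega)
              refine ⟨y, by simp; omega, ?_⟩
              simp [Function.update_of_ne (show y ≠ s₂.var 4 by omega), hy']
        · simp [g1, g2, e2, hc]
          repeat (refine ⟨by omega, ?_⟩)
          refine hP' _ _ _ ⟨rfl, k + 1, by omega, by simp, by simp [g2], by simp [g3],
            by simpa using g4, ⟨?_, ?_, ?_⟩, by omega, by omega⟩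
          · intro y hy
            have := g5.bound y (by simpa using hy)
            refine ⟨this.1, ?_⟩
            have := this.2
            simp
            omega
          · simpa using g5.lex
          · intro x hx hx1 hx2
            have : s.arr 10 x = q + 1 → x ≠ k := by
              rintro hv rfl
              exact hc hv
            simpa using g5.surj x hx hx1 (by omega)
  · rintro r' s' ⟨h1, h2⟩ - h4 h5
    have e10 := h1 10 (by omega)
    refine hQ _ _ (by omega) h1 h4 ⟨h4, by rw [h1 0 (by omega)]; exact ht.start,
      by rw [h1 1 (by omega)]; exact ht.entry, by rw [e10]; exact ht.rank⟩
      ⟨h2.le, fun y hy => (h2.bound y hy).1, fun y y' hy hy' => ?_, ?_⟩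
    · rw [e10]
      rcases hy.lt_or_eq with h | rfl
      · have := h2.lex y y' h hy'
        omega
      · exact le_rfl
    · rw [e10]
      exact fun k hk h6 h7 => h2.surj k hk h6 (Or.inl h7)

end Ram

namespace Ram

variable {B : ℕ} {Q : List Store → ℕ → Store → Prop} {l : List Store} {r : ℕ} {s t : Store} {n : ℕ}
  {I : SMI n} {M M' : Equiv.Perm (Fin n)}

/-! # The man-optimal stable matching -/

theorem sum_update {f : ℕ → ℕ} {j : Fin n} {v : ℕ} (h : v ≤ f j) :
    ∑ x : Fin n, Function.update f j v x + (f j - v) = ∑ x : Fin n, f x := by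
  rw [← Finset.add_sum_erase _ _ (Finset.mem_univ j),
    ← Finset.add_sum_erase _ (fun x : Fin n => f x) (Finset.mem_univ j), Function.update_self]
  have : ∀ x ∈ Finset.univ.erase j, Function.update f j v (x : ℕ) = f x := by
    intro x hx
    rw [update_fin, if_neg (Finset.mem_erase.1 hx).1]
  rw [Finset.sum_congr rfl this]
  omega

/-- Numbers of men are shifted by one, and 0 means nobody: it stands for a woman without fiancé and
ends a chain of proposals. The pointer of a displaced man still shows the woman who left him; his
next proposal to her fails and advances it. -/
def proposal : Com :=
  .assign 24 (.read 20 (.sub (.var 23) (.const 1))) ;;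
  .ite (.lt (.var 24) (.read 0 (.var 23)))
    (.assign 25 (.read 1 (.var 24)) ;;
      .ite (.lt (.read 10 (.var 24)) (.read 23 (.var 25)))
        (.assign 27 (.read 27 (.var 25)) ;;
          .write 27 (.var 25) (.var 23) ;;
          .write 23 (.var 25) (.read 10 (.var 24)) ;;
          .assign 23 (.var 27))
        (.write 20 (.sub (.var 23) (.const 1)) (.add (.var 24) (.const 1))))
    (.assign 23 (.const 0))

/-- Deferred acceptance; array 27 holds the fiancés, and register 23 the proposing man, both
increased by one. -/
def galeShapley : Com :=
  forLoop 28 (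
    .write 20 (.var 28) (.read 0 (.var 28)) ;;
    .write 23 (.var 28)
      (.add (.sub (.read 2 (.add (.var 28) (.const 1))) (.read 2 (.var 28))) (.const 1)) ;;
    .write 27 (.var 28) (.const 0)) ;;
  .assign 28 (.const 0) ;;
  .loop (.lt (.var 28) (.var 0))
    (.assign 23 (.add (.var 28) (.const 1)) ;;
      .loop (.var 23) proposal ;;
      .assign 28 (.add (.var 28) (.const 1)))

/-- The state of deferred acceptance among the first `q` men, where `v - 1` is proposing. -/
structure GsInv (I : SMI n) (q v : ℕ) (s : Store) : Prop where
  cur : v ≤ q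
  range : ∀ i : Fin n, startOf I.manList i ≤ s.arr 20 i ∧ s.arr 20 i ≤ startOf I.manList (i + 1)
  seen : ∀ i j, j ∈ I.manList i → pos I i j < s.arr 20 i →
    s.arr 23 j ≤ I.womanRank j i ∧ ∀ N, SMI.Stab I N → N i ≠ j
  woman : ∀ j : Fin n, (s.arr 27 j = 0 ∧ s.arr 23 j = (I.womanList j).length + 1) ∨
    ∃ i : Fin n, s.arr 27 j = i + 1 ∧ j ∈ I.manList i ∧ s.arr 20 i = pos I i j ∧
      s.arr 23 j = I.womanRank j i ∧ i ∈ I.womanList j ∧ v ≠ i + 1 ∧ i < q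
  man : ∀ i : Fin n, i < q → v ≠ i + 1 → s.arr 20 i = startOf I.manList (i + 1) ∨
    ∃ j ∈ I.manList i, s.arr 20 i = pos I i j ∧ s.arr 27 j = i + 1

theorem GsInv.congr {q v : ℕ} (h : GsInv I q v s) (h20 : t.arr 20 = s.arr 20)
    (h23 : t.arr 23 = s.arr 23) (h27 : t.arr 27 = s.arr 27) : GsInv I q v t :=
  ⟨h.cur, by rw [h20]; exact h.range, by rw [h20, h23]; exact h.seen,
    by rw [h20, h23, h27]; exact h.woman, by rw [h20, h27]; exact h.man⟩

theorem GsInv.next {q : ℕ} (h : GsInv I q 0 s) : GsInv I (q + 1) (q + 1) s := by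
  refine ⟨le_rfl, h.range, h.seen, fun j => ?_, fun i h1 h2 => h.man i (by omega) (by omega)⟩
  rcases h.woman j with h1 | ⟨i, h1, h2, h3, h4, h5, h6, h7⟩
  · exact Or.inl h1
  · exact Or.inr ⟨i, h1, h2, h3, h4, h5, by omega, by omega⟩

theorem GsInv.exhausted {q : ℕ} {i : Fin n} (h : GsInv I q (i + 1) s)
    (he : startOf I.manList (i + 1) ≤ s.arr 20 i) : GsInv I q 0 s := by
  refine ⟨by omega, h.range, h.seen, fun j => ?_, fun a h1 h2 => ?_⟩
  · rcases h.woman j with h1 | ⟨i, h1, h2, h3, h4, h5, h6, h7⟩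
    · exact Or.inl h1
    · exact Or.inr ⟨i, h1, h2, h3, h4, h5, by omega, by omega⟩
  · by_cases e : a = i
    · subst e
      exact Or.inl (le_antisymm (h.range a).2 he)
    · exact h.man a h1 fun e' => e (Fin.ext (by omega))

/-- Why no man is rejected by a stable partner: if `N` married `i` to `w`, then the fiancé of `w`,
whom she prefers to `i`, has not passed his own partner in `N`. He therefore prefers `w` to that
partner, and the two block `N`. A woman without fiancé rejects only men whom she does not list. -/
theorem GsInv.reject {q : ℕ} {i w : Fin n} (h : GsInv I q (i + 1) s) (hw : w ∈ I.manList i)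
    (hp : s.arr 20 i = pos I i w) (hle : s.arr 23 w ≤ I.womanRank w i)
    (h20 : t.arr 20 = Function.update (s.arr 20) i (pos I i w + 1))
    (h23 : t.arr 23 = s.arr 23) (h27 : t.arr 27 = s.arr 27) : GsInv I q (i + 1) t := by
  refine ⟨h.cur, fun a => ?_, fun a j hj hlt => ?_, fun j => ?_, fun a h1 h2 => ?_⟩
  · rw [h20, update_fin]
    split_ifs with e
    · subst e
      have := (h.range a).1
      have := pos_lt hw
      omega
    · exact h.range a
  · rw [h20, update_fin] at hlt
    rw [h23]
    by_cases ha : a = i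
    · subst ha
      rw [if_pos rfl] at hlt
      rcases Nat.lt_succ_iff_lt_or_eq.1 hlt with h1 | h1
      · exact h.seen a j hj (by omega)
      obtain rfl := pos_inj hj h1
      refine ⟨hle, fun N hN e => ?_⟩
      rcases h.woman j with ⟨-, h3⟩ | ⟨b, h3, h4, h5, h6, h7, h8, -⟩
      · have h4 := SMI.womanRank_le_iff.2 (hN.mem_woman a)
        rw [e] at h4
        omega
      · have hne : b ≠ a := fun e' => h8 (by rw [e'])
        have hNb : N b ≠ j := fun e' => hne (N.injective (e'.trans e.symm))
        have hge : pos I b j < pos I b (N b) := by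
          refine lt_of_le_of_ne ?_ fun e' => hNb (pos_inj h4 e').symm
          by_contra hc
          exact (h.seen b (N b) (hN.mem_man b) (by omega)).2 N hN rfl
        have := hN.stable_lt (pos_lt_pos_iff.1 hge)
        rw [show N.symm j = a by rw [← e]; simp] at this
        omega
    · rw [if_neg ha] at hlt
      exact h.seen a j hj hlt
  · rw [h23, h27, h20]
    rcases h.woman j with h1 | ⟨b, h1, h2, h3, h4, h5, h6, h7⟩
    · exact Or.inl h1
    · refine Or.inr ⟨b, h1, h2, ?_, h4, h5, h6, h7⟩
      rw [update_fin, if_neg fun e => h6 (by rw [e])]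
      exact h3
  · rw [h27, h20, update_fin, if_neg fun e => h2 (by rw [e])]
    exact h.man a h1 h2

/-- The rank held by `w` only improves, so earlier rejections stay justified. The displaced fiancé,
or nobody, becomes the current proposer. The final bound makes every accepted man listed by her. -/
theorem GsInv.accept {q : ℕ} {i w : Fin n} (h : GsInv I q (i + 1) s) (hw : w ∈ I.manList i)
    (hp : s.arr 20 i = pos I i w) (hlt : I.womanRank w i < s.arr 23 w)
    (h20 : t.arr 20 = s.arr 20)
    (h23 : t.arr 23 = Function.update (s.arr 23) w (I.womanRank w i))
    (h27 : t.arr 27 = Function.update (s.arr 27) w (i + 1)) :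
    GsInv I q (s.arr 27 w) t ∧ s.arr 23 w ≤ (I.womanList w).length + 1 := by
  have hcur := h.cur
  have hold : ∀ a : Fin n, s.arr 27 w = a + 1 → s.arr 20 a = pos I a w ∧ w ∈ I.manList a ∧ a < q ∧
      s.arr 23 w = I.womanRank w a ∧ a ∈ I.womanList w ∧ a ≠ i := by
    intro a ha
    rcases h.woman w with ⟨h1, -⟩ | ⟨b, h1, h2, h3, h4, h5, h6, h7⟩
    · omega
    · obtain rfl : b = a := Fin.ext (by omega)
      exact ⟨h3, h2, h7, h4, h5, fun e => h6 (by rw [e])⟩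
  have hlen : s.arr 23 w ≤ (I.womanList w).length + 1 := by
    rcases h.woman w with ⟨-, h1⟩ | ⟨b, h1, h2, h3, h4, h5, h6, h7⟩
    · omega
    · rw [h4]
      exact SMI.womanRank_le I b w
  have hmem : i ∈ I.womanList w := SMI.womanRank_le_iff.1 (by omega)
  refine ⟨⟨?_, by rw [h20]; exact h.range, fun a j hj hlt' => ?_, fun j => ?_,
    fun a h1 h2 => ?_⟩, hlen⟩
  · rcases h.woman w with ⟨h1, -⟩ | ⟨b, h1, -, -, -, -, -, h7⟩ <;> omega
  · rw [h20] at hlt'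
    have := h.seen a j hj hlt'
    rw [h23, update_fin]
    refine ⟨?_, this.2⟩
    split_ifs with e
    · subst e
      omega
    · exact this.1
  · rw [h23, h27, h20, update_fin, update_fin]
    by_cases e : j = w
    · subst e
      simp only [if_true]
      refine Or.inr ⟨i, rfl, hw, hp, rfl, hmem, fun e => (hold i e).2.2.2.2.2 rfl, by omega⟩
    · simp only [e, if_false]
      rcases h.woman j with h1 | ⟨b, h1, h2, h3, h4, h5, h6, h7⟩
      · exact Or.inl h1
      · refine Or.inr ⟨b, h1, h2, h3, h4, h5, fun e' => e ?_, h7⟩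
        exact pos_inj h2 (h3.symm.trans (hold b e').1)
  · rw [h27, h20]
    by_cases e : a = i
    · subst e
      exact Or.inr ⟨w, hw, hp, by simp⟩
    · rcases h.man a h1 fun e' => e (Fin.ext (by omega)) with h3 | ⟨j, h3, h4, h5⟩
      · exact Or.inl h3
      · refine Or.inr ⟨j, h3, h4, ?_⟩
        rw [update_fin, if_neg fun e' => h2 (by rw [← e', h5])]
        exact h5

/-- A woman whom a man has passed holds somebody at least as good, so the engagements are stable,
and by assumption perfect. The women passed are not stable partners, whence optimality for the men.
-/
theorem GsInv.manOpt (hI : I.AllAssigned) (h : GsInv I n 0 s) :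
    ∃ M₀, SMI.ManOpt I M₀ ∧ ∀ i : Fin n, s.arr 20 i = pos I i (M₀ i) := by
  let A : PairSet n := Finset.univ.filter fun p => s.arr 27 p.2 = p.1 + 1
  have hA : ∀ i j, (i, j) ∈ A ↔ s.arr 27 j = (i : ℕ) + 1 := fun i j => by simp [A]
  have hpair : ∀ i j, (i, j) ∈ A → j ∈ I.manList i ∧ s.arr 20 i = pos I i j ∧
      s.arr 23 j = I.womanRank j i ∧ i ∈ I.womanList j := by
    intro i j hij
    rw [hA] at hij
    rcases h.woman j with ⟨h1, -⟩ | ⟨b, h1, h2, h3, h4, h5, -⟩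
    · omega
    · obtain rfl : b = i := Fin.ext (by omega)
      exact ⟨h2, h3, h4, h5⟩
  have hst : I.IsStable A := by
    refine ⟨⟨fun i j hij => ⟨(hpair i j hij).1, (hpair i j hij).2.2.2⟩, fun i j j' h1 h2 => ?_,
      fun i i' j h1 h2 => ?_⟩, ?_⟩
    · exact pos_inj (hpair _ _ h1).1 ((hpair _ _ h1).2.1.symm.trans (hpair _ _ h2).2.1)
    · rw [hA] at h1 h2
      exact Fin.ext (by omega)
    · rintro i j ⟨⟨hj, hi⟩, h1, h2⟩
      have hle : s.arr 23 j ≤ I.womanRank j i := by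
        refine (h.seen i j hj ?_).1
        rcases h1 with h1 | ⟨j', h1, -, -, h3⟩
        · rcases h.man i i.2 (by omega) with h4 | ⟨j', -, -, h5⟩
          · rw [h4]
            exact pos_lt hj
          · exact absurd ((hA i j').2 h5) (h1 j')
        · rw [(hpair _ _ h1).2.1]
          exact pos_lt_pos_iff.2 h3
      rcases h2 with h2 | ⟨i', h2, -, -, h3⟩
      · rcases h.woman j with ⟨-, h4⟩ | ⟨b, h4, -⟩
        · have := SMI.womanRank_le_iff.2 hi
          omega
        · exact h2 b ((hA b j).2 h4)
      · rw [(hpair _ _ h2).2.2.1] at hle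
        omega
  obtain ⟨M₀, hM, hS⟩ := SMI.exists_graph_eq hI hst
  have hpos : ∀ i : Fin n, s.arr 20 i = pos I i (M₀ i) := fun i =>
    (hpair i (M₀ i) (by rw [hM]; simp)).2.1
  refine ⟨M₀, ⟨hS, fun N hN i => ?_⟩, hpos⟩
  by_contra! hc
  rw [← pos_lt_pos_iff, ← hpos] at hc
  exact (h.seen i (N i) (hN.mem_man i) hc).2 N hN rfl

/-- The potential is the slack plus the sum of the ranks held by the women: a rejection lowers the
first, an acceptance the second. An exhausted list lowers neither, but it ends the chain, so it
occurs at most once in each chain. -/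
theorem proposal_spec {q : ℕ} {i : Fin n} (hB : n + I.totalLength + 2 ≤ B) (ht : Tab I s)
    (hs : GsInv I q (i + 1) s) (hv : s.var 23 = i + 1) (hr : 100 ≤ r)
    (hQ : ∀ r' s' v, GsInv I q v s' → s'.var 23 = v → s'.var 28 = s.var 28 → s'.var 0 = s.var 0 →
      s'.var 4 = s.var 4 → (∀ a, a ≠ 20 → a ≠ 23 → a ≠ 27 → s'.arr a = s.arr a) →
      (r + 100 * (slack I (s'.arr 20) + ∑ j : Fin n, s'.arr 23 j) + 10 ≤
        r' + 100 * (slack I (s.arr 20) + ∑ j : Fin n, s.arr 23 j) ∨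
      v = 0 ∧ r + 100 * (slack I (s'.arr 20) + ∑ j : Fin n, s'.arr 23 j) ≤
        r' + 100 * (slack I (s.arr 20) + ∑ j : Fin n, s.arr 23 j) + 100) → Q l r' s') :
    WP B proposal Q l r s := by
  have hmt := manTotal_le (I := I)
  have e2 : s.arr 0 (i + 1) = startOf I.manList (i + 1) := ht.start _ i.2
  have b1 := i.2
  have b2 := startOf_le_manTotal (I := I) (k := i + 1) i.2
  have b3 := hs.range i
  unfold proposal
  by_cases hk : s.arr 20 i < startOf I.manList (i + 1)
  · obtain ⟨w, hw, hpw⟩ := exists_pos b3.1 hk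
    have e3 := ht.entry i w hw
    have e4 := ht.rank i w hw
    have b4 := w.2
    rw [← hpw] at hk
    by_cases hlt : I.womanRank w i < s.arr 23 w
    · simp [hv, e2, ← hpw, e3, e4, hk, hlt]
      have hacc := fun t => hs.accept (t := t) hw hpw.symm hlt
      have hlen : I.womanRank w i ≤ n + 1 ∧ s.arr 27 w ≤ n := by
        refine ⟨(SMI.womanRank_le I i w).trans (Nat.succ_le_succ (womanList_length_le w)), ?_⟩
        rcases hs.woman w with ⟨h1, -⟩ | ⟨b, h1, -⟩
        · omega
        · have := b.2
          omega
      have hsum := sum_update hlt.le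
      repeat (refine ⟨by omega, ?_⟩)
      refine hQ _ _ (s.arr 27 w) (hacc _ (by simp) (by simp) (by simp)).1 (by simp) (by simp)
        (by simp) (by simp) (fun a h1 h2 h3 => by simp [h2, h3]) (Or.inl ?_)
      simp
      omega
    · simp [hv, e2, ← hpw, e3, e4, hk, hlt]
      have hsl := slack_update (I := I) (f := s.arr 20) (i := i) (v := pos I i w + 1)
        (by omega) (by omega)
      repeat (refine ⟨by omega, ?_⟩)
      refine hQ _ _ (i + 1) (hs.reject hw hpw.symm (not_lt.1 hlt) (by simp) (by simp) (by simp))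
        (by simp [hv]) (by simp) (by simp) (by simp) (fun a h1 h2 h3 => by simp [h1]) (Or.inl ?_)
      simp
      omega
  · simp [hv, e2, hk]
    repeat (refine ⟨by omega, ?_⟩)
    refine hQ _ _ 0 ((hs.exhausted (not_lt.1 hk)).congr rfl rfl rfl) (by simp) (by simp) (by simp)
      (by simp) (by simp) (Or.inr ⟨rfl, ?_⟩)
    simp
    omega

/-- The sum of the ranks held by the women starts with at most `n + 1` for each of them, which is
the origin of the term `n * (n + 1)`. There are `n` chains, one for each man. -/
theorem galeShapley_spec (hI : I.AllAssigned) (hB : n + I.totalLength + 2 ≤ B) (ht : Tab I s)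
    (hin : Input I s)
    (hr : 100 * (manTotal I + n * (n + 1)) + 300 * n + 300 ≤ r)
    (hQ : ∀ r' s' M₀, r ≤ r' + 100 * (manTotal I + n * (n + 1)) + 300 * n + 300 →
      SMI.ManOpt I M₀ → (∀ i : Fin n, s'.arr 20 i = pos I i (M₀ i)) → s'.var 0 = n →
      s'.var 4 = s.var 4 → (∀ a, a ≠ 20 → a ≠ 23 → a ≠ 27 → s'.arr a = s.arr a) → Q l r' s') :
    WP B galeShapley Q l r s := by
  have hmt := manTotal_le (I := I)
  unfold galeShapley
  rw [WP_seq]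
  refine WP_forLoop (c := 40) (n := n) (fun q s' => (s'.var 4 = s.var 4 ∧
      (∀ a, a ≠ 20 → a ≠ 23 → a ≠ 27 → s'.arr a = s.arr a)) ∧ ∀ i : Fin n, i < q →
      s'.arr 20 i = startOf I.manList i ∧ s'.arr 23 i = (I.womanList i).length + 1 ∧
      s'.arr 27 i = 0) (by decide)
    ht.size (by omega) ?_ (by omega) ?_ ?_
  · simp
  · rintro q s' r' hq ⟨⟨h0, h1⟩, h2⟩ h3 h4 hr'
    let i : Fin n := ⟨q, hq⟩
    have e1 : s'.arr 0 q = startOf I.manList i := by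
      rw [h1 0 (by omega) (by omega) (by omega)]; exact hin.start q hq.le
    have e2 : s'.arr 2 q = startOf I.womanList i := by
      rw [h1 2 (by omega) (by omega) (by omega)]; exact hin.womanStart q hq.le
    have e3 : s'.arr 2 (q + 1) = startOf I.womanList (i + 1) := by
      rw [h1 2 (by omega) (by omega) (by omega)]; exact hin.womanStart (q + 1) hq
    have e4 := startOf_succ I.womanList i
    have b1 := startOf_le_manTotal (I := I) hq.le
    have b2 := womanList_length_le (I := I) i
    have b3 : startOf I.manList i = startOf I.manList q := rfl
    refine WP.abstract fun P hP => ?_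
    simp [h3, e1, e2, e3]
    repeat (refine ⟨by omega, ?_⟩)
    refine hP _ _ _ ⟨rfl, by omega, by simp [h3], by simp [h4], ⟨by simp [h0],
      fun a h5 h6 h7 => by simp [h5, h6, h7, h1]⟩, fun a ha => ?_⟩
    have hq' : q = (i : ℕ) := rfl
    simp only [Store.setVar_arr, Store.setArr_arr]
    simp only [Nat.reduceEqDiff, if_false, if_true]
    rw [hq', update_fin, update_fin, update_fin]
    split_ifs with e
    · subst e
      exact ⟨rfl, by omega, rfl⟩
    · exact h2 a (by have : (a : ℕ) ≠ q := fun e' => e (Fin.ext e'); omega)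
  · rintro r₁ s₁ ⟨⟨h0, h1⟩, h2⟩ - h4 h5
    have hsl : slack I (s₁.arr 20) ≤ manTotal I := slack_le fun i => (h2 i i.2).1.ge
    have hsum : ∑ j : Fin n, s₁.arr 23 j ≤ n * (n + 1) := by
      refine (Finset.sum_le_card_nsmul _ _ (n + 1) fun j _ => ?_).trans (by simp)
      rw [(h2 j j.2).2.1]
      have := womanList_length_le (I := I) j
      omega
    simp
    refine ⟨by omega, ?_⟩
    refine WP_loop (fun l' r' s' => l' = l ∧ ∃ q ≤ n, GsInv I q 0 s' ∧ s'.var 28 = q ∧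
      s'.var 0 = n ∧ s'.var 4 = s.var 4 ∧ (∀ a, a ≠ 20 → a ≠ 23 → a ≠ 27 → s'.arr a = s.arr a) ∧
      100 * (slack I (s'.arr 20) + ∑ j : Fin n, s'.arr 23 j) + 200 * (n - q) + 50 ≤ r' ∧
      r + 100 * (slack I (s'.arr 20) + ∑ j : Fin n, s'.arr 23 j) ≤
        r' + 100 * (manTotal I + n * (n + 1)) + 50 * n + 50 + 200 * q) ?_ ?_
    · refine ⟨rfl, 0, by omega, ⟨le_rfl, ?_, ?_, ?_, by omega⟩, by simp, by simp [h4], by simp [h0],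
        by simpa using h1, ?_, ?_⟩
      · intro i
        simp [(h2 i i.2).1]
        exact startOf_mono _ (by omega)
      · intro i j hj hlt
        simp [(h2 i i.2).1] at hlt
        have : startOf I.manList i ≤ pos I i j := Nat.le_add_right _ _
        omega
      · intro j
        exact Or.inl (by simpa using ⟨(h2 j j.2).2.2, (h2 j j.2).2.1⟩)
      · simp
        omega
      · simp
        omega
    · rintro l' r' s' ⟨rfl, q, hq, g1, g2, g3, g4, g5, g6, g7⟩
      simp only [Expr.eval, Expr.cost, g2, g3]
      refine ⟨by omega, fun h => ?_, fun h => ?_⟩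
      · have hqn : q = n := by
          by_contra hc
          rw [if_pos (by omega)] at h
          exact one_ne_zero h
        subst hqn
        obtain ⟨M₀, hM₀, hp⟩ := g1.manOpt hI
        exact hQ _ _ M₀ (by omega) hM₀ hp g3 g4 g5
      · have hqn : q < n := by
          by_contra hc
          rw [if_neg hc] at h
          exact h rfl
        refine WP.abstract fun P hP => ?_
        simp [g2]
        refine ⟨by omega, by omega, ?_⟩
        refine WP_loop (fun l₂ r₂ s₂ => l₂ = l' ∧ ∃ v, GsInv I (q + 1) v s₂ ∧ s₂.var 23 = v ∧
          s₂.var 28 = q ∧ s₂.var 0 = n ∧ s₂.var 4 = s.var 4 ∧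
          (∀ a, a ≠ 20 → a ≠ 23 → a ≠ 27 → s₂.arr a = s.arr a) ∧
          r' + 100 * (slack I (s₂.arr 20) + ∑ j : Fin n, s₂.arr 23 j) ≤
            r₂ + 100 * (slack I (s'.arr 20) + ∑ j : Fin n, s'.arr 23 j) + 150 ∧
          (v ≠ 0 → r' + 100 * (slack I (s₂.arr 20) + ∑ j : Fin n, s₂.arr 23 j) ≤
            r₂ + 100 * (slack I (s'.arr 20) + ∑ j : Fin n, s'.arr 23 j) + 20)) ?_ ?_
        · refine ⟨rfl, q + 1, g1.next.congr rfl rfl rfl, by simp, by simp [g2], by simp [g3],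
            by simp [g4], by simpa using g5, ?_, fun _ => ?_⟩
          · simp
            omega
          · simp
            omega
        · rintro l₂ r₂ s₂ ⟨rfl, v, k1, k2, k3, k4, k5, k6, k7, k8⟩
          simp only [Expr.eval, Expr.cost, k2]
          refine ⟨?_, fun h => ?_, fun h => ?_⟩
          · by_cases hv : v = 0
            · omega
            · have := k8 hv
              omega
          · subst h
            simp
            refine ⟨by omega, by omega, ?_⟩
            refine hP _ _ _ ⟨rfl, q + 1, hqn, k1.congr rfl rfl rfl, by simp [k3], by simp [k4],
              by simp [k5], by simpa using k6, ?_, ?_⟩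
            · simp
              omega
            · simp
              omega
          · have hvq := k1.cur
            have hk8 := k8 h
            obtain ⟨i, rfl⟩ : ∃ i : Fin n, v = i + 1 := ⟨⟨v - 1, by omega⟩, by simp; omega⟩
            have ht₂ : Tab I s₂ := ⟨k4,
              by rw [k6 0 (by omega) (by omega) (by omega)]; exact ht.start,
              by rw [k6 1 (by omega) (by omega) (by omega)]; exact ht.entry,
              by rw [k6 10 (by omega) (by omega) (by omega)]; exact ht.rank⟩
            refine proposal_spec hB ht₂ k1 k2 (by omega) fun r₃ s₃ v₃ m1 m2 m3 m4 m5 m6 m7 => ?_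
            refine ⟨rfl, v₃, m1, m2, m3.trans k3, m4.trans k4, m5.trans k5,
              fun a h5 h6 h7 => (m6 a h5 h6 h7).trans (k6 a h5 h6 h7), ?_, fun h => ?_⟩
            · rcases m7 with m7 | ⟨-, m7⟩ <;> omega
            · rcases m7 with m7 | ⟨m8, -⟩
              · omega
              · exact absurd m8 h

end Ram

/-! ### The woman-optimal stable matching and the list of all rotations. -/

namespace SMI

variable {n : ℕ} {I : SMI n} {M N Mz M₀ : Equiv.Perm (Fin n)}

/-- `Mz` is the stable matching in which each man has his least preferred stable partner. -/
def ManPess (I : SMI n) (Mz : Equiv.Perm (Fin n)) : Prop := Stab I Mz ∧ ∀ N, Stab I N → I.Dom N Mz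

/-- The meet of `Mz` and `N` lies below `Mz`, hence agrees with it at every man; so nobody is worse
off in `N`. -/
theorem manPess_of_stuck (hMz : Stab I Mz) (h : ∀ i N, Stab I N → I.Dom Mz N → N i = Mz i) :
    ManPess I Mz := by
  refine ⟨hMz, fun N hN i => ?_⟩
  obtain ⟨K, hK, hr⟩ := exists_meet hMz hN
  have := h i K hK fun a => by rw [hr]; exact le_max_left _ _
  have h1 := hr i
  rw [this] at h1
  rw [h1]
  exact le_max_right _ _

theorem ManPess.isWomanOptimal (hI : I.AllAssigned) (h : ManPess I Mz) :
    I.IsWomanOptimal (graph Mz) := by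
  refine ⟨isStable_graph_iff.2 h.1, fun A hA i' j hij => ?_⟩
  obtain ⟨N, rfl, hN⟩ := exists_graph_eq hI hA
  rw [mem_graph] at hij
  replace hij : N i' = j := hij
  refine ⟨Mz.symm j, by simp, ?_⟩
  have := Dom.womanRank_le hN h.1 (h.2 N hN) j
  rwa [show N.symm j = i' by rw [← hij]; simp] at this

/-- Each rotation leads from some stable matching to another one, which dominates `Mz`; so it is
past at `Mz`. -/
theorem ManPess.past_eq (hI : I.AllAssigned) (h : ManPess I Mz) : past I Mz = I.rotations := by
  refine Set.Subset.antisymm (fun σ hσ => hσ.1) fun σ hσ => ?_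
  obtain ⟨N, N', hN, hN', hs⟩ := exists_step_of_mem_rotations hI hσ
  refine past_mono (h.2 N' hN') ?_
  rw [past_step hI hN hσ hs]
  exact Set.mem_insert _ _

theorem dom_of_elimSeq (hI : I.AllAssigned) {L : List (PairSet n)} (hM : Stab I M)
    (h : I.ElimSeq (graph M) L (graph N)) : I.Dom M N := by
  obtain ⟨N', e, -, h1, -⟩ := elimSeq_spec hI hM h
  obtain rfl := graph_injective e
  exact h1

end SMI

namespace Ram

variable {B : ℕ} {Q : List Store → ℕ → Store → Prop} {l : List Store} {r : ℕ} {s t : Store} {n : ℕ}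
  {I : SMI n} {M M' M₀ Mz : Equiv.Perm (Fin n)}

/-! # The list of all rotations -/

theorem slack_lt (hM : SMI.Stab I M) (hM' : SMI.Stab I M') (hd : I.Dom M M') {i : Fin n}
    (hne : M' i ≠ M i) {f g : ℕ → ℕ} (hf : ∀ a : Fin n, f a = pos I a (M a))
    (hg : ∀ a : Fin n, g a = pos I a (M' a)) : slack I g < slack I f := by
  unfold slack
  refine Finset.sum_lt_sum (fun a _ => ?_) ⟨i, Finset.mem_univ i, ?_⟩
  · have := hd a
    have h1 := pos_add_one (I := I) a (M a)
    have h2 := pos_add_one (I := I) a (M' a)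
    rw [hf, hg]
    omega
  · have := hd.lt_of_ne hM hne
    have h1 := pos_add_one (I := I) i (M i)
    have h2 := pos_add_one (I := I) i (M' i)
    have h3 := pos_lt (hM'.mem_man i)
    rw [hf, hg]
    omega

theorem slack_le_manTotal (hs : Rep I s M) : slack I (s.arr 20) ≤ manTotal I :=
  slack_le fun i => by rw [hs.pos]; exact Nat.le_add_right _ _

/-- What is computed before the search: the tables, and the man-optimal stable matching. -/
structure Known (I : SMI n) (M₀ : Equiv.Perm (Fin n)) (s : Store) : Prop where
  tab : Tab I s
  sorted : Sorted I s
  opt : ∀ i : Fin n, s.arr 12 i = pos I i (M₀ i)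

theorem Known.frame (h : Known I M₀ s) (hf : Frame s t) : Known I M₀ t :=
  ⟨h.tab.frame hf, h.sorted.frame hf, by rw [hf.arr 12 (by omega)]; exact h.opt⟩

theorem Known.congr (h : Known I M₀ s) (h0 : t.var 0 = s.var 0) (h4 : t.var 4 = s.var 4)
    (ha : ∀ a, a < 2 ∨ (10 ≤ a ∧ a < 13) → t.arr a = s.arr a) : Known I M₀ t := by
  refine ⟨⟨by rw [h0, h.tab.size], by rw [ha 0 (by omega)]; exact h.tab.start,
    by rw [ha 1 (by omega)]; exact h.tab.entry, by rw [ha 10 (by omega)]; exact h.tab.rank⟩,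
    ⟨by rw [h4]; exact h.sorted.le, by rw [h4, ha 11 (by omega)]; exact h.sorted.lt, ?_, ?_⟩,
    by rw [ha 12 (by omega)]; exact h.opt⟩
  · rw [h4, ha 10 (by omega), ha 11 (by omega)]
    exact h.sorted.mono
  · rw [h4, ha 10 (by omega), ha 11 (by omega)]
    exact h.sorted.surj

/-- The memory represents the stable matching `M`, and is ready for `brk`. -/
structure Work (I : SMI n) (s : Store) (M : Equiv.Perm (Fin n)) : Prop where
  stab : SMI.Stab I M
  rep : Rep I s M
  idle : Idle n s
  record : ∃ L, Rec n s L
  cap : slack I (s.arr 20) + s.var 2 ≤ manTotal I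

theorem Work.setVar (h : Work I s M) {x v : ℕ} (hx : x ≠ 1 ∧ x ≠ 2 ∧ x ≠ 20) :
    Work I (s.setVar x v) M := by
  obtain ⟨L, hL⟩ := h.record
  exact ⟨h.stab, h.rep.congr rfl rfl rfl rfl (by simp [hx.2.2.symm]), h.idle,
    ⟨L, hL.congr (by simp [hx.1.symm]) (by simp [hx.2.1.symm]) rfl rfl rfl⟩,
    by simpa [hx.2.1.symm] using h.cap⟩

theorem Work.congr (h : Work I s M) (ha : ∀ a, a = 4 ∨ (7 ≤ a ∧ a < 10) ∨ (20 ≤ a ∧ a < 25) →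
    t.arr a = s.arr a) (hv : ∀ x, x = 1 ∨ x = 2 ∨ x = 20 → t.var x = s.var x) : Work I t M := by
  obtain ⟨L, hL⟩ := h.record
  refine ⟨h.stab, h.rep.congr (ha _ (by omega)) (ha _ (by omega)) (ha _ (by omega))
    (ha _ (by omega)) (hv _ (by omega)), ?_,
    ⟨L, hL.congr (hv _ (by omega)) (hv _ (by omega)) (ha _ (by omega)) (ha _ (by omega))
      (ha _ (by omega))⟩, by rw [ha 20 (by omega), hv 2 (by omega)]; exact h.cap⟩
  intro i
  rw [ha 21 (by omega), ha 20 (by omega), ha 24 (by omega)]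
  exact h.idle i

/-- Forget the list of rotations. -/
def reset : Com := .assign 1 (.const 0) ;; .assign 2 (.const 0) ;; .write 7 (.const 0) (.const 0)

theorem reset_spec (hM : SMI.Stab I M) (hs : Rep I s M) (hi : Idle n s) (hr : 20 ≤ r)
    (hQ : ∀ r' s', r ≤ r' + 20 → Frame s s' → Work I s' M → Rec n s' [] → s'.arr 20 = s.arr 20 →
      Q l r' s') : WP B reset Q l r s := by
  unfold reset
  simp
  repeat (refine ⟨by omega, ?_⟩)
  generalize hs' : ((s.setVar 1 0).setVar 2 0).setArr 7 0 0 = s'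
  have h1 : s'.var 1 = 0 := by simp [← hs']
  have h2 : s'.var 2 = 0 := by simp [← hs']
  have h7 : s'.arr 7 0 = 0 := by simp [← hs']
  have ha : ∀ a, a ≠ 7 → s'.arr a = s.arr a := fun a ha => by simp [← hs', ha]
  have hR : Rec n s' [] := ⟨by simp [h1], by omega, h7, by simp [h2, h7], by simp [h2, h7], by simp⟩
  refine hQ _ _ (by omega) ?_ ⟨hM, hs.congr (ha _ (by omega)) (ha _ (by omega)) (ha _ (by omega))
    (ha _ (by omega)) (by simp [← hs']), ?_, ⟨[], hR⟩, ?_⟩ hR (ha _ (by omega))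
  · rw [← hs']
    repeat first
      | exact Frame.refl _
      | refine Frame.setVar ?_ (by omega)
      | refine Frame.setArr ?_ (by omega)
  · intro i
    rw [ha 21 (by omega), ha 20 (by omega), ha 24 (by omega)]
    exact hi i
  · rw [h2, ha 20 (by omega)]
    exact slack_le_manTotal hs

/-- Continue with the matching whose positions are in array `a`. -/
def restart (a : ℕ) : Com := load a ;; reset

theorem restart_spec {a : ℕ} (ha : a = 12 ∨ a = 13) (hn : 0 < n)
    (hB : n + I.totalLength + 2 ≤ B) (ht : Tab I s) (hM : SMI.Stab I M)
    (hp : ∀ i : Fin n, s.arr a i = pos I i (M i)) (hr : 70 * n + 40 ≤ r)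
    (hQ : ∀ r' s', r ≤ r' + (70 * n + 40) → Frame s s' → Work I s' M → Rec n s' [] → Q l r' s') :
    WP B (restart a) Q l r s := by
  unfold restart
  rw [WP_seq]
  refine load_spec (by omega) hn hB ht hM.mem_man hM.mem_woman hp (by omega)
    fun r₁ s₁ h1 h2 h3 h4 => ?_
  exact reset_spec hM h3 h4 (by omega) fun r₂ s₂ h5 h6 h7 h8 h9 =>
    hQ _ _ (by omega) (h2.frame.trans h6) h7 h8

/-- Eliminate rotations as long as there are any, recording them. -/
def allRotations : Com :=
  forLoop 5 (.assign 3 (.var 5) ;; .assign 21 (.const 0) ;; .loop (.eq (.var 21) (.const 0)) brk)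

/-- The rotations recorded so far lead from `M₀` to `M`, and no stable matching below `M` differs
from it at the first `q` men. -/
structure AllInv (I : SMI n) (M₀ : Equiv.Perm (Fin n)) (q : ℕ) (s : Store)
    (M : Equiv.Perm (Fin n)) (L : List (PairSet n)) : Prop where
  stab : SMI.Stab I M
  rep : Rep I s M
  idle : Idle n s
  record : Rec n s L
  cap : slack I (s.arr 20) + s.var 2 ≤ manTotal I
  known : Known I M₀ s
  seq : I.ElimSeq (SMI.graph M₀) L (SMI.graph M)
  stuck : ∀ i : Fin n, i < q → ∀ N, SMI.Stab I N → I.Dom M N → N i = M i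

theorem AllInv.congr {q : ℕ} {L : List (PairSet n)} (h : AllInv I M₀ q s M L)
    (ha : t.arr = s.arr) (hv : ∀ x, x ≤ 2 ∨ x = 4 ∨ x = 20 → t.var x = s.var x) :
    AllInv I M₀ q t M L :=
  ⟨h.stab, h.rep.congr (by rw [ha]) (by rw [ha]) (by rw [ha]) (by rw [ha]) (hv _ (by omega)),
    by unfold Idle; rw [ha]; exact h.idle,
    h.record.congr (hv _ (by omega)) (hv _ (by omega)) (by rw [ha]) (by rw [ha]) (by rw [ha]),
    by rw [ha, hv 2 (by omega)]; exact h.cap,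
    h.known.congr (hv _ (by omega)) (hv _ (by omega)) (fun a _ => by rw [ha]), h.seq, h.stuck⟩

/-- For each man, every successful search moves him and thus releases slack: 1400 for each unit pay
for the search (900) and its constant overhead. One last search fails, at cost at most `900 manTotal
+ 700 n`; hence the coefficient 2300. -/
theorem allRotations_spec (hI : I.AllAssigned) (hn : 0 < n) (hB : n + I.totalLength + 2 ≤ B)
    (hM₀ : SMI.Stab I M₀) (hk : Known I M₀ s) (hw : Work I s M₀) (hrec : Rec n s [])
    (hr : (2300 * manTotal I + 700 * n + 1100) * n + 20 ≤ r)
    (hQ : ∀ r' s' M L, r ≤ r' + ((2300 * manTotal I + 700 * n + 1100) * n + 20) →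
      AllInv I M₀ n s' M L → Q l r' s') :
    WP B allRotations Q l r s := by
  have hmt := manTotal_le (I := I)
  have key : (2300 * manTotal I + 700 * n + 1092 + 8) * n =
    (2300 * manTotal I + 700 * n + 1100) * n := by ring
  unfold allRotations
  refine WP_forLoop (c := 2300 * manTotal I + 700 * n + 1092) (n := n)
    (fun q s' => ∃ M L, AllInv I M₀ q s' M L) (by decide) hk.tab.size (by omega) ?_ (by omega) ?_ ?_
  · exact ⟨M₀, [], (AllInv.mk (q := 0) hM₀ hw.rep hw.idle hrec hw.cap hk (.nil _)
      (by intro i hi; omega)).congr rfl fun x hx => by simp [show x ≠ 5 by omega]⟩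
  · rintro q s' r' hq ⟨M, L, hinv⟩ h5 h0 hr'
    refine WP.abstract fun P hP => ?_
    simp [h5]
    repeat (refine ⟨by omega, ?_⟩)
    refine WP_loop (fun l₁ r₁ s₁ => l₁ = l ∧ s₁.var 5 = q ∧ s₁.var 3 = q ∧
      ∃ M L, ∃ v ≤ 1, s₁.var 21 = v ∧ AllInv I M₀ (q + v) s₁ M L ∧
        (v = 0 → r' + 1400 * slack I (s₁.arr 20) ≤ r₁ + 1400 * manTotal I + 20) ∧
        (v = 1 → r' ≤ r₁ + 2300 * manTotal I + 700 * n + 1000)) ?_ ?_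
    · refine ⟨rfl, by simp [h5], by simp, M, L, 0, by omega, by simp,
        hinv.congr rfl fun x hx => by simp [show x ≠ 21 ∧ x ≠ 3 by omega], fun _ => ?_, by omega⟩
      have := slack_le_manTotal hinv.rep
      simp
      omega
    · rintro l₁ r₁ s₁ ⟨rfl, g1, g2, M₁, L₁, v, hv, g3, g4, g5, g6⟩
      have hsl := slack_le_manTotal g4.rep
      have hcase : v = 0 ∨ v = 1 := by omega
      rcases hcase with rfl | rfl
      · have g5 := g5 rfl
        simp only [Expr.eval, Expr.cost, g3]
        refine ⟨by omega, fun h => absurd h (by simp), fun _ => ?_⟩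
        let i : Fin n := ⟨q, hq⟩
        refine brk_spec (i := i) hB g4.known.tab g4.stab g4.rep g4.idle g4.record g4.cap
          g2 (by omega) ?_ ?_
        · intro r₂ s₂ M₂ L₂ hd hc
          have hdom := SMI.dom_of_elimSeq hI g4.stab hd.seq
          have hlt := slack_lt g4.stab hd.stab hdom hd.moved g4.rep.pos hd.rep.pos
          refine ⟨rfl, (hd.frame.var 5 (by omega)).trans g1, (hd.frame.var 3 (by omega)).trans g2,
            M₂, L₁ ++ L₂, 0, by omega, hd.fail, ⟨hd.stab, hd.rep, hd.idle, hd.record, hd.cap,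
              g4.known.frame hd.frame, g4.seq.append hd.seq, fun a ha N hN hN' => ?_⟩,
            fun _ => by omega, by omega⟩
          -- A stable matching below the new one is also below the old one, where the man `a` was
          -- already stuck.
          rw [g4.stuck a ha N hN (hdom.trans hN'), g4.stuck a ha M₂ hd.stab hdom]
        · intro r₂ s₂ M₂ L₂ hd hid hc
          have hdom := SMI.dom_of_elimSeq hI g4.stab hd.seq
          refine ⟨rfl, (hd.frame.var 5 (by omega)).trans g1, (hd.frame.var 3 (by omega)).trans g2,
            M₂, L₁ ++ L₂, 1, by omega, hd.fail, ⟨hd.stab, hd.rep, hid, hd.record, hd.cap,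
              g4.known.frame hd.frame, g4.seq.append hd.seq, fun a ha N hN hN' => ?_⟩,
            by omega, fun _ => by omega⟩
          by_cases e : (a : ℕ) = q
          · obtain rfl : a = i := Fin.ext e
            exact hd.stuck N hN hN'
          · rw [g4.stuck a (by omega) N hN (hdom.trans hN'),
              g4.stuck a (by omega) M₂ hd.stab hdom]
      · replace g6 := g6 rfl
        simp only [Expr.eval, Expr.cost, g3]
        refine ⟨by omega, fun h => ?_, fun h => absurd h (by simp)⟩
        clear h
        refine hP _ _ _ ⟨rfl, ?_, g1, g4.known.tab.size, M₁, L₁,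
          g4.congr rfl fun x hx => by simp [show x ≠ 5 by omega]⟩
        exact g6.trans (by clear * -; omega)
  · rintro r' s' ⟨M, L, hinv⟩ - - h3
    exact hQ _ _ M L (by omega) hinv

theorem AllInv.manPess {L : List (PairSet n)} (h : AllInv I M₀ n s M L) : SMI.ManPess I M :=
  SMI.manPess_of_stuck h.stab fun i => h.stuck i i.2

/-- The recorded sequence leads from `M₀`, where no rotation is past, to the bottom of the lattice,
where all are. By `elimSeq_spec` it contains every rotation exactly once. -/
theorem AllInv.mem_iff (hI : I.AllAssigned) (hM₀ : SMI.ManOpt I M₀) {L : List (PairSet n)}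
    (h : AllInv I M₀ n s M L) : L.Nodup ∧ ∀ σ, σ ∈ L ↔ σ ∈ I.rotations := by
  obtain ⟨N, e, -, -, h1, h2, -⟩ := SMI.elimSeq_spec hI hM₀.1 h.seq
  obtain rfl := SMI.graph_injective e
  refine ⟨h1, fun σ => ?_⟩
  rw [h2, hM₀.past_eq hI, h.manPess.past_eq hI, Set.sdiff_empty]

theorem holdsRotations_of_rec {L : List (PairSet n)} (h : Rec n s L) (hd : L.Nodup)
    (hL : ∀ σ, σ ∈ L ↔ σ ∈ I.rotations) : HoldsRotations I s := by
  rw [HoldsRotations, h.count]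
  refine ⟨fun ρ => ?_, fun k k' hk hk' e => ?_⟩
  · rw [← hL, List.mem_iff_getElem]
    refine exists_congr fun k => ?_
    constructor
    · rintro ⟨hk, rfl⟩
      exact ⟨hk, h.block k hk⟩
    · rintro ⟨hk, e⟩
      rw [h.block k hk] at e
      exact ⟨hk, Finset.coe_injective e⟩
  · rw [h.block k hk, h.block k' hk'] at e
    exact (hd.getElem_inj_iff).1 (Finset.coe_injective e)

/-- From the positions of the man-optimal stable matching: the setup, up to and including its
recording. -/
def setup : Com :=
  copy 20 12 ;; restart 12 ;; allRotations ;; copy 4 6 ;; load 12 ;; copy 4 5 ;; .observe ;; reset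

theorem setup_spec (hI : I.AllAssigned) (hn : 0 < n) (hB : n + I.totalLength + 2 ≤ B)
    (hM₀ : SMI.ManOpt I M₀) (ht : Tab I s) (hs : Sorted I s)
    (hp : ∀ i : Fin n, s.arr 20 i = pos I i (M₀ i))
    (hr : (2300 * manTotal I + 700 * n + 1400) * n + 200 ≤ r)
    (hQ : ∀ r' s' s₁ Mz, r ≤ r' + ((2300 * manTotal I + 700 * n + 1400) * n + 200) →
      SMI.ManPess I Mz → Displays I (.setup (SMI.graph M₀) (SMI.graph Mz)) s₁ →
      Known I M₀ s' → Work I s' M₀ → (∀ i : Fin n, s'.arr 5 i = M₀ i) →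
      (∀ i : Fin n, s'.arr 6 i = Mz i) → Q (l ++ [s₁]) r' s') :
    WP B setup Q l r s := by
  have hmt := manTotal_le (I := I)
  have key : (2300 * manTotal I + 700 * n + 1400) * n =
    (2300 * manTotal I + 700 * n + 1100) * n + 300 * n := by ring
  unfold setup
  rw [WP_seq]
  refine copy_spec (n := n) (by decide) ht.size (by omega) (fun i hi => ?_) (by omega)
    fun r₁ s₁ c1 c2 c3 c4 => ?_
  · have := pos_lt_manTotal (hM₀.1.mem_man ⟨i, hi⟩)
    have := hp ⟨i, hi⟩
    simp only at this
    omega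
  have hk₁ : Known I M₀ s₁ := by
    refine ⟨⟨(c3 0 (by omega)).trans ht.size, ?_, ?_, ?_⟩, ⟨?_, ?_, ?_, ?_⟩, fun i => ?_⟩
    · rw [c2 0 (by omega)]; exact ht.start
    · rw [c2 1 (by omega)]; exact ht.entry
    · rw [c2 10 (by omega)]; exact ht.rank
    · rw [c3 4 (by omega)]; exact hs.le
    · rw [c3 4 (by omega), c2 11 (by omega)]; exact hs.lt
    · rw [c3 4 (by omega), c2 11 (by omega), c2 10 (by omega)]; exact hs.mono
    · rw [c3 4 (by omega), c2 11 (by omega), c2 10 (by omega)]; exact hs.surj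
    · rw [c4 i i.2, hp]
  rw [WP_seq]
  refine restart_spec (a := 12) (by omega) hn hB hk₁.tab hM₀.1 hk₁.opt (r := r₁) (by omega)
    fun r₂ s₂ d1 d2 d3 d4 => ?_
  rw [WP_seq]
  refine allRotations_spec hI hn hB hM₀.1 (hk₁.frame d2) d3 d4 (by omega)
    fun r₃ s₃ Mz L e1 e2 => ?_
  have hk₃ := e2.known
  rw [WP_seq]
  refine copy_spec (n := n) (by decide) hk₃.tab.size (by omega) (fun i hi => ?_) (by omega)
    fun r₄ s₄ f1 f2 f3 f4 => ?_
  · have h1 := e2.rep.part ⟨i, hi⟩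
    have := (Mz ⟨i, hi⟩).2
    simp only at h1
    omega
  have hk₄ : Known I M₀ s₄ := hk₃.congr (f3 _ (by omega)) (f3 _ (by omega)) fun a ha =>
    f2 a (by omega)
  rw [WP_seq]
  -- The recorded memory has to show `M₀` together with the complete list of rotations. `load` does
  -- not touch the list; it is forgotten only after the recording, so that slack plus number of
  -- recorded pairs is again within its bound.
  refine load_spec (a := 12) (by omega) hn hB hk₄.tab hM₀.1.mem_man hM₀.1.mem_woman hk₄.opt (by omega)
    fun r₅ s₅ g1 g2 g3 g4 => ?_
  have hk₅ := hk₄.frame g2.frame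
  rw [WP_seq]
  refine copy_spec (n := n) (by decide) hk₅.tab.size (by omega) (fun i hi => ?_) (by omega)
    fun r₆ s₆ i1 i2 i3 i4 => ?_
  · have h1 := g3.part ⟨i, hi⟩
    have := (M₀ ⟨i, hi⟩).2
    simp only at h1
    omega
  have hk₆ : Known I M₀ s₆ := hk₅.congr (i3 _ (by omega)) (i3 _ (by omega)) fun a ha =>
    i2 a (by omega)
  have hrep₆ : Rep I s₆ M₀ := g3.congr (i2 _ (by omega)) (i2 _ (by omega)) (i2 _ (by omega))
    (i2 _ (by omega)) (i3 _ (by omega))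
  have hMz : ∀ i : Fin n, s₆.arr 6 i = Mz i := fun i => by
    rw [i2 6 (by omega), g2.frame.arr 6 (by omega), f4 i i.2, e2.rep.part]
  have hM5 : ∀ i : Fin n, s₆.arr 5 i = M₀ i := fun i => by rw [i4 i i.2, g3.part]
  rw [WP_seq, WP_observe]
  refine ⟨by omega, ?_⟩
  have hmem := e2.mem_iff hI hM₀
  refine reset_spec hM₀.1 hrep₆ ?_ (by omega) fun r₇ s₇ j1 j2 j3 j4 j5 => ?_
  · intro i
    rw [i2 21 (by omega), i2 20 (by omega), i2 24 (by omega)]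
    exact g4 i
  refine hQ _ _ _ Mz (by omega) e2.manPess ⟨hrep₆.holds, fun i j => ?_, ?_⟩ (hk₆.frame j2) j3
    (fun i => by rw [j2.arr 5 (by omega), hM5]) (fun i => by rw [j2.arr 6 (by omega), hMz])
  · rw [hMz, SMI.mem_graph, Fin.val_inj]
  · refine holdsRotations_of_rec (e2.record.congr ?_ ?_ ?_ ?_ ?_) hmem.1 hmem.2
    · rw [i3 1 (by omega), g2.var 1 (by omega) (by omega), f3 1 (by omega)]
    · rw [i3 2 (by omega), g2.var 2 (by omega) (by omega), f3 2 (by omega)]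
    · rw [i2 7 (by omega), g2.arr 7 (by omega) (by omega), f2 7 (by omega)]
    · rw [i2 8 (by omega), g2.arr 8 (by omega) (by omega), f2 8 (by omega)]
    · rw [i2 9 (by omega), g2.arr 9 (by omega) (by omega), f2 9 (by omega)]

end Ram

/-! ### Column operations and the woman-degree. -/

namespace SMI

variable {n : ℕ} {I : SMI n} {M M' N Mz M₀ : Equiv.Perm (Fin n)}

theorem rotClosure_mono {S T : Set (PairSet n)} (h : S ⊆ T) : I.rotClosure S ⊆ I.rotClosure T :=
  fun _ ⟨h1, τ, h2, h3⟩ => ⟨h1, τ, h h2, h3⟩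

theorem ManPess.ne_of_mem (hI : I.AllAssigned) (hz : ManPess I Mz) {σ : PairSet n} {i j : Fin n}
    (hσ : σ ∈ I.rotations) (h : (i, j) ∈ σ) : Mz i ≠ j := by
  obtain ⟨N, N', hN, hN', hs⟩ := exists_step_of_mem_rotations hI hσ
  have h1 := hs.lt h
  have h2 := hz.2 N' hN' i
  intro e
  rw [e] at h2
  exact absurd h2 (not_le.2 h1)

/-- The rotations eliminated when all women of rank `b` have moved, as far as they can. -/
theorem rotClosure_rotationsAt_diff (hI : I.AllAssigned) (h₀ : ManOpt I M₀) (hz : ManPess I Mz)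
    (hM : Stab I M) (hM' : Stab I M') (hd : I.Dom M M') {b : ℕ}
    (hsub : past I M' ⊆ past I M ∪ I.rotClosure (I.rotationsAt (graph M) b))
    (hall : ∀ i, I.womanRank (M i) i = b → M' i ≠ M i ∨ Mz i = M i) :
    I.rotClosure (I.rotationsAt (graph M) b) \ past I M = past I M' \ past I M := by
  -- A pair that survives in `Mz` lies in no rotation. Every other pair of rank `b` has been broken,
  -- so the rotation containing it is past at `M'`, and with it its predecessors.
  have hsup : I.rotClosure (I.rotationsAt (graph M) b) ⊆ past I M' := by
    refine rotClosure_subset_past hI h₀ hM' ?_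
    rintro σ ⟨hσ, i, j, hij, hm, hb⟩
    rw [mem_graph] at hm
    replace hm : M i = j := hm
    subst hm
    rcases hall i hb with h | h
    · exact ⟨hσ, _, hij, hd.lt_of_ne hM h⟩
    · exact absurd h (hz.ne_of_mem hI hσ hij)
  ext σ
  constructor
  · exact fun h => ⟨hsup h.1, h.2⟩
  · exact fun h => ⟨(hsub h.1).resolve_left h.2, h.2⟩

theorem past_union_diff (hd : I.Dom M M') : past I M ∪ (past I M' \ past I M) = past I M' :=
  Set.union_sdiff_cancel (past_mono hd)

theorem regretScore_eq (M : PairSet n) : I.regretScore M =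
    (I.manDegree M - I.womanDegree M) + (I.womanDegree M - I.manDegree M) := by
  unfold regretScore
  omega

theorem exists_best (I : SMI n) (M N : Equiv.Perm (Fin n)) :
    ∃ K, graph K = I.best (graph M) (graph N) ∧
      ((I.regretScore (graph M) < I.regretScore (graph N) ∧ K = M) ∨
        (¬ I.regretScore (graph M) < I.regretScore (graph N) ∧ K = N)) := by
  unfold best
  split_ifs with h
  · exact ⟨M, rfl, Or.inl ⟨h, rfl⟩⟩
  · exact ⟨N, rfl, Or.inr ⟨h, rfl⟩⟩

end SMI

namespace Ram

variable {B : ℕ} {Q : List Store → ℕ → Store → Prop} {l : List Store} {r : ℕ} {s t : Store} {n : ℕ}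
  {I : SMI n} {M M' M₀ Mz Mopt : Equiv.Perm (Fin n)}

/-! # The woman-degree -/

/-- Move the pointer (register 5) into the list of positions, sorted by rank, down to a pair of the
present matching. -/
def findDegree : Com :=
  .loop (.lt (.read 23 (.read 1 (.read 11 (.var 5)))) (.read 10 (.read 11 (.var 5))))
    (.assign 5 (.sub (.var 5) (.const 1)))

/-- No pair of `M` is above the pointer. -/
structure Ptr (I : SMI n) (s : Store) (M : Equiv.Perm (Fin n)) : Prop where
  lt : s.var 5 < s.var 4
  above : ∀ y, s.var 5 < y → y < s.var 4 → ∀ i j, j ∈ I.manList i → s.arr 11 y = pos I i j →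
    I.womanRank j (M.symm j) < I.womanRank j i

theorem Ptr.congr (h : Ptr I s M) (h5 : t.var 5 = s.var 5) (h4 : t.var 4 = s.var 4)
    (h11 : t.arr 11 = s.arr 11) : Ptr I t M :=
  ⟨by rw [h5, h4]; exact h.lt, by rw [h5, h4, h11]; exact h.above⟩

theorem Ptr.mono (h : Ptr I s M) (hM : SMI.Stab I M) (hM' : SMI.Stab I M') (hd : I.Dom M M') :
    Ptr I s M' :=
  ⟨h.lt, fun y h1 h2 i j h3 h4 => (hd.womanRank_le hM hM' j).trans_lt (h.above y h1 h2 i j h3 h4)⟩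

theorem Known.exists_entry (hk : Known I M₀ s) {y : ℕ} (hy : y < s.var 4) :
    ∃ i j, j ∈ I.manList i ∧ s.arr 11 y = pos I i j ∧ s.arr 1 (s.arr 11 y) = j ∧
      s.arr 10 (s.arr 11 y) = I.womanRank j i := by
  obtain ⟨i, j, hj, e⟩ := exists_pos_of_lt (hk.sorted.lt y hy)
  refine ⟨i, j, hj, e.symm, ?_, ?_⟩
  · rw [← e, hk.tab.entry i j hj]
  · rw [← e, hk.tab.rank i j hj]

theorem Known.exists_index (hk : Known I M₀ s) (hM : SMI.Stab I M) (i : Fin n) :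
    ∃ y < s.var 4, s.arr 11 y = pos I i (M i) ∧ s.arr 10 (s.arr 11 y) = I.womanRank (M i) i := by
  have h1 := hk.tab.rank i (M i) (hM.mem_man i)
  obtain ⟨y, hy, e⟩ := hk.sorted.surj _ (pos_lt_manTotal (hM.mem_man i)) (by rw [h1]; exact Nat.le_add_left _ _)
    (by rw [h1]; exact (SMI.womanRank_le_iff.2 (hM.mem_woman i)).trans (womanList_length_le _))
  exact ⟨y, hy, e, by rw [e, h1]⟩

theorem Rep.crk_eq (h : Rep I s M) (j : Fin n) : s.arr 23 j = I.womanRank j (M.symm j) := by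
  simpa using h.crk (M.symm j)

theorem Rep.husb_eq (h : Rep I s M) (j : Fin n) : s.arr 22 j = M.symm j := by
  simpa using h.husb (M.symm j)

theorem Store.setVar_setVar (s : Store) (x v w : ℕ) : (s.setVar x v).setVar x w = s.setVar x w := by
  simp [Store.setVar]

theorem Store.setVar_self (s : Store) (x : ℕ) : s.setVar x (s.var x) = s := by
  simp [Store.setVar]

/-- The pointer leaves a position whose woman has a better husband than the man there, so it cannot
pass a pair of maximal rank. Where it stops, the rank of the position is at most the present rank of
its woman, hence at most the degree; by sortedness it is also at least the degree. As women only
gain (`Ptr.mono`), the pointer never has to rise again, and its height is a second potential. -/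
theorem findDegree_spec (hn : 0 < n) (hB : n + I.totalLength + 2 ≤ B) (hk : Known I M₀ s)
    (hM : SMI.Stab I M) (hs : Rep I s M) (hp : Ptr I s M) (hr : 20 * s.var 5 + 20 ≤ r)
    (hQ : ∀ r' x, r + 20 * x ≤ r' + 20 * s.var 5 + 20 → x ≤ s.var 5 → Ptr I (s.setVar 5 x) M →
      s.arr 10 (s.arr 11 x) = I.womanDegree (SMI.graph M) → Q l r' (s.setVar 5 x)) :
    WP B findDegree Q l r s := by
  have hmt := manTotal_le (I := I)
  have hcnt := hk.sorted.le
  obtain ⟨i₀, hi₀⟩ := SMI.exists_womanRank_eq hn I M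
  obtain ⟨y₀, hy₀, h1, h2⟩ := hk.exists_index hM i₀
  unfold findDegree
  refine WP_loop (fun l' r' s' => l' = l ∧ ∃ x, s' = s.setVar 5 x ∧ y₀ ≤ x ∧ x ≤ s.var 5 ∧
    Ptr I (s.setVar 5 x) M ∧ r + 20 * x ≤ r' + 20 * s.var 5 ∧ 20 * x + 20 ≤ r') ?_ ?_
  · refine ⟨rfl, s.var 5, (s.setVar_self 5).symm, ?_, le_rfl, by rwa [s.setVar_self 5], le_rfl, hr⟩
    by_contra! hc
    have := hp.above y₀ hc hy₀ i₀ (M i₀) (hM.mem_man i₀) h1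
    simp at this
  · rintro l' r' s' ⟨rfl, x, rfl, g1, g2, g3, g4, g5⟩
    have hx : x < s.var 4 := by simpa using g3.lt
    obtain ⟨i, j, hj, e1, e2, e3⟩ := hk.exists_entry hx
    have e4 := hs.crk_eq j
    simp only [Expr.eval, Expr.cost, Store.setVar_var, Store.setVar_arr, if_true, e2, e3, e4]
    refine ⟨by omega, fun h => ?_, fun h => ?_⟩
    · have hle : I.womanRank j i ≤ I.womanRank j (M.symm j) := by
        by_contra hc
        rw [if_pos (by omega)] at h
        exact one_ne_zero h
      refine hQ _ _ (by omega) g2 g3 ?_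
      have h3 := hk.sorted.mono y₀ x g1 hx
      have h4 := SMI.womanRank_le_womanDegree (I := I) (M := M) (M.symm j)
      simp at h4
      omega
    · have hlt : I.womanRank j (M.symm j) < I.womanRank j i := by
        by_contra hc
        rw [if_neg hc] at h
        exact h rfl
      have hne : y₀ ≠ x := by
        rintro rfl
        rw [e1] at h1
        have h3 := hk.tab.entry i j hj
        have h4 := hk.tab.entry i₀ (M i₀) (hM.mem_man i₀)
        rw [h1, h4, Fin.val_inj] at h3
        subst h3
        rw [Equiv.symm_apply_apply] at hlt
        exact absurd (h2.symm.trans e3) hlt.ne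
      simp [Store.setVar_setVar]
      refine ⟨by omega, by omega, x - 1, rfl, by omega, by omega, ?_, by omega, by omega⟩
      refine ⟨by simp; omega, fun y h3 h4 a b h5 h6 => ?_⟩
      simp at h3 h4 h6
      by_cases hy : y = x
      · subst hy
        have h7 := hk.tab.entry i j hj
        have h8 := hk.tab.entry a b h5
        rw [← h6, e1, h7, Fin.val_inj] at h8
        subst h8
        have h9 := hk.tab.rank a j h5
        rw [← h6, e3] at h9
        omega
      · exact g3.above y (by simp; omega) (by simpa using h4) a b h5 (by simpa using h6)

/-! # Updating the best matching -/

/-- The values of all variables between the elimination steps. -/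
structure State (I : SMI n) (M₀ Mz : Equiv.Perm (Fin n)) (s : Store) (M Mopt : Equiv.Perm (Fin n)) :
    Prop where
  known : Known I M₀ s
  work : Work I s M
  ptr : Ptr I s M
  deg : s.arr 10 (s.arr 11 (s.var 5)) = I.womanDegree (SMI.graph M)
  opt : ∀ i : Fin n, s.arr 5 i = Mopt i
  score : s.var 6 = I.regretScore (SMI.graph Mopt)
  last : ∀ i : Fin n, s.arr 6 i = Mz i

theorem State.congr (h : State I M₀ Mz s M Mopt)
    (hv : ∀ x, x ≤ 2 ∨ (4 ≤ x ∧ x < 7) ∨ x = 20 → t.var x = s.var x)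
    (ha : ∀ a, a < 13 ∨ (20 ≤ a ∧ a < 25) → t.arr a = s.arr a) : State I M₀ Mz t M Mopt :=
  ⟨h.known.congr (hv _ (by omega)) (hv _ (by omega)) fun a _ => ha a (by omega),
    h.work.congr (fun a _ => ha a (by omega)) fun x _ => hv x (by omega),
    h.ptr.congr (hv _ (by omega)) (hv _ (by omega)) (ha _ (by omega)),
    by rw [ha 10 (by omega), ha 11 (by omega), hv 5 (by omega)]; exact h.deg,
    by rw [ha 5 (by omega)]; exact h.opt, by rw [hv 6 (by omega)]; exact h.score,
    by rw [ha 6 (by omega)]; exact h.last⟩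

theorem State.displays (h : State I M₀ Mz s M Mopt) :
    Displays I (.vars (SMI.graph M) (SMI.graph Mopt)) s :=
  ⟨h.work.rep.holds, fun i j => by rw [h.opt, SMI.mem_graph, Fin.val_inj]⟩

theorem womanDegree_le (hM : SMI.Stab I M) : I.womanDegree (SMI.graph M) ≤ n := by
  refine Finset.sup_le ?_
  rintro ⟨i, j⟩ hp
  simp at hp
  subst hp
  exact (SMI.womanRank_le_iff.2 (hM.mem_woman i)).trans (womanList_length_le _)

theorem manDegree_le (hM : SMI.Stab I M) : I.manDegree (SMI.graph M) ≤ n := by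
  refine Finset.sup_le ?_
  rintro ⟨i, j⟩ hp
  simp at hp
  subst hp
  exact (SMI.manRank_le_iff.2 (hM.mem_man i)).trans (manList_length_le _)

/-- Store the woman-degree in register 8, update the best matching, and record the variables. -/
def updateBest : Com :=
  .assign 8 (.read 10 (.read 11 (.var 5))) ;;
  .assign 12 (.add (.sub (.var 20) (.var 8)) (.sub (.var 8) (.var 20))) ;;
  .ite (.lt (.var 12) (.var 6)) (copy 4 5 ;; .assign 6 (.var 12)) .skip ;;
  .observe

/-- A copy of a matching costs linear time but is made only when the integer score drops. A credit
of `30 n` for each unit of the score thus pays for all copies of the entire run. -/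
theorem updateBest_spec (hB : n + I.totalLength + 2 ≤ B)
    (hs : State I M₀ Mz s M Mopt) (hr : 30 * (n * s.var 6) + 40 ≤ r)
    (hQ : ∀ r' s' K, r + 30 * (n * s'.var 6) ≤ r' + 30 * (n * s.var 6) + 40 →
      SMI.graph K = I.best (SMI.graph M) (SMI.graph Mopt) → State I M₀ Mz s' M K →
      s'.var 8 = I.womanDegree (SMI.graph M) → (∀ a, a ≠ 5 → s'.arr a = s.arr a) →
      (∀ x, x ≠ 6 → x ≠ 8 → x ≠ 12 → x ≠ 28 → s'.var x = s.var x) → Q (l ++ [s']) r' s') :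
    WP B updateBest Q l r s := by
  have hd := hs.work.rep.deg
  have hscore := SMI.regretScore_eq (I := I) (SMI.graph M)
  have b1 := womanDegree_le hs.work.stab
  have b2 := manDegree_le hs.work.stab
  obtain ⟨K, hK, hcase⟩ := SMI.exists_best I M Mopt
  unfold updateBest
  simp [hs.deg, hd, ← hscore]
  repeat (refine ⟨by omega, ?_⟩)
  generalize hs' : (s.setVar 8 (I.womanDegree (SMI.graph M))).setVar 12
    (I.regretScore (SMI.graph M)) = s'
  have hst : State I M₀ Mz s' M Mopt := hs.congr
    (fun x hx => by simp [← hs', show x ≠ 8 ∧ x ≠ 12 by omega]) (fun a _ => by simp [← hs'])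
  have v8 : s'.var 8 = I.womanDegree (SMI.graph M) := by simp [← hs']
  have v12 : s'.var 12 = I.regretScore (SMI.graph M) := by simp [← hs']
  have va : s'.arr = s.arr := by simp [← hs']
  have vv : ∀ x, x ≠ 8 → x ≠ 12 → s'.var x = s.var x := fun x h1 h2 => by simp [← hs', h1, h2]
  rw [hs.score] at hr hQ ⊢
  refine ⟨fun h => ?_, fun h => ?_⟩
  · obtain ⟨-, rfl⟩ : _ ∧ K = M := hcase.resolve_right fun h' => h'.1 h
    have hmul := Nat.mul_le_mul_left n (Nat.succ_le_of_lt h)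
    rw [Nat.mul_succ] at hmul
    refine copy_spec (n := n) (by decide) hst.known.tab.size (by omega) (fun i hi => ?_) (by omega)
      fun r₁ s₁ c1 c2 c3 c4 => ?_
    · have h1 := hst.work.rep.part ⟨i, hi⟩
      have := (K ⟨i, hi⟩).2
      simp only at h1
      omega
    have e12 : s₁.var 12 = I.regretScore (SMI.graph K) := (c3 _ (by omega)).trans v12
    simp [e12]
    repeat (refine ⟨by omega, ?_⟩)
    refine hQ _ _ K (by simp; omega) hK ⟨?_, ?_, ?_, ?_, fun i => ?_, by simp, ?_⟩ ?_ ?_ ?_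
    · exact hst.known.congr (by simp [c3]) (by simp [c3]) fun a ha => c2 a (by omega)
    · exact hst.work.congr (fun a ha => c2 a (by omega)) fun x hx => by
        simp [show x ≠ 6 by omega, c3 x (by omega)]
    · exact hst.ptr.congr (by simp [c3]) (by simp [c3]) (c2 _ (by omega))
    · simp [c3, c2, hst.deg]
    · simp [c4, hst.work.rep.part]
    · simp [c2, hst.last]
    · simp [c3, v8]
    · intro a ha
      simp [c2 a ha, va]
    · intro x h1 h2 h3 h4
      simp [h1, c3 x h4, vv x h2 h3]
  · obtain ⟨-, rfl⟩ : _ ∧ K = Mopt := hcase.resolve_left fun h' => absurd h'.1 (not_lt.2 h)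
    repeat (refine ⟨by omega, ?_⟩)
    refine hQ _ _ K ?_ hK hst v8 (fun a _ => by rw [va]) fun x _ h2 h3 _ => vv x h2 h3
    rw [vv 6 (by omega) (by omega), hs.score]
    omega

end Ram

namespace Ram

variable {B : ℕ} {Q : List Store → ℕ → Store → Prop} {l : List Store} {r : ℕ} {s t : Store} {n : ℕ}
  {I : SMI n} {M M' M₀ Mz Mopt : Equiv.Perm (Fin n)}

/-! # Column operations -/

/-- The working memory of `advance` is the only part of the memory that changes. -/
structure Keep (s s' : Store) : Prop where
  arr : ∀ a, (a < 4 ∨ a = 5 ∨ a = 6 ∨ (10 ≤ a ∧ a < 20)) → s'.arr a = s.arr a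
  var : ∀ x, (x = 0 ∨ (4 ≤ x ∧ x < 20 ∧ x ≠ 9)) → s'.var x = s.var x

theorem Keep.refl (s : Store) : Keep s s := ⟨fun _ _ => rfl, fun _ _ => rfl⟩

theorem Keep.frame {s' s'' : Store} (h : Keep s s') (h' : Frame s' s'') : Keep s s'' :=
  ⟨fun a ha => (h'.arr a ha).trans (h.arr a ha),
    fun x hx => (h'.var x (by omega)).trans (h.var x hx)⟩

theorem Keep.setVar {s' : Store} (h : Keep s s') {x v : ℕ}
    (hx : (1 ≤ x ∧ x < 4) ∨ x = 9 ∨ 20 ≤ x) : Keep s (s'.setVar x v) :=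
  ⟨h.arr, fun y hy => by rw [Store.setVar_var, if_neg (by omega)]; exact h.var y hy⟩

theorem Known.keep (h : Known I M₀ s) (hk : Keep s t) : Known I M₀ t :=
  h.congr (hk.var _ (by omega)) (hk.var _ (by omega)) fun a ha => hk.arr a (by omega)

/-- Move each woman of rank `b` (register 8) whose partner is not her partner in `Mz`. -/
def advance : Com :=
  .assign 9 (.add (.var 5) (.const 1)) ;;
  .loop (.lt (.const 1) (.add (.lt (.const 0) (.var 9))
      (.eq (.read 10 (.read 11 (.sub (.var 9) (.const 1)))) (.var 8))))
    (.assign 9 (.sub (.var 9) (.const 1)) ;;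
      .assign 25 (.read 1 (.read 11 (.var 9))) ;;
      .ite (.eq (.read 23 (.var 25)) (.var 8))
        (.assign 3 (.read 22 (.var 25)) ;;
          .ite (.eq (.read 4 (.var 3)) (.read 6 (.var 3))) .skip brk)
        .skip)

/-- The state of `advance` when the positions from number `y` on have been treated. -/
structure AdvInv (I : SMI n) (M₀ Mz : Equiv.Perm (Fin n)) (b : ℕ) (M : Equiv.Perm (Fin n))
    (s₀ : Store) (y : ℕ) (s : Store) (M' : Equiv.Perm (Fin n)) : Prop where
  cur : s.var 9 = y
  le : y ≤ s₀.var 5 + 1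
  keep : Keep s₀ s
  work : Work I s M'
  dom : I.Dom M M'
  sub : SMI.past I M' ⊆ SMI.past I M ∪ I.rotClosure (I.rotationsAt (SMI.graph M) b)
  treated : ∀ x, y ≤ x → x ≤ s₀.var 5 → s₀.arr 10 (s₀.arr 11 x) = b ∧
    ∀ i, s₀.arr 11 x = pos I i (M i) → M' i ≠ M i ∨ Mz i = M i

theorem AdvInv.setVar {b y : ℕ} {s₀ : Store} (h : AdvInv I M₀ Mz b M s₀ y s M') {x v : ℕ}
    (hx : x = 3 ∨ 21 ≤ x) : AdvInv I M₀ Mz b M s₀ y (s.setVar x v) M' :=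
  ⟨by rw [Store.setVar_var, if_neg (by omega)]; exact h.cur, h.le, h.keep.setVar (by omega),
    h.work.setVar (by omega), h.dom, h.sub, h.treated⟩

theorem AdvInv.next {b y : ℕ} {s₀ : Store} (h : AdvInv I M₀ Mz b M s₀ (y + 1) s M')
    (hb : s₀.arr 10 (s₀.arr 11 y) = b)
    (hc : ∀ i, s₀.arr 11 y = pos I i (M i) → M' i ≠ M i ∨ Mz i = M i) :
    AdvInv I M₀ Mz b M s₀ y (s.setVar 9 y) M' := by
  refine ⟨by simp, by have := h.le; omega, h.keep.setVar (by omega), h.work.setVar (by omega), h.dom,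
    h.sub, fun x h1 h2 => ?_⟩
  by_cases e : x = y
  · subst e
    exact ⟨hb, hc⟩
  · exact h.treated x (by omega) h2

/-- The treatment of one position. -/
theorem advStep_spec {b y : ℕ} {s₀ : Store} (hI : I.AllAssigned)
    (hB : n + I.totalLength + 2 ≤ B)
    (hk : Known I M₀ s₀) (hz : SMI.ManPess I Mz) (hlast : ∀ i : Fin n, s₀.arr 6 i = Mz i)
    (hM : SMI.Stab I M) (hp : s₀.var 5 < s₀.var 4) (h8 : s₀.var 8 = b)
    (hdeg : I.womanDegree (SMI.graph M) = b)
    (hs : AdvInv I M₀ Mz b M s₀ (y + 1) s M') (hb : s₀.arr 10 (s₀.arr 11 y) = b)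
    (hr : 900 * slack I (s.arr 20) + 700 * n + 750 ≤ r)
    (hQ : ∀ r' s' M'', AdvInv I M₀ Mz b M s₀ y s' M'' →
      r + 900 * slack I (s'.arr 20) ≤ r' + 900 * slack I (s.arr 20) + 450 → Q l r' s') :
    WP B (.assign 9 (.sub (.var 9) (.const 1)) ;;
      .assign 25 (.read 1 (.read 11 (.var 9))) ;;
      .ite (.eq (.read 23 (.var 25)) (.var 8))
        (.assign 3 (.read 22 (.var 25)) ;;
          .ite (.eq (.read 4 (.var 3)) (.read 6 (.var 3))) .skip brk)
        .skip) Q l r s := by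
  have hmt := manTotal_le (I := I)
  have hle := hs.le
  have hcnt := hk.sorted.le
  have hM' := hs.work.stab
  obtain ⟨i, j, hj, e1, e2, e3⟩ := hk.exists_entry (y := y) (by omega)
  have e4 := hs.work.rep.crk_eq j
  have e5 := hs.work.rep.husb_eq j
  have b4 := j.2
  have h9 := hs.cur
  have k8 := (hs.keep.var 8 (by omega)).trans h8
  rw [← hs.keep.arr 11 (by omega), ← hs.keep.arr 1 (by omega)] at e2
  rw [e3] at hb
  -- A position determines the woman by its entry, and then the man by his rank on her list.
  have hown : ∀ a, s₀.arr 11 y = pos I a (M a) → a = i ∧ M a = j := by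
    intro a ha
    have h1 := hk.tab.entry a (M a) (hM.mem_man a)
    rw [← ha, ← hs.keep.arr 11 (by omega), ← hs.keep.arr 1 (by omega), e2, Fin.val_inj] at h1
    have h2 := hk.tab.rank a (M a) (hM.mem_man a)
    rw [← ha, e3, ← h1] at h2
    exact ⟨(SMI.womanRank_inj (by simpa [h1] using hM.mem_woman a) h2.symm), h1.symm⟩
  simp [h9, k8, e2, e4, e5]
  repeat (refine ⟨by omega, ?_⟩)
  refine ⟨fun hrk => ?_, fun hrk => ?_⟩
  · have hsym : M'.symm j = i := SMI.womanRank_inj (hM'.mem_woman' j) (by omega)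
    have hMi' : M' i = j := by rw [← hsym]; simp
    have e6 := hs.work.rep.part i
    rw [hMi'] at e6
    have e7 : s.arr 6 i = Mz i := (congrFun (hs.keep.arr 6 (by omega)) _).trans (hlast i)
    have bi := i.2
    simp [hsym, e6, e7]
    repeat (refine ⟨by omega, ?_⟩)
    refine ⟨fun he => ?_, fun he => ?_⟩
    · rw [Fin.val_inj] at he
      refine ⟨by omega, hQ _ _ M' (((hs.next (by rw [e3, hb]) fun a ha => ?_).setVar
        (by omega)).setVar (by omega)) (by simp; omega)⟩
      obtain ⟨rfl, h1⟩ := hown a ha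
      exact Or.inr (he.symm.trans h1.symm)
    · rw [Fin.val_inj] at he
      generalize hs₁ : ((s.setVar 9 y).setVar 25 j).setVar 3 i = s₁
      have hk₁ : Keep s₀ s₁ := by
        rw [← hs₁]
        exact ((hs.keep.setVar (by omega)).setVar (by omega)).setVar (by omega)
      have hw₁ : Work I s₁ M' := by
        rw [← hs₁]
        exact ((hs.work.setVar (by omega)).setVar (by omega)).setVar (by omega)
      have h20 : s₁.arr = s.arr := by rw [← hs₁]; rfl
      have h39 : s₁.var 3 = i ∧ s₁.var 9 = y := by simp [← hs₁]
      obtain ⟨L₀, hL₀⟩ := hw₁.record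
      refine brk_spec (i := i) hB (hk.keep hk₁).tab hM' hw₁.rep hw₁.idle hL₀ hw₁.cap h39.1
        (by rw [h20]; omega) (fun r' s' M'' L hd hc => ?_) fun r' s' M'' L hd _ _ => ?_
      · have hdom := SMI.dom_of_elimSeq hI hM' hd.seq
        obtain ⟨⟨ρ, hρ, hiρ⟩, hbr⟩ := SMI.past_break hI hM' hd.stab hdom hd.moved hd.best
        rw [h20] at hc
        have hkk := hk₁.frame hd.frame
        refine hQ _ _ M'' ⟨(hd.frame.var 9 (by omega)).trans h39.2, by omega, hkk,
          ⟨hd.stab, hd.rep, hd.idle, ⟨_, hd.record⟩, hd.cap⟩, hs.dom.trans hdom, ?_,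
          fun x h1 h2 => ?_⟩ (by omega)
        -- The pair that is broken belongs to `M`, so its rotation is in `R_b(M)`: the rank of `j`
        -- is `b` in the present matching and by dominance no smaller in `M`, where `b` is the
        -- maximum. Equal ranks mean the same husband.
        · by_cases hMi : M i = j
          · refine (hbr ρ hρ hiρ).2.trans (Set.union_subset hs.sub (Set.subset_union_of_subset_right
              (SMI.rotClosure_mono ?_) _))
            rw [Set.singleton_subset_iff]
            exact ⟨hρ, i, M' i, hiρ, by simp [hMi, hMi'], by rw [hMi', hb]⟩
          · have h1 := hs.dom.womanRank_le hM hM' j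
            have h2 := SMI.womanRank_le_womanDegree (I := I) (M := M) (M.symm j)
            rw [Equiv.apply_symm_apply, hdeg] at h2
            refine absurd ?_ hMi
            rw [← SMI.womanRank_inj (i := M.symm j) (i' := i) (hM.mem_woman' j) (by omega)]
            simp
        · have hmv : ∀ a, M' a ≠ M a → M'' a ≠ M a := by
            intro a ha e
            have h3 := hs.dom.lt_of_ne hM ha
            have h4 := hdom a
            rw [e] at h4
            omega
          by_cases e : x = y
          · subst e
            refine ⟨by rw [e3, hb], fun a ha => ?_⟩
            obtain ⟨rfl, h3⟩ := hown a ha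
            left
            rw [h3, ← hMi']
            exact hd.moved
          · obtain ⟨h3, h4⟩ := hs.treated x (by omega) h2
            exact ⟨h3, fun a ha => (h4 a ha).imp_left (hmv a)⟩
      -- Failure is impossible: the stuck man would keep his partner in `Mz`, and this case has been
      -- excluded by the test.
      · have hdom := SMI.dom_of_elimSeq hI hM' hd.seq
        have := hd.stuck Mz hz.1 (hz.2 _ hd.stab)
        rw [hd.same, hMi'] at this
        exact absurd this.symm he
  -- The woman no longer has rank `b`, so a pair of `M` at this position was already broken by an
  -- earlier elimination.
  · refine ⟨by omega, hQ _ _ M' ((hs.next (by rw [e3, hb]) fun a ha => ?_).setVar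
      (by omega)) (by simp; omega)⟩
    obtain ⟨rfl, h1⟩ := hown a ha
    left
    intro h2
    apply hrk
    rw [show M'.symm j = a by rw [← h1, ← h2]; simp]
    exact hb

-- All pairs of `M` of rank `b` lie in the block of that rank ending at the pointer, since no pair
-- of `M` is above the pointer. Each break stays within the closure of `R_b(M)`, and at the end
-- every pair that can be broken is broken; so the order of the breaks is irrelevant. The cost of
-- 500 for each treated position is charged to the position.
set_option maxRecDepth 2000 in
theorem advance_spec {b : ℕ} (hI : I.AllAssigned) (hB : n + I.totalLength + 2 ≤ B)
    (hM₀ : SMI.ManOpt I M₀) (hz : SMI.ManPess I Mz) (hs : State I M₀ Mz s M Mopt)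
    (h8 : s.var 8 = b) (hdeg : I.womanDegree (SMI.graph M) = b)
    (hr : 900 * slack I (s.arr 20) + 500 * (s.var 5 + 1) + 700 * n + 800 ≤ r)
    (hQ : ∀ r' s' M' y, Keep s s' → Work I s' M' → I.Dom M M' →
      I.rotClosure (I.rotationsAt (SMI.graph M) b) \ SMI.past I M = SMI.past I M' \ SMI.past I M →
      (∀ x, y ≤ x → x ≤ s.var 5 → s.arr 10 (s.arr 11 x) = b) →
      r + 900 * slack I (s'.arr 20) + 500 * y ≤
        r' + 900 * slack I (s.arr 20) + 500 * (s.var 5 + 1) + 50 → Q l r' s') :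
    WP B advance Q l r s := by
  have hmt := manTotal_le (I := I)
  have hcnt := hs.known.sorted.le
  have hlt := hs.ptr.lt
  have hk := hs.known
  have hM := hs.work.stab
  unfold advance
  simp
  repeat (refine ⟨by omega, ?_⟩)
  refine WP_loop (fun l' r' s' => l' = l ∧ ∃ y M', AdvInv I M₀ Mz b M s y s' M' ∧
    r + 900 * slack I (s'.arr 20) + 500 * y ≤
        r' + 900 * slack I (s.arr 20) + 500 * (s.var 5 + 1) + 20) ?_ ?_
  · exact ⟨rfl, s.var 5 + 1, M, ⟨by simp, le_rfl, (Keep.refl s).setVar (by omega),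
      hs.work.setVar (by omega), .refl I M, Set.subset_union_left, by intro x; omega⟩,
      by simp; omega⟩
  · rintro l' r' s' ⟨rfl, y, M', hinv, hc⟩
    have h9 := hinv.cur
    have k8 := (hinv.keep.var 8 (by omega)).trans h8
    have k10 := hinv.keep.arr 10 (by omega)
    have k11 := hinv.keep.arr 11 (by omega)
    have hle := hinv.le
    simp only [Expr.eval, Expr.cost, h9, k8, k10, k11, Nat.reduceAdd]
    refine ⟨by omega, fun h => ?_, fun h => ?_⟩
    -- The loop test encodes a conjunction as a sum of two truth values exceeding 1. At `y = 0` the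
    -- truncated index makes it read position 0, which does no harm because the first truth value is
    -- 0.
    · have hend : y = 0 ∨ s.arr 10 (s.arr 11 (y - 1)) ≠ b := by
        by_contra! hc
        rw [if_pos (show 0 < y by omega), if_pos hc.2] at h
        exact one_ne_zero h
      refine hQ _ _ M' y hinv.keep hinv.work hinv.dom ?_ (fun x h1 h2 => (hinv.treated x h1 h2).1)
        (by omega)
      refine SMI.rotClosure_rotationsAt_diff hI hM₀ hz hM hinv.work.stab hinv.dom hinv.sub
        fun i hi => ?_
      obtain ⟨x, hx, e1, e2⟩ := hk.exists_index hM i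
      have hx' : x ≤ s.var 5 := by
        by_contra! hc
        have := hs.ptr.above x hc hx i (M i) (hM.mem_man i) e1
        simp at this
      refine (hinv.treated x ?_ hx').2 i e1
      by_contra! hc
      have h1 := hk.sorted.mono x (y - 1) (by omega) (by omega)
      have h2 := hk.sorted.mono (y - 1) (s.var 5) (by omega) hlt
      rw [hs.deg] at h2
      omega
    · have hy : 0 < y ∧ s.arr 10 (s.arr 11 (y - 1)) = b := by
        by_contra hc
        refine h (if_neg ?_)
        by_cases h1 : 0 < y
        · rw [if_neg fun h2 => hc ⟨h1, h2⟩]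
          simp only [h1, if_true]
          omega
        · rw [if_neg h1]
          split_ifs <;> omega
      obtain ⟨y, rfl⟩ : ∃ z, y = z + 1 := ⟨y - 1, by omega⟩
      refine advStep_spec hI hB hk hz hs.last hM hlt h8 hdeg hinv hy.2 (by omega)
        fun r₂ s₂ M₂ hinv₂ hc₂ => ⟨rfl, y, M₂, hinv₂, by omega⟩

/-- Store in register 14 whether the next iteration is to be carried out. -/
def colBody : Com :=
  .assign 14 (.const 0) ;;
  updateBest ;;
  .ite (.lt (.var 20) (.var 8))
    (advance ;; findDegree ;;
      .ite (.lt (.var 13) (.var 20)) .skip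
        (.ite (.eq (.read 10 (.read 11 (.var 5))) (.var 8)) .skip (.assign 14 (.const 1))))
    .skip

/-- The subroutine REDI-COL; in the end the given matching is restored. -/
def col : Com :=
  copy 20 13 ;; .assign 10 (.var 5) ;; .assign 13 (.var 20) ;; .assign 14 (.const 1) ;;
  .loop (.var 14) colBody ;;
  restart 13 ;; .assign 5 (.var 10)

/-- What is saved during a column operation that starts from `M`. -/
structure Saved (I : SMI n) (M : Equiv.Perm (Fin n)) (s₀ s : Store) : Prop where
  pos : ∀ i : Fin n, s.arr 13 i = pos I i (M i)
  ptr : s.var 10 = s₀.var 5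
  deg : s.var 13 = I.manDegree (SMI.graph M)
  var : ∀ x, x = 4 ∨ x = 7 ∨ x = 11 → s.var x = s₀.var x
  arr : ∀ a, a = 10 ∨ a = 11 → s.arr a = s₀.arr a

theorem Saved.congr {s₀ : Store} (h : Saved I M s₀ s)
    (hv : ∀ x, x = 4 ∨ x = 7 ∨ x = 10 ∨ x = 11 ∨ x = 13 → t.var x = s.var x)
    (ha : ∀ a, a = 10 ∨ a = 11 ∨ a = 13 → t.arr a = s.arr a) : Saved I M s₀ t :=
  ⟨by rw [ha 13 (by omega)]; exact h.pos, by rw [hv 10 (by omega), h.ptr],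
    by rw [hv 13 (by omega), h.deg], fun x hx => (hv x (by omega)).trans (h.var x hx),
    fun a hx => (ha a (by omega)).trans (h.arr a hx)⟩

/-- One iteration of the loop of REDI-COL: either it is the last one, or it leads to `M'`. -/
theorem colBody_spec {a : ℕ} (hI : I.AllAssigned) (hn : 0 < n) (hB : n + I.totalLength + 2 ≤ B)
    (hM₀ : SMI.ManOpt I M₀) (hz : SMI.ManPess I Mz) (hs : State I M₀ Mz s M Mopt)
    (h13 : s.var 13 = a)
    (hr : 900 * slack I (s.arr 20) + 1500 * (s.var 5 + 1) + 30 * (n * s.var 6) + 700 * n + 1000 ≤ r)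
    (hQ : ∀ r' s' s₁ M' K, SMI.graph K = I.best (SMI.graph M) (SMI.graph Mopt) →
      Displays I (.vars (SMI.graph M) (SMI.graph K)) s₁ →
      (∀ x, x = 4 ∨ x = 7 ∨ x = 10 ∨ x = 11 ∨ x = 13 → s'.var x = s.var x) →
      (∀ a, a = 10 ∨ a = 11 ∨ a = 13 → s'.arr a = s.arr a) →
      (s'.var 14 = 0 ∧ I.ColRun a (SMI.graph M) (SMI.past I M) (SMI.graph Mopt)
          [.vars (SMI.graph M) (SMI.graph K)] (SMI.graph K) ∧ Known I M₀ s' ∧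
          (∀ i : Fin n, s'.arr 5 i = K i) ∧ s'.var 6 = I.regretScore (SMI.graph K) ∧
          (∀ i : Fin n, s'.arr 6 i = Mz i) ∧
          r + 30 * (n * s'.var 6) ≤ r' + 30 * (n * s.var 6) + 900 * slack I (s.arr 20) +
            1500 * (s.var 5 + 1)) ∨
        (s'.var 14 = 1 ∧ (∀ ev res,
          I.ColRun a (SMI.graph M') (SMI.past I M') (SMI.graph K) ev res →
          I.ColRun a (SMI.graph M) (SMI.past I M) (SMI.graph Mopt)
            (.vars (SMI.graph M) (SMI.graph K) :: ev) res) ∧ State I M₀ Mz s' M' K ∧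
          r + 30 * (n * s'.var 6) + 900 * slack I (s'.arr 20) + 1500 * s'.var 5 + 10 ≤
            r' + 30 * (n * s.var 6) + 900 * slack I (s.arr 20) + 1500 * s.var 5) →
      Q (l ++ [s₁]) r' s') :
    WP B colBody Q l r s := by
  have hmt := manTotal_le (I := I)
  unfold colBody
  rw [WP_seq, WP_assign]
  refine ⟨by simp, by simp; omega, ?_⟩
  have hs₁ : State I M₀ Mz (s.setVar 14 0) M Mopt := hs.congr
    (fun x hx => by simp [show x ≠ 14 by omega]) (fun a _ => by simp)
  rw [WP_seq]
  refine updateBest_spec hB hs₁ (by simp; omega) fun r₂ s₂ K c2 hK hs₂ h8 ha₂ hv₂ => ?_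
  have hb := hK ▸ hs₂.displays
  have v14 : s₂.var 14 = 0 := by rw [hv₂ 14 (by omega) (by omega) (by omega) (by omega)]; simp
  have v5 : s₂.var 5 = s.var 5 := by
    rw [hv₂ 5 (by omega) (by omega) (by omega) (by omega)]; simp
  have a20 : s₂.arr 20 = s.arr 20 := by rw [ha₂ 20 (by omega)]; simp
  have hvs : ∀ x, x = 4 ∨ x = 7 ∨ x = 10 ∨ x = 11 ∨ x = 13 → s₂.var x = s.var x := fun x hx => by
    rw [hv₂ x (by omega) (by omega) (by omega) (by omega)]
    simp [show x ≠ 14 by omega]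
  have has : ∀ a, a = 10 ∨ a = 11 ∨ a = 13 → s₂.arr a = s.arr a := fun a hx => by
    rw [ha₂ a (by omega)]
    simp
  simp at c2
  have hd := hs₂.work.rep.deg
  rw [WP_ite]
  refine ⟨by simp; omega, fun h => ?_, fun h => ?_⟩
  · have hlt : I.manDegree (SMI.graph M) < I.womanDegree (SMI.graph M) := by
      simpa [hd, h8] using h
    simp only [Expr.cost]
    rw [WP_seq]
    refine advance_spec hI hB hM₀ hz hs₂ h8 rfl (by rw [a20, v5]; omega)
      fun r₃ s₃ M' y hk₃ hw₃ hdom hdiff hbucket c3 => ?_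
    have hp₃ : Ptr I s₃ M' := (hs₂.ptr.mono hs₂.work.stab hw₃.stab hdom).congr
      (hk₃.var _ (by omega)) (hk₃.var _ (by omega)) (hk₃.arr _ (by omega))
    have v5' : s₃.var 5 = s.var 5 := (hk₃.var _ (by omega)).trans v5
    rw [WP_seq]
    refine findDegree_spec hn hB (hs₂.known.keep hk₃) hw₃.stab hw₃.rep hp₃ (by rw [a20, v5] at c3; rw [v5']; omega)
      fun r₄ x c4 hx hp₄ hd₄ => ?_
    rw [v5'] at c4 hx
    rw [a20, v5] at c3
    have hElim : I.Elim (SMI.graph M) (SMI.past I M' \ SMI.past I M) (SMI.graph M') :=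
      SMI.elim_past hI hs₂.work.stab hw₃.stab hdom
    have hmd : s₃.var 20 = I.manDegree (SMI.graph M') := hw₃.rep.deg
    have h8' : s₃.var 8 = I.womanDegree (SMI.graph M) := (hk₃.var _ (by omega)).trans h8
    have h13' : s₃.var 13 = a := (hk₃.var _ (by omega)).trans ((hvs _ (by omega)).trans h13)
    have h14' : s₃.var 14 = 0 := (hk₃.var _ (by omega)).trans v14
    have hvs₃ : ∀ x, x = 4 ∨ x = 7 ∨ x = 10 ∨ x = 11 ∨ x = 13 → s₃.var x = s.var x :=
      fun x hx => (hk₃.var x (by omega)).trans (hvs x hx)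
    have has₃ : ∀ a, a = 10 ∨ a = 11 ∨ a = 13 → s₃.arr a = s.arr a :=
      fun a hx => (hk₃.arr a (by omega)).trans (has a hx)
    have hst : State I M₀ Mz (s₃.setVar 5 x) M' K := by
      refine ⟨(hs₂.known.keep hk₃).congr (by simp) (by simp) (by simp), hw₃.setVar (by omega), hp₄,
        by simpa using hd₄, ?_, ?_, ?_⟩
      · rw [Store.setVar_arr, hk₃.arr 5 (by omega)]
        exact hs₂.opt
      · rw [Store.setVar_var, if_neg (by omega), hk₃.var 6 (by omega)]
        exact hs₂.score
      · rw [Store.setVar_arr, hk₃.arr 6 (by omega)]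
        exact hs₂.last
    have v6 : s₃.var 6 = s₂.var 6 := hk₃.var 6 (by omega)
    have hend : (a < I.manDegree (SMI.graph M') ∨
        I.womanDegree (SMI.graph M') = I.womanDegree (SMI.graph M)) →
        I.ColRun a (SMI.graph M) (SMI.past I M) (SMI.graph Mopt)
          [.vars (SMI.graph M) (SMI.graph K)] (SMI.graph K) := fun h => by
      rw [hK]
      exact .elimStop hlt rfl (by rw [hdiff]; exact hElim) h
    have hfin : ∀ r', r₄ ≤ r' + 20 → (a < I.manDegree (SMI.graph M') ∨
        I.womanDegree (SMI.graph M') = I.womanDegree (SMI.graph M)) →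
        Q (l ++ [s₂]) r' (s₃.setVar 5 x) := fun r' hr' h => by
      refine hQ _ _ s₂ M K hK hs₂.displays (fun z hz => ?_) (fun z hz => ?_)
        (Or.inl ⟨by simp [h14'], hend h, hst.known, hst.opt, hst.score, hst.last, ?_⟩)
      · simp [show z ≠ 5 by omega, hvs₃ z hz]
      · simp [has₃ z hz]
      · simp [v6]
        omega
    simp [hmd, h13', hd₄, h8']
    refine ⟨by omega, fun h => ⟨by omega, hfin _ (by omega) (Or.inl h)⟩, fun h =>
      ⟨by omega, fun h' => ⟨by omega, hfin _ (by omega) (Or.inr h')⟩, fun h' => ⟨by omega, ?_⟩⟩⟩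
    -- The woman-degree has fallen, so the new pointer lies below the whole block just treated. The
    -- descent of the pointer thus pays for the treatment of the block and for the overhead of the
    -- iteration.
    have hxy : x < y ∧ x < s.var 5 := by
      have h1 : x < y := by
        by_contra! hc
        have := hbucket x hc (by omega)
        rw [← hk₃.arr 10 (by omega), ← hk₃.arr 11 (by omega), hd₄] at this
        exact h' this
      refine ⟨h1, lt_of_le_of_ne (by omega) fun e => h' ?_⟩
      have := hs₂.deg
      rw [v5, ← e, ← hk₃.arr 10 (by omega), ← hk₃.arr 11 (by omega), hd₄] at this
      exact this
    refine ⟨by omega, hQ _ _ s₂ M' K hK hs₂.displays (fun z hz => ?_) (fun z hz => ?_)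
      (Or.inr ⟨by simp, fun ev res hrun => ?_, hst.congr (fun z hz => ?_) (fun z hz => ?_), ?_⟩)⟩
    · simp [show z ≠ 14 ∧ z ≠ 5 by omega, hvs₃ z hz]
    · simp [has₃ z hz]
    · rw [hK] at hrun ⊢
      refine .step hlt rfl (by rw [hdiff]; exact hElim) (by omega) ?_
      rw [hdiff, SMI.past_union_diff hdom]
      exact hrun
    · simp [show z ≠ 14 by omega]
    · simp
    · simp [v6]
      omega
  · have hle : I.womanDegree (SMI.graph M) ≤ I.manDegree (SMI.graph M) := by
      by_contra! hc
      simp [hd, h8, hc] at h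
    simp only [Expr.cost]
    rw [WP_skip]
    refine ⟨by omega, hQ _ _ s₂ M K hK hs₂.displays hvs has (Or.inl ⟨v14, ?_, hs₂.known, hs₂.opt,
      hs₂.score, hs₂.last, by omega⟩)⟩
    rw [hK]
    exact .degreeStop hle

-- The eliminations use 900 for each unit of slack, the blocks and the pointer 1500 for each
-- position; both potentials start at most at `manTotal I`, whence 2400. As the variables of the
-- subroutine are local, matching and pointer are restored, and the caller loses none of its own
-- potential.
set_option maxRecDepth 8000 in
theorem col_spec (hI : I.AllAssigned) (hn : 0 < n) (hB : n + I.totalLength + 2 ≤ B)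
    (hM₀ : SMI.ManOpt I M₀) (hz : SMI.ManPess I Mz) (hs : State I M₀ Mz s M Mopt)
    (hr : 2400 * manTotal I + 1000 * n + 2000 + 30 * (n * s.var 6) ≤ r)
    (hQ : ∀ r' s' K ev lg, I.ColRun (I.manDegree (SMI.graph M)) (SMI.graph M) (SMI.past I M)
        (SMI.graph Mopt) ev (SMI.graph K) → List.Forall₂ (Displays I) ev lg →
      State I M₀ Mz s' M K → s'.var 5 = s.var 5 → s'.var 11 = s.var 11 →
      r + 30 * (n * s'.var 6) ≤
        r' + 30 * (n * s.var 6) + (2400 * manTotal I + 1000 * n + 2000) → Q (l ++ lg) r' s') :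
    WP B col Q l r s := by
  have hmt := manTotal_le (I := I)
  have hlt := hs.ptr.lt
  have hcnt := hs.known.sorted.le
  have hM := hs.work.stab
  unfold col
  rw [WP_seq]
  refine copy_spec (n := n) (by decide) hs.known.tab.size (by omega) (fun i hi => ?_) (by omega)
    fun r₁ s₁ c1 c2 c3 c4 => ?_
  · have h1 := hs.work.rep.pos ⟨i, hi⟩
    have := pos_lt_manTotal (hM.mem_man ⟨i, hi⟩)
    simp only at h1
    omega
  have hd := hs.work.rep.deg
  have hdn := manDegree_le hM
  simp [c3, hd]
  repeat (refine ⟨by omega, ?_⟩)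
  generalize hs₂ : ((s₁.setVar 10 (s.var 5)).setVar 13 (I.manDegree (SMI.graph M))).setVar 14 1 = s₂
  have hv₂ : ∀ x, x ≠ 10 → x ≠ 13 → x ≠ 14 → x ≠ 28 → s₂.var x = s.var x := fun x h1 h2 h3 h4 => by
    simp [← hs₂, h1, h2, h3, c3 x h4]
  have ha₂ : ∀ a, a ≠ 13 → s₂.arr a = s.arr a := fun a ha => by simp [← hs₂, c2 a ha]
  have hsv : Saved I M s s₂ := by
    refine ⟨fun i => ?_, by simp [← hs₂], by simp [← hs₂], fun x hx =>
      hv₂ x (by omega) (by omega) (by omega) (by omega), fun a ha => ha₂ a (by omega)⟩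
    rw [← hs.work.rep.pos, ← c4 i i.2, ← hs₂]
    simp
  have hst₂ : State I M₀ Mz s₂ M Mopt := hs.congr
    (fun x hx => hv₂ x (by omega) (by omega) (by omega) (by omega)) (fun a ha => ha₂ a (by omega))
  have h14 : s₂.var 14 = 1 := by simp [← hs₂]
  refine WP_loop (fun l' r' s' => ∃ K acc lg, l' = l ++ lg ∧ List.Forall₂ (Displays I) acc lg ∧
    Saved I M s s' ∧
    ((s'.var 14 = 0 ∧ I.ColRun (I.manDegree (SMI.graph M)) (SMI.graph M) (SMI.past I M)
        (SMI.graph Mopt) acc (SMI.graph K) ∧ Known I M₀ s' ∧ (∀ i : Fin n, s'.arr 5 i = K i) ∧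
        s'.var 6 = I.regretScore (SMI.graph K) ∧ (∀ i : Fin n, s'.arr 6 i = Mz i) ∧
        r + 30 * (n * s'.var 6) ≤
          r' + 30 * (n * s.var 6) + 2400 * manTotal I + 14 * n + 100) ∨
      (s'.var 14 = 1 ∧ ∃ N, (∀ ev res, I.ColRun (I.manDegree (SMI.graph M)) (SMI.graph N)
          (SMI.past I N) (SMI.graph K) ev res →
        I.ColRun (I.manDegree (SMI.graph M)) (SMI.graph M) (SMI.past I M) (SMI.graph Mopt)
          (acc ++ ev) res) ∧ State I M₀ Mz s' N K ∧
        r + 30 * (n * s'.var 6) + 900 * slack I (s'.arr 20) + 1500 * (s'.var 5 + 1) ≤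
          r' + 30 * (n * s.var 6) + 2400 * manTotal I + 14 * n + 50))) ?_ ?_
  · have h5 := hv₂ 5 (by omega) (by omega) (by omega) (by omega)
    have h6 := hv₂ 6 (by omega) (by omega) (by omega) (by omega)
    have h7 := slack_le_manTotal hst₂.work.rep
    refine ⟨Mopt, [], [], by simp, .nil, hsv, Or.inr ⟨h14, M, fun ev res h => h, hst₂, ?_⟩⟩
    rw [h5, h6]
    omega
  · rintro l' r' s' ⟨K, acc, lg, rfl, hlg, hsv', ⟨g1, g2, g3, g4, g5, g6, g7⟩ | ⟨g1, N, g2, g3, g4⟩⟩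
    · simp only [Expr.eval, Expr.cost, g1]
      refine ⟨by omega, fun _ => ?_, fun h => absurd rfl h⟩
      rw [WP_seq]
      refine restart_spec (a := 13) (r := r' - (1 + 1)) (by omega) hn hB g3.tab hM hsv'.pos (by omega)
        fun r₃ s₃ d1 d2 d3 _ => ?_
      have v10 : s₃.var 10 = s.var 5 := (d2.var _ (by omega)).trans hsv'.ptr
      have v4 : s₃.var 4 = s.var 4 := (d2.var _ (by omega)).trans (hsv'.var _ (by omega))
      have a10 : s₃.arr 10 = s.arr 10 := (d2.arr _ (by omega)).trans (hsv'.arr _ (by omega))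
      have a11 : s₃.arr 11 = s.arr 11 := (d2.arr _ (by omega)).trans (hsv'.arr _ (by omega))
      have v6 := d2.var 6 (by omega)
      simp [v10]
      repeat (refine ⟨by omega, ?_⟩)
      refine hQ _ _ K acc lg g2 hlg ⟨(g3.frame d2).congr (by simp) (by simp) (by simp),
        d3.setVar (by omega), hs.ptr.congr (by simp) (by simp [v4]) (by simp [a11]), ?_, fun i => ?_,
        ?_, fun i => ?_⟩ (by simp) ?_ ?_
      · simp [a10, a11, hs.deg]
      · rw [Store.setVar_arr, d2.arr 5 (by omega), g4]
      · simp [v6, g5]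
      · rw [Store.setVar_arr, d2.arr 6 (by omega), g6]
      · simp [d2.var 11 (by omega), hsv'.var 11 (by omega)]
      · simp [v6]
        omega
    · simp only [Expr.eval, Expr.cost, g1]
      refine ⟨by omega, fun h => absurd h (by decide), fun _ => ?_⟩
      refine colBody_spec (a := I.manDegree (SMI.graph M)) hI hn hB hM₀ hz g3 hsv'.deg (by omega)
        fun r₃ s₃ sₒ M' K' d1 d2 d3 d4 d5 => ?_
      refine ⟨K', acc ++ [.vars (SMI.graph N) (SMI.graph K')], lg ++ [sₒ], by simp,
        List.rel_append hlg (.cons d2 .nil), hsv'.congr d3 d4, ?_⟩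
      rcases d5 with ⟨e1, e2, e3, e4, e5, e6, e7⟩ | ⟨e1, e2, e3, e4⟩
      · exact Or.inl ⟨e1, g2 _ _ e2, e3, e4, e5, e6, by omega⟩
      · refine Or.inr ⟨e1, M', fun ev res h => ?_, e3, by omega⟩
        rw [List.append_assoc]
        exact g2 _ _ (e2 _ _ h)

end Ram

/-! ### The loops of REDI and the total time. -/

namespace Ram

variable {B : ℕ} {Q : List Store → ℕ → Store → Prop} {l : List Store} {r : ℕ} {s t : Store} {n : ℕ}
  {I : SMI n} {M M' M₀ Mz Mopt : Equiv.Perm (Fin n)}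

/-! # The algorithm -/

/-- Let the man of register 11 move to his next stable partner. -/
def move : Com :=
  .assign 7 (.var 20) ;; .assign 3 (.var 11) ;; brk ;; findDegree ;; .observe

/-- The search finds the best stable matching below `M` in which `i` has a new partner. `past_break`
gives one inclusion and `rotClosure_subset_past` the other to identify it with the elimination of
`c(φ(i, M(i))) \ Q`. -/
theorem move_spec {i : Fin n} (hI : I.AllAssigned) (hn : 0 < n) (hB : n + I.totalLength + 2 ≤ B)
    (hM₀ : SMI.ManOpt I M₀) (hz : SMI.ManPess I Mz) (hs : State I M₀ Mz s M Mopt)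
    (hi : s.var 11 = i) (hne : M i ≠ Mz i)
    (hr : 900 * slack I (s.arr 20) + 20 * s.var 5 + 700 * n + 1000 ≤ r)
    (hQ : ∀ r' s' M', I.Dom M M' →
      I.Move i (M i) (SMI.graph M) (SMI.past I M) (SMI.past I M' \ SMI.past I M) (SMI.graph M') →
      State I M₀ Mz s' M' Mopt → s'.var 11 = i → s'.var 7 = I.manDegree (SMI.graph M) →
      s'.var 6 = s.var 6 → slack I (s'.arr 20) < slack I (s.arr 20) →
      r + 900 * slack I (s'.arr 20) + 20 * s'.var 5 ≤
        r' + 900 * slack I (s.arr 20) + 20 * s.var 5 + 450 → Q (l ++ [s']) r' s') :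
    WP B move Q l r s := by
  have hd := hs.work.rep.deg
  have hdn := manDegree_le hs.work.stab
  have hi' := i.2
  have hM := hs.work.stab
  unfold move
  simp [hd, hi]
  repeat (refine ⟨by omega, ?_⟩)
  generalize hs₁ : (s.setVar 7 (I.manDegree (SMI.graph M))).setVar 3 i = s₁
  have hst : State I M₀ Mz s₁ M Mopt := hs.congr
    (fun x hx => by simp [← hs₁, show x ≠ 7 ∧ x ≠ 3 by omega]) (fun a _ => by simp [← hs₁])
  have hv : ∀ x, x ≠ 3 → x ≠ 7 → s₁.var x = s.var x := fun x h1 h2 => by simp [← hs₁, h1, h2]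
  have ha : s₁.arr = s.arr := by simp [← hs₁]
  obtain ⟨L₀, hL₀⟩ := hst.work.record
  refine brk_spec (i := i) hB hst.known.tab hM hst.work.rep hst.work.idle hL₀ hst.work.cap
    (by simp [← hs₁]) (by rw [ha]; omega) (fun r₂ s₂ M' L hb hc => ?_) fun r₂ s₂ M' L hf _ _ => ?_
  · have hdom := SMI.dom_of_elimSeq hI hM hb.seq
    have hsl := slack_lt hM hb.stab hdom hb.moved hs.work.rep.pos hb.rep.pos
    have hk₂ := hst.known.frame hb.frame
    have v5 : s₂.var 5 = s.var 5 := (hb.frame.var 5 (by omega)).trans (hv 5 (by omega) (by omega))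
    have hp₂ : Ptr I s₂ M' := (hst.ptr.mono hM hb.stab hdom).congr (hb.frame.var _ (by omega))
      (hb.frame.var _ (by omega)) (hb.frame.arr _ (by omega))
    rw [ha] at hc
    rw [WP_seq]
    refine findDegree_spec hn hB hk₂ hb.stab hb.rep hp₂ (by rw [v5]; omega)
      fun r₃ x c3 hx hp₃ hd₃ => ?_
    simp
    have v6 : s₂.var 6 = s.var 6 := (hb.frame.var 6 (by omega)).trans (hv 6 (by omega) (by omega))
    refine ⟨by omega, hQ _ _ M' hdom ?_ ⟨hk₂.congr (by simp) (by simp) (by simp),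
      Work.setVar ⟨hb.stab, hb.rep, hb.idle, ⟨_, hb.record⟩, hb.cap⟩ (by omega), hp₃,
      by simpa using hd₃, fun i => ?_, by simp [v6, hs.score], fun i => ?_⟩ ?_ ?_ (by simp [v6])
      (by simpa using hsl) (by simp; omega)⟩
    · obtain ⟨⟨ρ, hρ, hiρ⟩, hbr⟩ := SMI.past_break hI hM hb.stab hdom hb.moved hb.best
      refine ⟨ρ, hρ, hiρ, ?_, SMI.elim_past hI hM hb.stab hdom⟩
      have hcl := SMI.rotClosure_subset_past hI hM₀ hb.stab
        (Set.singleton_subset_iff.2 (hbr ρ hρ hiρ).1)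
      ext σ
      exact ⟨fun h => ⟨((hbr ρ hρ hiρ).2 h.1).resolve_left h.2, h.2⟩, fun h => ⟨hcl h.1, h.2⟩⟩
    · rw [Store.setVar_arr, hb.frame.arr 5 (by omega), ha, hs.opt]
    · rw [Store.setVar_arr, hb.frame.arr 6 (by omega), ha, hs.last]
    · rw [Store.setVar_var, if_neg (by omega), hb.frame.var 11 (by omega),
        hv 11 (by omega) (by omega), hi]
    · rw [Store.setVar_var, if_neg (by omega), hb.frame.var 7 (by omega), ← hs₁]
      simp
  · have h1 := hf.stuck Mz hz.1 (hz.2 _ hf.stab)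
    rw [hf.same] at h1
    exact absurd h1.symm hne

/-- The while loop of REDI for the man of register 11. -/
def manLoop : Com :=
  .loop (.lt (.add (.eq (.var 6) (.const 0)) (.eq (.read 4 (.var 11)) (.read 6 (.var 11))))
      (.lt (.var 20) (.read 10 (.read 11 (.var 5)))))
    (move ;;
      .ite (.lt (.var 7) (.var 20))
        (.ite (.eq (.add (.read 20 (.var 11)) (.const 1))
            (.add (.read 0 (.var 11)) (.var 20))) col .skip)
        .skip)

/-- The time for a column operation, apart from updates of the best matching. -/
def colTime (I : SMI n) : ℕ := 2400 * manTotal I + 1000 * n + 2000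

/-- One iteration of the while loop of REDI. -/
theorem manBody_spec {i : Fin n} (hI : I.AllAssigned) (hn : 0 < n) (hB : n + I.totalLength + 2 ≤ B)
    (hM₀ : SMI.ManOpt I M₀) (hz : SMI.ManPess I Mz) (hs : State I M₀ Mz s M Mopt)
    (hi : s.var 11 = i) (hne : M i ≠ Mz i)
    (hlt : I.manDegree (SMI.graph M) < I.womanDegree (SMI.graph M))
    (hr : 30 * (n * s.var 6) + 1500 * slack I (s.arr 20) + 20 * s.var 5 +
      colTime I * (I.womanDegree (SMI.graph M₀) - I.manDegree (SMI.graph M)) + 700 * n + 1000 ≤ r)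
    (hQ : ∀ r' s' M' K acc lg, List.Forall₂ (Displays I) acc lg → State I M₀ Mz s' M' K →
      s'.var 11 = i →
      (I.regretScore (SMI.graph K) ≠ 0 → ∀ ev res h,
        I.ManRun (SMI.graph Mz) i (SMI.graph M') (SMI.past I M') (SMI.graph K) ev res h →
        I.ManRun (SMI.graph Mz) i (SMI.graph M) (SMI.past I M) (SMI.graph Mopt) (acc ++ ev) res h) →
      (I.regretScore (SMI.graph Mopt) ≠ 0 → I.regretScore (SMI.graph K) = 0 →
        I.ManRun (SMI.graph Mz) i (SMI.graph M) (SMI.past I M) (SMI.graph Mopt) acc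
          (SMI.graph K) true) →
      r + 30 * (n * s'.var 6) + 1500 * slack I (s'.arr 20) + 20 * s'.var 5 +
          colTime I * (I.womanDegree (SMI.graph M₀) - I.manDegree (SMI.graph M')) + 50 ≤
        r' + 30 * (n * s.var 6) + 1500 * slack I (s.arr 20) + 20 * s.var 5 +
          colTime I * (I.womanDegree (SMI.graph M₀) - I.manDegree (SMI.graph M)) →
      Q (l ++ lg) r' s') :
    WP B (move ;;
      .ite (.lt (.var 7) (.var 20))
        (.ite (.eq (.add (.read 20 (.var 11)) (.const 1))
            (.add (.read 0 (.var 11)) (.var 20))) col .skip)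
        .skip) Q l r s := by
  have hM := hs.work.stab
  rw [WP_seq]
  refine move_spec hI hn hB hM₀ hz hs hi hne (by omega)
    fun r₂ s₂ M' hdom hmove hs₂ h11 h7 h6 hsl hc => ?_
  have hcond : I.LoopCond (SMI.graph Mz) i (SMI.graph M) (M i) :=
    ⟨by simp, by simpa using fun h => hne h.symm, hlt⟩
  have hd := hs₂.work.rep.deg
  have e1 : s₂.arr 0 i = startOf I.manList i := hs₂.known.tab.start _ i.2.le
  have e2 := hs₂.work.rep.pos i
  have e3 := pos_add_one (I := I) i (M' i)
  have hdeg := hdom.manDegree_le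
  have hw₀ := SMI.Dom.womanDegree_le hM₀.1 hM (hM₀.2 M hM)
  have hmono := Nat.mul_le_mul_left (colTime I) (show I.womanDegree (SMI.graph M₀) -
    I.manDegree (SMI.graph M') ≤ I.womanDegree (SMI.graph M₀) - I.manDegree (SMI.graph M) by omega)
  have hskip : ∀ r', r₂ ≤ r' + 40 → ¬ I.ColCond i (SMI.graph M) (SMI.graph M') →
      Q (l ++ [s₂]) r' s₂ := by
    intro r' hr' hno
    refine hQ _ _ M' Mopt [_] [s₂] (.cons hs₂.displays .nil) hs₂ h11 (fun _ ev res h hrun => ?_)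
      (fun h h' => absurd h' h) (by rw [h6]; omega)
    refine .move hcond hmove hno ?_
    rw [SMI.past_union_diff hdom]
    exact hrun
  simp [h7, hd, h11, e1, e2]
  refine ⟨by omega, fun hinc => ⟨by omega, fun heq => ?_, fun heq => ⟨by omega, ?_⟩⟩,
    fun hinc => ⟨by omega, ?_⟩⟩
  · have hcc : I.ColCond i (SMI.graph M) (SMI.graph M') := ⟨hinc, M' i, by simp, by omega⟩
    -- The man-degree has grown from a value below `d_W(M) ≤ d_W(M₀)`, so the truncated difference
    -- to `d_W(M₀)` falls by at least one and releases the time for one column operation.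
    have hmul := Nat.mul_le_mul_left (colTime I) (show I.womanDegree (SMI.graph M₀) -
      I.manDegree (SMI.graph M') + 1 ≤
        I.womanDegree (SMI.graph M₀) - I.manDegree (SMI.graph M) by omega)
    rw [Nat.mul_add, Nat.mul_one] at hmul
    have hF : colTime I = 2400 * manTotal I + 1000 * n + 2000 := rfl
    refine col_spec hI hn hB hM₀ hz hs₂ (by rw [h6, ← hF]; omega)
      fun r₃ s₃ K evc lg hrun hlg hs₃ h5 h11' hc₃ => ?_
    rw [← hF] at hc₃
    have hsl₃ : slack I (s₃.arr 20) = slack I (s₂.arr 20) := slack_congr fun a => by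
      rw [hs₃.work.rep.pos, hs₂.work.rep.pos]
    rw [List.append_assoc]
    rw [← SMI.past_union_diff hdom] at hrun
    refine hQ _ _ M' K _ _ (.cons hs₂.displays hlg) hs₃ (h11'.trans h11)
      (fun h0 ev res h hrun' => ?_) (fun _ h0 => .columnReturn hcond hmove hcc hrun h0)
      (by rw [hsl₃, h5]; rw [h6] at hc₃; omega)
    refine .column hcond hmove hcc hrun h0 ?_
    rw [SMI.past_union_diff hdom]
    exact hrun'
  · refine hskip _ (by omega) ?_
    rintro ⟨-, j, hj, he⟩
    simp at hj
    subst hj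
    omega
  · refine hskip _ (by omega) ?_
    rintro ⟨h, -⟩
    omega

end Ram

namespace Ram

variable {B : ℕ} {Q : List Store → ℕ → Store → Prop} {l : List Store} {r : ℕ} {s t : Store} {n : ℕ}
  {I : SMI n} {M M' M₀ Mz Mopt : Equiv.Perm (Fin n)}

/-- The time for the treatment of one man, apart from updates of the best matching. -/
def manTime (I : SMI n) (M₀ : Equiv.Perm (Fin n)) : ℕ :=
  colTime I * (I.womanDegree (SMI.graph M₀) - I.manDegree (SMI.graph M₀)) + 1520 * manTotal I +
    800 * n + 1500

/-- A derivation of `ManRun` is built from its end. The invariant therefore carries a function that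
prepends the finished iterations to any run of the remaining ones. -/
theorem manLoop_spec {i : Fin n} (hI : I.AllAssigned) (hn : 0 < n) (hB : n + I.totalLength + 2 ≤ B)
    (hM₀ : SMI.ManOpt I M₀) (hz : SMI.ManPess I Mz) (hs : State I M₀ Mz s M Mopt)
    (hi : s.var 11 = i) (h0 : I.regretScore (SMI.graph Mopt) ≠ 0)
    (hr : 30 * (n * s.var 6) + 1500 * slack I (s.arr 20) + 20 * s.var 5 +
      colTime I * (I.womanDegree (SMI.graph M₀) - I.manDegree (SMI.graph M)) + 700 * n + 1100 ≤ r)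
    (hQ : ∀ r' s' M' K acc lg, List.Forall₂ (Displays I) acc lg → State I M₀ Mz s' M' K →
      s'.var 11 = i →
      I.ManRun (SMI.graph Mz) i (SMI.graph M) (SMI.past I M) (SMI.graph Mopt) acc (SMI.graph K)
        (decide (I.regretScore (SMI.graph K) = 0)) →
      r + 30 * (n * s'.var 6) ≤
        r' + 30 * (n * s.var 6) + 1500 * slack I (s.arr 20) + 20 * s.var 5 +
          colTime I * (I.womanDegree (SMI.graph M₀) - I.manDegree (SMI.graph M)) + 50 →
      Q (l ++ lg) r' s') :
    WP B manLoop Q l r s := by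
  unfold manLoop
  refine WP_loop (fun l' r' s' => ∃ M' K acc lg, l' = l ++ lg ∧
    List.Forall₂ (Displays I) acc lg ∧ State I M₀ Mz s' M' K ∧ s'.var 11 = i ∧
    (I.regretScore (SMI.graph K) ≠ 0 → ∀ ev res h,
      I.ManRun (SMI.graph Mz) i (SMI.graph M') (SMI.past I M') (SMI.graph K) ev res h →
      I.ManRun (SMI.graph Mz) i (SMI.graph M) (SMI.past I M) (SMI.graph Mopt) (acc ++ ev) res h) ∧
    (I.regretScore (SMI.graph K) = 0 →
      I.ManRun (SMI.graph Mz) i (SMI.graph M) (SMI.past I M) (SMI.graph Mopt) acc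
        (SMI.graph K) true) ∧
    r + 30 * (n * s'.var 6) + 1500 * slack I (s'.arr 20) + 20 * s'.var 5 +
        colTime I * (I.womanDegree (SMI.graph M₀) - I.manDegree (SMI.graph M')) ≤
      r' + 30 * (n * s.var 6) + 1500 * slack I (s.arr 20) + 20 * s.var 5 +
        colTime I * (I.womanDegree (SMI.graph M₀) - I.manDegree (SMI.graph M))) ?_ ?_
  · exact ⟨M, Mopt, [], [], by simp, .nil, hs, hi, fun _ ev res h h' => h', fun h => absurd h h0,
      le_rfl⟩
  · rintro l' r' s' ⟨M', K, acc, lg, rfl, hlg, hs', h11, hrun, hret, hc⟩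
    have hd := hs'.work.rep.deg
    have e1 : s'.arr 4 i = M' i := hs'.work.rep.part i
    have e2 := hs'.last i
    -- For truth values, `a + b < c` holds exactly if `c` is true and both `a` and `b` are false.
    -- The early return at score 0 is part of the loop test.
    simp only [Expr.eval, Expr.cost, h11, hd, hs'.deg, e1, e2, hs'.score, Fin.val_inj,
      Nat.reduceAdd]
    refine ⟨by omega, fun h => ?_, fun h => ?_⟩
    · refine hQ _ _ M' K acc lg hlg hs' h11 ?_ (by omega)
      by_cases hK : I.regretScore (SMI.graph K) = 0
      · rw [decide_eq_true hK]
        exact hret hK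
      · rw [decide_eq_false hK]
        have := hrun hK [] _ _ (.exit (Mopt := SMI.graph K) ?_)
        · rwa [List.append_nil] at this
        · rintro ⟨j, h1, h2, h3⟩
          rw [SMI.mem_graph] at h1 h2
          replace h1 : M' i = j := h1
          replace h2 : ¬ Mz i = j := h2
          have h4 : ¬ M' i = Mz i := fun e => h2 (e.symm.trans h1)
          rw [if_neg hK, if_neg h4, if_pos h3] at h
          exact one_ne_zero h
    · have hlt : I.manDegree (SMI.graph M') < I.womanDegree (SMI.graph M') := by
        by_contra hc
        simp [hc] at h
      have hK : I.regretScore (SMI.graph K) ≠ 0 := by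
        intro hc
        rw [if_pos hc, if_pos hlt] at h
        exact h (if_neg (by omega))
      have hne : M' i ≠ Mz i := by
        intro hc
        rw [if_pos hc, if_pos hlt] at h
        exact h (if_neg (by omega))
      refine manBody_spec hI hn hB hM₀ hz hs' h11 hne hlt (by omega)
        fun r₃ s₃ M₃ K₃ acc₃ lg₃ d1 d2 d3 d4 d5 d6 => ?_
      refine ⟨M₃, K₃, acc ++ acc₃, lg ++ lg₃, by simp, List.rel_append hlg d1, d2, d3,
        fun h ev res h' hr => ?_, fun h => hrun hK _ _ _ (d5 hK h), by omega⟩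
      rw [List.append_assoc]
      exact hrun hK _ _ _ (d4 h _ _ _ hr)

/-- The treatment of the man of register 11. -/
def man : Com :=
  restart 12 ;; .assign 5 (.sub (.var 4) (.const 1)) ;; findDegree ;; .observe ;; manLoop

/-- With the pointer at the last entry nothing is above it. The sorted list contains the pairs of
`M`, so it is nonempty and the subtraction does not truncate. -/
theorem ptr_top (hk : Known I M₀ s) (hn : 0 < n) (hM : SMI.Stab I M) :
    Ptr I (s.setVar 5 (s.var 4 - 1)) M ∧ 0 < s.var 4 := by
  obtain ⟨y, hy, -⟩ := hk.exists_index hM ⟨0, hn⟩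
  exact ⟨⟨by simp; omega, fun x h1 h2 => by simp at h1 h2; omega⟩, by omega⟩

set_option maxRecDepth 8000 in
theorem man_spec {i : Fin n} (hI : I.AllAssigned) (hn : 0 < n) (hB : n + I.totalLength + 2 ≤ B)
    (hM₀ : SMI.ManOpt I M₀) (hz : SMI.ManPess I Mz) (hs : State I M₀ Mz s M Mopt)
    (hi : s.var 11 = i) (h0 : I.regretScore (SMI.graph Mopt) ≠ 0)
    (hr : 30 * (n * s.var 6) + manTime I M₀ ≤ r)
    (hQ : ∀ r' s' M' K acc lg, List.Forall₂ (Displays I) (.vars (SMI.graph M₀) (SMI.graph Mopt) :: acc) lg →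
      State I M₀ Mz s' M' K → s'.var 11 = i →
      I.ManRun (SMI.graph Mz) i (SMI.graph M₀) ∅ (SMI.graph Mopt) acc (SMI.graph K)
        (decide (I.regretScore (SMI.graph K) = 0)) →
      r + 30 * (n * s'.var 6) ≤ r' + 30 * (n * s.var 6) + manTime I M₀ → Q (l ++ lg) r' s') :
    WP B man Q l r s := by
  have hmt := manTotal_le (I := I)
  have hcnt := hs.known.sorted.le
  unfold manTime at hr hQ
  unfold man
  rw [WP_seq]
  refine restart_spec (a := 12) (by omega) hn hB hs.known.tab hM₀.1 hs.known.opt (by omega)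
    fun r₁ s₁ c1 c2 c3 _ => ?_
  have hk₁ := hs.known.frame c2
  obtain ⟨hp₁, hpos⟩ := ptr_top hk₁ hn hM₀.1
  have v4 := c2.var 4 (by omega)
  have v6 := c2.var 6 (by omega)
  rw [WP_seq, WP_assign]
  simp only [Expr.eval, Expr.cost]
  refine ⟨by omega, by omega, ?_⟩
  generalize hs₂ : s₁.setVar 5 (s₁.var 4 - 1) = s₂ at hp₁
  have hk₂ : Known I M₀ s₂ := hk₁.congr (by simp [← hs₂]) (by simp [← hs₂]) (by simp [← hs₂])
  have hw₂ : Work I s₂ M₀ := hs₂ ▸ c3.setVar (by omega)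
  have v5 : s₂.var 5 = s₁.var 4 - 1 := by simp [← hs₂]
  have hv : ∀ x, x ≠ 5 → s₂.var x = s₁.var x := fun x hx => by simp [← hs₂, hx]
  have ha : s₂.arr = s₁.arr := by simp [← hs₂]
  rw [WP_seq]
  refine findDegree_spec hn hB hk₂ hw₂.stab hw₂.rep hp₁ (by rw [v5]; omega)
    fun r₃ x c4 hx hp₃ hd₃ => ?_
  rw [WP_seq, WP_observe]
  refine ⟨by omega, ?_⟩
  have hst : State I M₀ Mz (s₂.setVar 5 x) M₀ Mopt := by
    refine ⟨hk₂.congr (by simp) (by simp) (by simp), hw₂.setVar (by omega), hp₃, by simpa using hd₃,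
      fun i => ?_, ?_, fun i => ?_⟩
    · rw [Store.setVar_arr, ha, c2.arr 5 (by omega), hs.opt]
    · rw [Store.setVar_var, if_neg (by omega), hv 6 (by omega), v6, hs.score]
    · rw [Store.setVar_arr, ha, c2.arr 6 (by omega), hs.last]
  have hsl := slack_le_manTotal hst.work.rep
  have u5 : (s₂.setVar 5 x).var 5 = x := by simp
  have u6 : (s₂.setVar 5 x).var 6 = s.var 6 := by
    rw [Store.setVar_var, if_neg (by omega), hv 6 (by omega), v6]
  have u11 : (s₂.setVar 5 x).var 11 = i := by
    rw [Store.setVar_var, if_neg (by omega), hv 11 (by omega), c2.var 11 (by omega), hi]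
  refine manLoop_spec hI hn hB hM₀ hz hst u11 h0 (by rw [u5, u6]; omega)
    fun r₄ s₄ M' K acc lg d1 d2 d3 d4 d5 => ?_
  rw [hM₀.past_eq hI] at d4
  rw [List.append_assoc]
  refine hQ _ _ M' K acc _ (.cons hst.displays d1) d2 d3 d4 ?_
  rw [u5, u6] at d5
  omega

/-- The for loop of REDI. -/
def men : Com :=
  .assign 11 (.const 0) ;;
  .loop (.lt (.eq (.var 6) (.const 0)) (.lt (.var 11) (.var 0)))
    (man ;; .assign 11 (.add (.var 11) (.const 1)))

/-- The credit for copies of the best matching is shared by all men and stands outside the product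
with `n`. If the score is 0 at the start, the loop is not entered and nothing is recorded. -/
theorem men_spec (hI : I.AllAssigned) (hn : 0 < n) (hB : n + I.totalLength + 2 ≤ B)
    (hM₀ : SMI.ManOpt I M₀) (hz : SMI.ManPess I Mz) (hs : State I M₀ Mz s M Mopt)
    (hr : 30 * (n * s.var 6) + n * (manTime I M₀ + 50) + 50 ≤ r)
    (hQ : ∀ r' (s' : Store) (K : Equiv.Perm (Fin n)) acc lg, List.Forall₂ (Displays I) acc lg →
      (∀ i : Fin n, s'.arr 5 i = K i) →
      (I.regretScore (SMI.graph Mopt) ≠ 0 → I.MenRun (SMI.graph M₀) (SMI.graph Mz)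
        (List.finRange n) (SMI.graph Mopt) acc (SMI.graph K)) →
      (I.regretScore (SMI.graph Mopt) = 0 → acc = [] ∧ K = Mopt) →
      r ≤ r' + 30 * (n * s.var 6) + n * (manTime I M₀ + 50) + 50 → Q (l ++ lg) r' s') :
    WP B men Q l r s := by
  unfold men
  simp
  refine ⟨by omega, ?_⟩
  refine WP_loop (fun l' r' s' => ∃ M' K acc lg, ∃ q ≤ n, l' = l ++ lg ∧
    List.Forall₂ (Displays I) acc lg ∧ State I M₀ Mz s' M' K ∧ s'.var 11 = q ∧
    (I.regretScore (SMI.graph K) ≠ 0 → ∀ ev res,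
      I.MenRun (SMI.graph M₀) (SMI.graph Mz) ((List.finRange n).drop q) (SMI.graph K) ev res →
      I.MenRun (SMI.graph M₀) (SMI.graph Mz) (List.finRange n) (SMI.graph Mopt) (acc ++ ev) res) ∧
    (I.regretScore (SMI.graph K) = 0 → I.regretScore (SMI.graph Mopt) ≠ 0 →
      I.MenRun (SMI.graph M₀) (SMI.graph Mz) (List.finRange n) (SMI.graph Mopt) acc (SMI.graph K)) ∧
    (I.regretScore (SMI.graph Mopt) = 0 → acc = [] ∧ K = Mopt) ∧
    r + 30 * (n * s'.var 6) + (n - q) * (manTime I M₀ + 50) ≤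
      r' + 30 * (n * s.var 6) + n * (manTime I M₀ + 50) + 10) ?_ ?_
  · refine ⟨M, Mopt, [], [], 0, by omega, by simp, .nil, hs.congr (fun x hx => ?_) (by simp),
      by simp, fun _ ev res h => by simpa using h, fun h h' => absurd h h', fun _ => ⟨rfl, rfl⟩, ?_⟩
    · simp [show x ≠ 11 by omega]
    · simp
      omega
  · rintro l' r' s' ⟨M', K, acc, lg, q, hq, rfl, hlg, hs', h11, hrun, hret, htriv, hc⟩
    simp only [Expr.eval, Expr.cost, h11, hs'.score, hs'.known.tab.size, Nat.reduceAdd]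
    refine ⟨by omega, fun h => ?_, fun h => ?_⟩
    · refine hQ _ _ K acc lg hlg hs'.opt (fun h0 => ?_) htriv (by omega)
      by_cases hK : I.regretScore (SMI.graph K) = 0
      · exact hret hK h0
      · have hqn : q = n := by
          by_contra hne
          rw [if_neg hK, if_pos (show q < n by omega)] at h
          exact one_ne_zero h
        subst hqn
        have := hrun hK [] (SMI.graph K) (by
          rw [List.drop_of_length_le (by simp)]
          exact .done)
        rwa [List.append_nil] at this
    · have hqn : q < n := by
        by_contra hc
        simp [hc] at h
      have hK : I.regretScore (SMI.graph K) ≠ 0 := by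
        intro hc
        rw [if_pos hc, if_pos hqn] at h
        exact h (if_neg (by omega))
      let i : Fin n := ⟨q, hqn⟩
      have hdrop : (List.finRange n).drop q = i :: (List.finRange n).drop (q + 1) := by
        rw [List.drop_eq_getElem_cons (by simpa using hqn)]
        simp [i]
      obtain ⟨d, hd⟩ : ∃ d, n = q + 1 + d := ⟨n - (q + 1), by omega⟩
      have hmul : (n - q) * (manTime I M₀ + 50) =
          (n - (q + 1)) * (manTime I M₀ + 50) + (manTime I M₀ + 50) := by
        rw [show n - q = n - (q + 1) + 1 by omega, Nat.succ_mul]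
      rw [WP_seq]
      refine man_spec (i := i) hI hn hB hM₀ hz hs' h11 hK (by omega)
        fun r₃ s₃ M₃ K₃ acc₃ lg₃ d1 d2 d3 d4 d5 => ?_
      have hi : (i : ℕ) = q := rfl
      simp only [WP_assign, Expr.eval, Expr.cost, d3, hi, Nat.reduceAdd]
      refine ⟨by omega, by omega, M₃, K₃, acc ++ (_ :: acc₃), lg ++ lg₃, q + 1, by omega, by simp,
        List.rel_append hlg d1, d2.congr (fun x hx => ?_) (by simp), by simp, fun h ev res hm => ?_,
        fun h h0 => ?_, fun h => ?_, ?_⟩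
      · simp [show x ≠ 11 by omega]
      · rw [decide_eq_false h] at d4
        rw [List.append_assoc]
        refine hrun hK _ _ ?_
        rw [hdrop]
        exact .next d4 hm
      · rw [decide_eq_true h] at d4
        refine hrun hK _ _ ?_
        rw [hdrop]
        exact .ret d4
      · rw [(htriv h).2] at hK
        exact absurd h hK
      · rw [Store.setVar_var, if_neg (by decide)]
        omega

/-- Algorithm REDI. -/
def redi : Com :=
  rankTable ;; sort ;; galeShapley ;; setup ;;
  .assign 5 (.sub (.var 4) (.const 1)) ;; findDegree ;;
  .assign 8 (.read 10 (.read 11 (.var 5))) ;;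
  .assign 6 (.add (.sub (.var 20) (.var 8)) (.sub (.var 8) (.var 20))) ;;
  .ite (.lt (.var 20) (.var 8)) (col ;; men) .skip

/-- Every man's list contains his partner. This absorbs terms such as `n * n` into `n * manTotal I`.
-/
theorem le_manTotal (hM : SMI.Stab I M) : n ≤ manTotal I := by
  unfold manTotal
  rw [startOf_eq_sum]
  calc n = ∑ _i : Fin n, 1 := by simp
    _ ≤ _ := Finset.sum_le_sum fun i _ => List.length_pos_of_mem (hM.mem_man i)

theorem WP.exists_exec {c : Com} (h : WP B c Q l r s) :
    ∃ log t s', Exec B c s log t s' ∧ t ≤ r ∧ Q (l ++ log) (r - t) s' := by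
  unfold WP at h
  exact h

/-- The time for the tables and the man-optimal stable matching. -/
def tableTime (I : SMI n) : ℕ :=
  (40 * n + 100) * manTotal I + 40 * n + 40 + ((40 * manTotal I + 60) * n + 40) +
    (100 * (manTotal I + n * (n + 1)) + 300 * n + 300)

set_option maxRecDepth 8000 in
theorem tables_spec {c : Com} (hI : I.AllAssigned) (hB : n + I.totalLength + 2 ≤ B)
    (hr : tableTime I ≤ r)
    (hQ : ∀ r' s' M₀, SMI.ManOpt I M₀ → Tab I s' → Sorted I s' →
      (∀ i : Fin n, s'.arr 20 i = pos I i (M₀ i)) → r ≤ r' + tableTime I → WP B c Q l r' s') :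
    WP B (rankTable ;; sort ;; galeShapley ;; c) Q l r (inputStore I) := by
  unfold tableTime at hr hQ
  rw [WP_seq]
  refine rankTable_spec hB (input_inputStore I) (by omega) fun r₁ s₁ c1 hin₁ ht₁ => ?_
  rw [WP_seq]
  refine sort_spec hB ht₁ (by omega) fun r₂ s₂ c2 ha₂ h0₂ ht₂ hs₂ => ?_
  rw [WP_seq]
  refine galeShapley_spec hI hB ht₂ (hin₁.congr (h0₂.trans hin₁.size.symm)
    fun a ha => ha₂ a (by omega)) (by omega) fun r₃ s₃ M₀ c3 hM₀ hp h0₃ h4₃ ha₃ => ?_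
  have ha : ∀ a, a < 20 → s₃.arr a = s₂.arr a := fun a ha => ha₃ a (by omega) (by omega) (by omega)
  refine hQ _ _ M₀ hM₀ ⟨h0₃, ?_, ?_, ?_⟩ ⟨?_, ?_, ?_, ?_⟩ hp (by omega)
  · rw [ha 0 (by omega)]; exact ht₂.start
  · rw [ha 1 (by omega)]; exact ht₂.entry
  · rw [ha 10 (by omega)]; exact ht₂.rank
  · rw [h4₃]; exact hs₂.le
  · rw [h4₃, ha 11 (by omega)]; exact hs₂.lt
  · rw [h4₃, ha 11 (by omega), ha 10 (by omega)]; exact hs₂.mono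
  · rw [h4₃, ha 11 (by omega), ha 10 (by omega)]; exact hs₂.surj

/-- Existence is extracted from the correctness of the program: deferred acceptance halts in time,
and its result is man-optimal. -/
theorem exists_manOpt (hI : I.AllAssigned) : ∃ M₀, SMI.ManOpt I M₀ := by
  obtain ⟨-, -, -, -, -, h⟩ := (tables_spec (c := .skip) (l := []) (r := tableTime I + 1)
    (Q := fun _ _ _ => ∃ M₀, SMI.ManOpt I M₀) hI le_rfl (by omega)
    fun r' s' M₀ h _ _ _ hr => by
      rw [WP_skip]
      exact ⟨by omega, M₀, h⟩).exists_exec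
  exact h

/-- The time for everything before the first column operation. -/
def initTime (I : SMI n) : ℕ :=
  tableTime I + ((2300 * manTotal I + 700 * n + 1400) * n + 200) + 20 * manTotal I + 100

/-- The time for everything, when `D` is the regret-equality score of the man-optimal matching. -/
def totalTime (I : SMI n) (D : ℕ) : ℕ :=
  initTime I + 30 * (n * D) + colTime I +
    (n * (colTime I * D + 1520 * manTotal I + 800 * n + 1500 + 50) + 50)

/-- What the execution of REDI has to achieve. -/
def Achieved (I : SMI n) (M₀ : Equiv.Perm (Fin n)) (lg : List Store) (s : Store) : Prop :=
  ∃ ev out, I.RediRun (SMI.graph M₀) ev out ∧ List.Forall₂ (Displays I) ev lg ∧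
    HoldsMatching (s.arr 5) out

/-- The search, started from `M₀`. -/
theorem search_spec {sₒ : Store} (hI : I.AllAssigned) (hn : 0 < n) (hB : n + I.totalLength + 2 ≤ B)
    (hM₀ : SMI.ManOpt I M₀) (hz : SMI.ManPess I Mz)
    (ho : Displays I (.setup (SMI.graph M₀) (SMI.graph Mz)) sₒ) (hs : State I M₀ Mz s M₀ M₀)
    (hlt : I.manDegree (SMI.graph M₀) < I.womanDegree (SMI.graph M₀))
    (hr : 30 * (n * s.var 6) + colTime I + (n * (manTime I M₀ + 50) + 50) ≤ r) :
    WP B (col ;; men) (fun lg _ s => Achieved I M₀ lg s) [sₒ] r s := by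
  have hF : colTime I = 2400 * manTotal I + 1000 * n + 2000 := rfl
  rw [WP_seq]
  refine col_spec hI hn hB hM₀ hz hs (by omega) fun r₁ s₁ K ev lg hrun hlg hs₁ _ _ c1 => ?_
  refine men_spec hI hn hB hM₀ hz hs₁ (by omega) fun r₂ s₂ K' ev' lg' hlg' hK' h1 h2 _ => ?_
  rw [hM₀.past_eq hI] at hrun
  have hout : HoldsMatching (s₂.arr 5) (SMI.graph K') := fun i j => by
    rw [hK', SMI.mem_graph, Fin.val_inj]
  -- A score of 0 after the first column operation means that REDI returns at once; the loop over
  -- the men then contributes an empty log and no change.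
  by_cases h0 : I.regretScore (SMI.graph K) = 0
  · obtain ⟨rfl, rfl⟩ := h2 h0
    obtain rfl : lg' = [] := by simpa using hlg'
    refine ⟨_, _, .returnFirst (hM₀.isManOptimal hI) (hz.isWomanOptimal hI) hlt hrun h0, ?_, hout⟩
    rw [List.append_nil]
    exact .cons ho hlg
  · refine ⟨_, _, .returnLater (hM₀.isManOptimal hI) (hz.isWomanOptimal hI) hlt hrun h0 (h1 h0), ?_,
      hout⟩
    rw [List.append_assoc]
    exact .cons ho (List.rel_append hlg hlg')

theorem ManOpt.unique (h : SMI.ManOpt I M) (h' : SMI.ManOpt I M') : M = M' :=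
  Equiv.ext fun i => h.1.eq_of_rank (le_antisymm (h.2 M' h'.1 i) (h'.2 M h.1 i))

set_option maxRecDepth 8000 in
theorem redi_spec (hI : I.AllAssigned) (hn : 0 < n) (hB : n + I.totalLength + 2 ≤ B)
    (hM₀ : SMI.ManOpt I M₀) : ∃ t ≤ totalTime I (I.womanDegree (SMI.graph M₀) -
      I.manDegree (SMI.graph M₀)), CarriesOut B redi I (SMI.graph M₀) t := by
  suffices h : WP B redi (fun lg _ s => Achieved I M₀ lg s) []
      (totalTime I (I.womanDegree (SMI.graph M₀) - I.manDegree (SMI.graph M₀))) (inputStore I) by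
    obtain ⟨lg, t, s, h1, h2, ev, out, h3, h4, h5⟩ := h.exists_exec
    exact ⟨t, h2, ev, out, lg, s, h3, h1, h4, h5⟩
  have hmt := manTotal_le (I := I)
  generalize hr : totalTime I (I.womanDegree (SMI.graph M₀) - I.manDegree (SMI.graph M₀)) = r
  unfold totalTime initTime at hr
  unfold redi
  refine tables_spec hI hB (by omega) fun r₁ s₁ M₁ hM₁ ht₁ hs₁ hp₁ c1 => ?_
  -- The time bound is stated for a matching fixed in advance; it is the one that the program
  -- computes.
  obtain rfl := ManOpt.unique hM₀ hM₁
  rw [WP_seq]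
  refine setup_spec hI hn hB hM₀ ht₁ hs₁ hp₁ (by omega)
    fun r₂ s₂ sₒ Mz c2 hz ho hk₂ hw₂ h5₂ h6₂ => ?_
  rw [List.nil_append]
  have hcnt := hk₂.sorted.le
  obtain ⟨hp₂, hpos⟩ := ptr_top hk₂ hn hM₀.1
  rw [WP_seq, WP_assign]
  simp only [Expr.eval, Expr.cost, Nat.reduceAdd]
  refine ⟨by omega, by omega, ?_⟩
  generalize hs₃ : s₂.setVar 5 (s₂.var 4 - 1) = s₃ at hp₂
  have hk₃ : Known I M₀ s₃ := hk₂.congr (by simp [← hs₃]) (by simp [← hs₃]) (by simp [← hs₃])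
  have hw₃ : Work I s₃ M₀ := hs₃ ▸ hw₂.setVar (by omega)
  have v5 : s₃.var 5 = s₂.var 4 - 1 := by simp [← hs₃]
  have ha : s₃.arr = s₂.arr := by simp [← hs₃]
  rw [WP_seq]
  refine findDegree_spec hn hB hk₃ hw₃.stab hw₃.rep hp₂ (by rw [v5]; omega)
    fun r₄ x c4 hx hp₄ hd₄ => ?_
  have hdeg := hw₃.rep.deg
  have hscore := SMI.regretScore_eq (I := I) (SMI.graph M₀)
  have b1 := womanDegree_le hM₀.1
  have b2 := manDegree_le hM₀.1
  simp [hd₄, hdeg, ← hscore]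
  repeat (refine ⟨by omega, ?_⟩)
  generalize hs₅ : ((s₃.setVar 5 x).setVar 8 (I.womanDegree (SMI.graph M₀))).setVar 6
    (I.regretScore (SMI.graph M₀)) = s₅
  have hst : State I M₀ Mz s₅ M₀ M₀ := by
    rw [← hs₅]
    refine ⟨hk₃.congr (by simp) (by simp) (by simp),
      ((hw₃.setVar (by omega)).setVar (by omega)).setVar (by omega),
      hp₄.congr (by simp) (by simp) (by simp), by simpa using hd₄, ?_, by simp, ?_⟩
    · simpa [ha] using h5₂
    · simpa [ha] using h6₂
  have v6 : s₅.var 6 = I.regretScore (SMI.graph M₀) := hst.score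
  refine ⟨fun hlt => ?_, fun hle => ⟨by omega, ?_⟩⟩
  -- In this branch the truncated difference of the degrees, which governs the time, is the initial
  -- score.
  · have hD : I.regretScore (SMI.graph M₀) =
        I.womanDegree (SMI.graph M₀) - I.manDegree (SMI.graph M₀) := by omega
    rw [← WP_seq]
    refine search_spec hI hn hB hM₀ hz ho hst hlt ?_
    rw [v6, hD]
    unfold manTime
    omega
  · exact ⟨_, _, .returnManOptimal (hM₀.isManOptimal hI) (hz.isWomanOptimal hI) (by omega),
      .cons ho .nil, fun i j => by rw [hst.opt, SMI.mem_graph, Fin.val_inj]⟩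

/-- Every summand is a constant times one of `n * m`, `n * n`, `m`, `n`, 1, possibly times `D`. With
`1 ≤ n ≤ m` each is at most that constant times `max 1 D * n * m`, and 30000 exceeds the sum of the
constants. -/
theorem totalTime_le (hn : 0 < n) (h : n ≤ manTotal I) (D : ℕ) :
    totalTime I D ≤ 30000 * (max 1 D * n * manTotal I) := by
  unfold totalTime initTime tableTime colTime
  generalize manTotal I = m at *
  obtain ⟨d, hd⟩ : ∃ d, max 1 D = d := ⟨_, rfl⟩
  have hd1 : 1 ≤ d := hd ▸ le_max_left _ _
  have hdD : D ≤ d := hd ▸ le_max_right _ _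
  rw [hd]
  have h1 : n * m ≤ d * (n * m) := Nat.le_mul_of_pos_left _ hd1
  have h2 : n * n ≤ n * m := Nat.mul_le_mul_left n h
  have h3 : m ≤ n * m := Nat.le_mul_of_pos_left _ hn
  have h4 : D * (n * m) ≤ d * (n * m) := Nat.mul_le_mul_right _ hdD
  have h5 : D * n ≤ D * (n * m) := Nat.mul_le_mul_left D (h.trans h3)
  have h6 : D * (n * n) ≤ D * (n * m) := Nat.mul_le_mul_left D h2
  have e : d * n * m = d * (n * m) := Nat.mul_assoc _ _ _
  rw [e]
  ring_nf at *
  omega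

end Ram

theorem mainTheorem2 :
    ∃ (P : Ram.Com) (C : ℕ), ∀ (n : ℕ) (I : SMI n), 0 < n → I.AllAssigned →
      ∃ (M₀ : PairSet n) (t : ℕ),
        I.IsManOptimal M₀ ∧
        Ram.CarriesOut ((n + I.totalLength + 2) ^ C) P I M₀ t ∧
        t ≤ C * (max 1 ((I.manDegree M₀ : ℤ) - (I.womanDegree M₀ : ℤ)).natAbs
          * n * I.totalLength) := by
  -- Only two properties matter: `C ≠ 0` makes the word bound at least `n + I.totalLength + 2`, and
  -- `30000 ≤ C` gives the time bound. The value is hidden so that the power is never evaluated.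
  obtain ⟨C, hC0, hC⟩ : ∃ C : ℕ, C ≠ 0 ∧ 30000 ≤ C := ⟨30000, by decide, le_rfl⟩
  refine ⟨Ram.redi, C, fun n I hn hI => ?_⟩
  obtain ⟨M₀, hM₀⟩ := Ram.exists_manOpt hI
  obtain ⟨t, ht, h⟩ := Ram.redi_spec hI hn (Nat.le_self_pow hC0 _) hM₀
  refine ⟨SMI.graph M₀, t, hM₀.isManOptimal hI, h, ht.trans ?_⟩
  refine (Ram.totalTime_le hn (Ram.le_manTotal hM₀.1) _).trans (Nat.mul_le_mul hC
    (Nat.mul_le_mul (Nat.mul_le_mul_right _ (max_le_max le_rfl ?_)) Ram.manTotal_le))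
  omega
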